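/- **Setting.** Let $\sigma:\mathbb R\to\mathbb R$ be $C^2$ with $|\sigma|\le\sigma_0$, $|\sigma'|\le\sigma_1$, $|\sigma''|\le\sigma_2$. For an even width $m\ge 2$ and $w=[(c_i,W_i)]_{i\in[m]}\in\mathbb R^{m(d+1)}$ let $$\varphi(x;w)=\frac1{\sqrt m}\sum_{i=1}^m c_i\,\sigma(\langle W_i,x\rangle),\qquad x\in\mathbb R^d .$$ The initial parameter $w_0=[(c_0^{(i)},W_0^{(i)})]_{i\in[m]}$ is random: $(c_0^{(i)},W_0^{(i)})$, $i\le m/2$, are i.i.d. $\mathcal N(0,I_{d+1})$, and $c_0^{(i+m/2)}=-c_0^{(i)}$, $W_0^{(i+m/2)}=W_0^{(i)}$. For $\bar v_c,\bar v_W\ge 0$, let $\mathcal F_{\mathrm{NTK}}$ be the set of all functions $$x\mapsto\mathbb E_{(c,W)\sim\mathcal N(0,I_{d+1})}\big[v_c(c,W)\,\sigma(\langle W,x\rangle)+\langle v_W(c,W),\,c\,x\,\sigma'(\langle W,x\rangle)\rangle\big]$$ with measurable $v_c:\mathbb R^{d+1}\to\mathbb R$, $v_W:\mathbb R^{d+1}\to\mathbb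 R^d$ such that $|v_c|\le\bar v_c$ and $\|v_W\|_2\le\bar v_W$ everywhere. Put $\rho=\|(\bar v_c,\bar v_W)\|_2$ and $\mathcal C=\mathcal B_2(w_0,\rho)$, the closed Euclidean ball. The training samples $z_j=(x_j,y_j)$, $j\in[n]$, satisfy $\|x_j\|_2\le1$, $|y_j|\le1$ and $y_j=f^\star(x_j)$ for some $f^\star\in\mathcal F_{\mathrm{NTK}}$. For every sample $z$ the loss $u\mapsto\ell(u;z)$ is twice differentiable, $\nu$-strongly convex with $\nu>0$, and $\beta_K$-Lipschitz on each compact $K\subset\mathbb R$; moreover $\ell(y_j;z_j)=0$ for all $j$. The empirical risk is $\widehat{\mathcal R}(w)=\frac1n\sum_{j}\ell(\varphi(x_j;w);z_j)$. Let $$\mathrm{Lip}_\varphi=\sup_{w\in\mathcal C,\,\|x\|\le1}\|\nabla_w\varphi(x;w)\|_2,\quad M=\sup_{w\in\mathcal C,\,\|x\|\le1}|\varphi(x;w)|,\quad K=[-\max(1,M),\max(1,M)],\quad \mathrm{Lip}_\ell=\beta_K .$$ **Algorithm (SGN).** Fix a batch size $1\le B\le n$, and let $I_0,I_1,\dots$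 be independent uniformly random $B$-element subsets of $[n]$, independent of $w_0$. Let $J_t(w)$ be the matrix with rows $\nabla_w\varphi(x_j;w)^\top$, $j\in I_t$, and $G_t(w)=[\ell'(\varphi(x_j;w);z_j)]_{j\in I_t}$. With $\alpha,\gamma>0$, $\xi\ge 2/\nu$, $\eta=\xi\alpha$, $\lambda=\gamma\alpha\,\mathrm{Lip}_\varphi^2B$ and $H_k=\alpha\sum_{t=0}^kJ_t(w_t)^\top J_t(w_t)+\lambda I$, set $$w_{k+1}\in\arg\min_{w\in\mathcal C}\ \big\|w-\big(w_k-\eta H_k^{-1}J_k(w_k)^\top G_k(w_k)\big)\big\|_{H_k}^2,\qquad \widehat w_k=\frac1k\sum_{t=0}^{k-1}w_t .$$ Write $\mathbb E_0=\mathbb E[\,\cdot\mid w_0]$ and $$\bar r_k=\operatorname{rank}\Big(\frac1k\sum_{t=0}^{k-1}\mathbb E_0\Big[\frac1n\sum_{j=1}^n\nabla_w\varphi(x_j;w_t)\nabla_w\varphi(x_j;w_t)^\top\Big]\Big).$$ **Claim.** There are an absolute exponent $q\in\mathbb N$ and a constant $A>0$ depending only on $\sigma_0,\sigma_1,\sigma_2,\xi,\gamma$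 such that, for every $\delta\in(0,1]$, with $$Q=A\,(1+\log(n/\delta))^q\,(1+\rho)^q ,$$ the following holds with probability at least $1-\delta$ over $w_0$. One has $M\le Q$, and for all $\alpha>0$ and all $k\ge2$: (i) for every $D\ge0$ with $|\ell'(u;z_j)|\le D\,|u-y_j|$ for all $u\in K$ and $j\in[n]$ (for example $D=1$ for the square loss; a finite such $D$ always exists if $\ell(\cdot\,;z_j)$ is minimal at $y_j$ for every $j$), $$\mathbb E_0\,\widehat{\mathcal R}(\widehat w_k)\le Q\,(1+\mathrm{Lip}_\ell+D)^2\Big(\frac{\bar r_k\log k}{k}+\frac1{\sqrt m}\Big);$$ (ii) with no reference to $D$, $$\mathbb E_0\,\widehat{\mathcal R}(\widehat w_k)\le Q\,(1+\mathrm{Lip}_\ell)^2\Big(\frac{\bar r_k\log k}{k}+\frac{\sqrt{\log m}}{\sqrt m}\Big).$$ -/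

import Mathlib

open MeasureTheory ProbabilityTheory
open scoped NNReal ENNReal Gradient RealInnerProductSpace

namespace SGN

noncomputable section

/-! ### Losses, data and empirical risk -/

/-- A sample `(x, y)` with input `x ∈ ℝᵈ` and output `y ∈ ℝ`. -/
abbrev Sample (d : ℕ) : Type := EuclideanSpace ℝ (Fin d) × ℝ

/-- The standing assumption on the loss `u ↦ ℓ u z` at a predicted value `u` for a sample `z` of the
sample space `Z`: it is twice differentiable, `ν`-strongly convex, and on every compact set `K` it is
Lipschitz with constant `β K`, uniformly in `z`. -/
structure IsLoss {d : ℕ} (Z : Set (Sample d)) (ν : ℝ) (β : Set ℝ → ℝ≥0)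
    (ℓ : ℝ → Sample d → ℝ) : Prop where
  differentiable : ∀ z ∈ Z, Differentiable ℝ fun u => ℓ u z
  differentiable_deriv : ∀ z ∈ Z, Differentiable ℝ (deriv fun u => ℓ u z)
  pos : 0 < ν
  strongConvex : ∀ z ∈ Z, StrongConvexOn Set.univ ν fun u => ℓ u z
  lipschitz : ∀ z ∈ Z, ∀ K : Set ℝ, IsCompact K → LipschitzOnWith (β K) (fun u => ℓ u z) K

/-- The empirical risk of a predictor `f` on the training set `s`. -/
def empRisk {d n : ℕ} (ℓ : ℝ → Sample d → ℝ) (s : Fin n → Sample d)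
    (f : EuclideanSpace ℝ (Fin d) → ℝ) : ℝ :=
  (1 / (n : ℝ)) * ∑ j, ℓ (f (s j).1) (s j)

/-! ### Stochastic Gauss-Newton for a parametric predictor `φ w x` -/

section Algorithm

variable {p : Type} [Fintype p] [DecidableEq p] {d n : ℕ}

/-- The Jacobian `J(w)` on the batch `I`: its rows are the gradients `∇_w φ(x_j; w)`, `j ∈ I`. -/
def jacobian (φ : EuclideanSpace ℝ p → EuclideanSpace ℝ (Fin d) → ℝ) (s : Fin n → Sample d)
    (I : Finset (Fin n)) (w : EuclideanSpace ℝ p) : Matrix I p ℝ :=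
  Matrix.of fun j a => (∇ (fun v => φ v (s j).1) w) a

/-- The vector `G(w)` of the loss derivatives `ℓ'(φ(x_j; w); z_j)`, `j ∈ I`. -/
def lossGrad (φ : EuclideanSpace ℝ p → EuclideanSpace ℝ (Fin d) → ℝ) (ℓ : ℝ → Sample d → ℝ)
    (s : Fin n → Sample d) (I : Finset (Fin n)) (w : EuclideanSpace ℝ p) : I → ℝ :=
  fun j => deriv (fun u => ℓ u (s j)) (φ w (s j).1)

/-- The Gram matrix `J(w)ᵀ J(w)` on the batch `I`. -/
def batchGram (φ : EuclideanSpace ℝ p → EuclideanSpace ℝ (Fin d) → ℝ) (s : Fin n → Sample d)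
    (I : Finset (Fin n)) (w : EuclideanSpace ℝ p) : Matrix p p ℝ :=
  (jacobian φ s I w).transpose * jacobian φ s I w

/-- The batch gradient `Ψ(w) = J(w)ᵀ G(w)`. -/
def batchGrad (φ : EuclideanSpace ℝ p → EuclideanSpace ℝ (Fin d) → ℝ) (ℓ : ℝ → Sample d → ℝ)
    (s : Fin n → Sample d) (I : Finset (Fin n)) (w : EuclideanSpace ℝ p) : p → ℝ :=
  (jacobian φ s I w).transpose.mulVec (lossGrad φ ℓ s I w)

/-- The squared norm `‖v‖²_H = vᵀ H v`. -/
def sqNorm (H : Matrix p p ℝ) (v : EuclideanSpace ℝ p) : ℝ :=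
  v.ofLp ⬝ᵥ H.mulVec v.ofLp

/-- The projection of `u` onto `C` in the metric of `H`: a minimizer of `‖v - u‖²_H` over `v ∈ C`.
It exists if `C` is nonempty and compact, and it is unique if moreover `C` is convex and `H` is
positive definite. -/
def metricProj (C : Set (EuclideanSpace ℝ p)) (H : Matrix p p ℝ) (u : EuclideanSpace ℝ p) :
    EuclideanSpace ℝ p :=
  Classical.epsilon fun v => v ∈ C ∧ ∀ v' ∈ C, sqNorm H (v - u) ≤ sqNorm H (v' - u)

/-- The pair `(w_k, H_{k-1})` of stochastic Gauss-Newton run with the batches `I 0, I 1, …`, step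
size `η`, curvature weight `α` and damping `lam`, where `H_{-1} = lam • 1`,
`H_k = H_{k-1} + α J_k(w_k)ᵀ J_k(w_k)` and `w_{k+1}` is the projection of `w_k - η H_k⁻¹ Ψ_k(w_k)`
onto `C` in the metric of `H_k`. -/
def sgnState (φ : EuclideanSpace ℝ p → EuclideanSpace ℝ (Fin d) → ℝ) (ℓ : ℝ → Sample d → ℝ)
    (s : Fin n → Sample d) (C : Set (EuclideanSpace ℝ p)) (η α lam : ℝ)
    (w₀ : EuclideanSpace ℝ p) (I : ℕ → Finset (Fin n)) :
    ℕ → EuclideanSpace ℝ p × Matrix p p ℝ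
  | 0 => (w₀, lam • (1 : Matrix p p ℝ))
  | k + 1 =>
    let w := (sgnState φ ℓ s C η α lam w₀ I k).1
    let H := (sgnState φ ℓ s C η α lam w₀ I k).2 + α • batchGram φ s (I k) w
    (metricProj C H (w - η • WithLp.toLp 2 (H⁻¹.mulVec (batchGrad φ ℓ s (I k) w))), H)

/-- The iterate `w_k`. -/
def sgnIter (φ : EuclideanSpace ℝ p → EuclideanSpace ℝ (Fin d) → ℝ) (ℓ : ℝ → Sample d → ℝ)
    (s : Fin n → Sample d) (C : Set (EuclideanSpace ℝ p)) (η α lam : ℝ)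
    (w₀ : EuclideanSpace ℝ p) (I : ℕ → Finset (Fin n)) (k : ℕ) : EuclideanSpace ℝ p :=
  (sgnState φ ℓ s C η α lam w₀ I k).1

/-- The preconditioner `H_k = α ∑_{t ≤ k} J_t(w_t)ᵀ J_t(w_t) + lam • 1`. -/
def sgnPrecond (φ : EuclideanSpace ℝ p → EuclideanSpace ℝ (Fin d) → ℝ) (ℓ : ℝ → Sample d → ℝ)
    (s : Fin n → Sample d) (C : Set (EuclideanSpace ℝ p)) (η α lam : ℝ)
    (w₀ : EuclideanSpace ℝ p) (I : ℕ → Finset (Fin n)) (k : ℕ) : Matrix p p ℝ :=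
  α • ∑ t ∈ Finset.range (k + 1), batchGram φ s (I t) (sgnIter φ ℓ s C η α lam w₀ I t)
    + lam • (1 : Matrix p p ℝ)

theorem sgnState_succ_snd (φ : EuclideanSpace ℝ p → EuclideanSpace ℝ (Fin d) → ℝ)
    (ℓ : ℝ → Sample d → ℝ) (s : Fin n → Sample d) (C : Set (EuclideanSpace ℝ p)) (η α lam : ℝ)
    (w₀ : EuclideanSpace ℝ p) (I : ℕ → Finset (Fin n)) (k : ℕ) :
    (sgnState φ ℓ s C η α lam w₀ I (k + 1)).2 = sgnPrecond φ ℓ s C η α lam w₀ I k := by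
  induction k with
  | zero => simp [sgnPrecond, sgnIter, sgnState, add_comm]
  | succ k ih =>
    rw [sgnState, ih, sgnPrecond, sgnPrecond, Finset.sum_range_succ _ (k + 1), smul_add]
    simp only [sgnIter]
    abel

/-- The defining recursion of stochastic Gauss-Newton. -/
theorem sgnIter_succ (φ : EuclideanSpace ℝ p → EuclideanSpace ℝ (Fin d) → ℝ)
    (ℓ : ℝ → Sample d → ℝ) (s : Fin n → Sample d) (C : Set (EuclideanSpace ℝ p)) (η α lam : ℝ)
    (w₀ : EuclideanSpace ℝ p) (I : ℕ → Finset (Fin n)) (k : ℕ) :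
    sgnIter φ ℓ s C η α lam w₀ I (k + 1) =
      metricProj C (sgnPrecond φ ℓ s C η α lam w₀ I k)
        (sgnIter φ ℓ s C η α lam w₀ I k - η • WithLp.toLp 2
          ((sgnPrecond φ ℓ s C η α lam w₀ I k)⁻¹.mulVec
            (batchGrad φ ℓ s (I k) (sgnIter φ ℓ s C η α lam w₀ I k)))) := by
  rw [← sgnState_succ_snd]
  rfl

/-- The average `ŵ_k = (1/k) ∑_{t < k} w_t` of a sequence. -/
def average (w : ℕ → EuclideanSpace ℝ p) (k : ℕ) : EuclideanSpace ℝ p :=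
  (1 / (k : ℝ)) • ∑ t ∈ Finset.range k, w t

/-- The Jacobian covariance `Σ(w) = (1/n) ∑_j ∇φ(x_j; w) ∇φ(x_j; w)ᵀ`. -/
def jacCov (φ : EuclideanSpace ℝ p → EuclideanSpace ℝ (Fin d) → ℝ) (s : Fin n → Sample d)
    (w : EuclideanSpace ℝ p) : Matrix p p ℝ :=
  (1 / (n : ℝ)) • ∑ j, Matrix.vecMulVec (∇ (fun v => φ v (s j).1) w).ofLp
    (∇ (fun v => φ v (s j).1) w).ofLp

/-- The intrinsic rank `r̄_k`, the rank of `(1/k) ∑_{t < k} 𝔼[Σ(w_t)]`, for a random sequence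
`w : ℕ → Ω → ℝᵖ`. -/
def intrinsicRank {Ω : Type*} [MeasurableSpace Ω] (P : Measure Ω)
    (φ : EuclideanSpace ℝ p → EuclideanSpace ℝ (Fin d) → ℝ) (s : Fin n → Sample d)
    (w : ℕ → Ω → EuclideanSpace ℝ p) (k : ℕ) : ℕ :=
  Matrix.rank ((1 / (k : ℝ)) • ∑ t ∈ Finset.range k,
    (Matrix.of fun a b => ∫ ω, jacCov φ s (w t ω) a b ∂P : Matrix p p ℝ))

/-- `Lip_{φ,C}`: the supremum of `‖∇_w φ(x; w)‖` over `w ∈ C` and `‖x‖ ≤ 1`. -/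
def lipPred (φ : EuclideanSpace ℝ p → EuclideanSpace ℝ (Fin d) → ℝ)
    (C : Set (EuclideanSpace ℝ p)) : ℝ :=
  sSup {r | ∃ w ∈ C, ∃ x, ‖x‖ ≤ 1 ∧ r = ‖∇ (fun v => φ v x) w‖}

/-- The supremum of `|φ(x; w)|` over `w ∈ C` and `‖x‖ ≤ 1`. -/
def supPred (φ : EuclideanSpace ℝ p → EuclideanSpace ℝ (Fin d) → ℝ)
    (C : Set (EuclideanSpace ℝ p)) : ℝ :=
  sSup {r | ∃ w ∈ C, ∃ x, ‖x‖ ≤ 1 ∧ r = |φ w x|}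

/-- The symmetric interval spanned by the labels in `[-1, 1]` and the predictions `φ(x; w)`, `w ∈ C`,
`‖x‖ ≤ 1`. -/
def predRange (φ : EuclideanSpace ℝ p → EuclideanSpace ℝ (Fin d) → ℝ)
    (C : Set (EuclideanSpace ℝ p)) : Set ℝ :=
  Set.Icc (-max 1 (supPred φ C)) (max 1 (supPred φ C))

end Algorithm

/-- `I 0, I 1, …` are independent random batches, each uniformly distributed over the subsets of
`{1, …, n}` of size `B`. -/
structure IsBatchSampling {Ω : Type*} [MeasurableSpace Ω] (P : Measure Ω) {n : ℕ} (B : ℕ)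
    (I : ℕ → Ω → Finset (Fin n)) : Prop where
  measurable : ∀ k M, MeasurableSet {ω | I k ω = M}
  indep : iIndepFun (m := fun _ => ⊤) I P
  card_eq : ∀ k, ∀ᵐ ω ∂P, (I k ω).card = B
  uniform : ∀ k M, M.card = B → P {ω | I k ω = M} = ((n.choose B : ℕ) : ℝ≥0∞)⁻¹

/-! ### Single-hidden-layer networks -/

/-- The parameter space `ℝ^{m(d+1)}` of a network with `m` hidden neurons: the coordinate `(i, 0)` is
the output weight `c_i`, the coordinates `(i, a + 1)` are the entries of the inner weight `W_i`. -/
abbrev Params (m d : ℕ) : Type := EuclideanSpace ℝ (Fin m × Fin (d + 1))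

/-- For `ω = (c, W) ∈ ℝ^{d+1}`, the part `W ∈ ℝᵈ`. -/
def innerWeight {d : ℕ} (ω : EuclideanSpace ℝ (Fin (d + 1))) : EuclideanSpace ℝ (Fin d) :=
  WithLp.toLp 2 fun a => ω a.succ

/-- The parameters `(c_i, W_i) ∈ ℝ^{d+1}` of the `i`-th neuron. -/
def neuron {m d : ℕ} (w : Params m d) (i : Fin m) : EuclideanSpace ℝ (Fin (d + 1)) :=
  WithLp.toLp 2 fun a => w (i, a)

/-- The network `φ(x; w) = m^{-1/2} ∑_i c_i σ(⟨W_i, x⟩)`. -/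
def network (σ : ℝ → ℝ) (m d : ℕ) (w : Params m d) (x : EuclideanSpace ℝ (Fin d)) : ℝ :=
  (1 / √(m : ℝ)) * ∑ i, neuron w i 0 * σ ⟪innerWeight (neuron w i), x⟫

/-- The activation is twice continuously differentiable, with `|σ| ≤ σ₀`, `|σ'| ≤ σ₁` and
`|σ''| ≤ σ₂`. -/
structure IsActivation (σ : ℝ → ℝ) (σ₀ σ₁ σ₂ : ℝ) : Prop where
  contDiff : ContDiff ℝ 2 σ
  bound : ∀ t, |σ t| ≤ σ₀
  bound_deriv : ∀ t, |deriv σ t| ≤ σ₁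
  bound_deriv_deriv : ∀ t, |deriv (deriv σ) t| ≤ σ₂

/-- The function class `𝓕_NTK` with bounds `vc` and `vW` on the transport mappings: the functions
`x ↦ 𝔼[v_c(ω) σ(⟨W, x⟩) + ⟨v_W(ω), c σ'(⟨W, x⟩) x⟩]`, where `ω = (c, W)` is a standard Gaussian
vector in `ℝ^{d+1}`. -/
def ntkClass (σ : ℝ → ℝ) (d : ℕ) (vc vW : ℝ) : Set (EuclideanSpace ℝ (Fin d) → ℝ) :=
  {f | ∃ (g : EuclideanSpace ℝ (Fin (d + 1)) → ℝ)
      (h : EuclideanSpace ℝ (Fin (d + 1)) → EuclideanSpace ℝ (Fin d)),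
      Measurable g ∧ Measurable h ∧ (∀ ω, |g ω| ≤ vc) ∧ (∀ ω, ‖h ω‖ ≤ vW) ∧
      f = fun x => ∫ ω, (g ω * σ ⟪innerWeight ω, x⟫
          + ⟪h ω, (ω 0 * deriv σ ⟪innerWeight ω, x⟫) • x⟫)
        ∂(stdGaussian (EuclideanSpace ℝ (Fin (d + 1))))}

/-- The initial parameter of a network of width `2 * h` made of the neurons `ω 0, …, ω (h - 1)` and of
their mirror images: the neuron `i + h` has the inner weight of the neuron `i` and the opposite output
weight. -/
def symInit {h d : ℕ} (ω : Fin h → EuclideanSpace ℝ (Fin (d + 1))) : Params (2 * h) d :=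
  WithLp.toLp 2 fun q =>
    if hi : (q.1 : ℕ) < h then ω ⟨q.1, hi⟩ q.2
    else if q.2 = 0 then -ω ⟨q.1 - h, by have := q.1.isLt; omega⟩ 0
    else ω ⟨q.1 - h, by have := q.1.isLt; omega⟩ q.2

/-- The law of `h` independent standard Gaussian vectors in `ℝ^{d+1}`. -/
def initLaw (h d : ℕ) : Measure (Fin h → EuclideanSpace ℝ (Fin (d + 1))) :=
  Measure.pi fun _ => stdGaussian (EuclideanSpace ℝ (Fin (d + 1)))

/-! ### The setting of the result -/

/-- A run of stochastic Gauss-Newton for a single-hidden-layer network of width `m` started at `w₀`,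
with `C` the closed Euclidean ball of radius `ρ` about `w₀`, step size `η = ξ α` and damping
`λ = γ α Lip_{φ,C}² B`. -/
def ntkRun (σ : ℝ → ℝ) {m d n : ℕ} (ℓ : ℝ → Sample d → ℝ) (s : Fin n → Sample d)
    (ρ ξ γ α : ℝ) (B : ℕ) (w₀ : Params m d) (I : ℕ → Finset (Fin n)) (k : ℕ) : Params m d :=
  sgnIter (network σ m d) ℓ s (Metric.closedBall w₀ ρ) (ξ * α) α
    (γ * α * lipPred (network σ m d) (Metric.closedBall w₀ ρ) ^ 2 * B) w₀ I k

/-- The conditional expected empirical risk `𝔼₀ R̂(φ(ŵ_k))` of the average iterate, given `w₀`. -/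
def expRisk {Ω : Type*} [MeasurableSpace Ω] (P : Measure Ω) (σ : ℝ → ℝ) {m d n : ℕ}
    (ℓ : ℝ → Sample d → ℝ) (s : Fin n → Sample d) (ρ ξ γ α : ℝ) (B : ℕ)
    (I : ℕ → Ω → Finset (Fin n)) (w₀ : Params m d) (k : ℕ) : ℝ :=
  ∫ ω, empRisk ℓ s (network σ m d
    (average (ntkRun σ ℓ s ρ ξ γ α B w₀ fun t => I t ω) k)) ∂P

/-- The intrinsic rank `r̄_k` of the run started at `w₀`. -/
def runRank {Ω : Type*} [MeasurableSpace Ω] (P : Measure Ω) (σ : ℝ → ℝ) {m d n : ℕ}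
    (ℓ : ℝ → Sample d → ℝ) (s : Fin n → Sample d) (ρ ξ γ α : ℝ) (B : ℕ)
    (I : ℕ → Ω → Finset (Fin n)) (w₀ : Params m d) (k : ℕ) : ℕ :=
  intrinsicRank P (network σ m d) s
    (fun t ω => ntkRun σ ℓ s ρ ξ γ α B w₀ (fun t' => I t' ω) t) k

end

end SGN

/-! The algorithm is an online Newton step on a model that is nearly linear in its parameters. For
fixed batches and a comparator `v` in the ball, the projection in the metric of `H_k` does not
increase the distance to `v`, so the update gives a telescoping inequality between squared distances
in successive metrics (`sqNorm_gaussNewton_step_le`, `sgn_regret_le`). The noise term `Gᵀ J H⁻¹ Jᵀ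
G` is summed by the elliptical potential argument (`trace_inv_mul_le_log_det_sub`), and the total
growth of `log det H` is a rank times a logarithm (`log_det_add_smul_one_le`). The parameter
dimension never enters.

The change of metric costs `α a²` per sample, where `a = ⟪∇φ(w), w - v⟫`. If the linearized
prediction at `v` is within `ε` of the label, then `a` is `u - y` up to `ε`, where `u` is the
prediction. Strong convexity with `ξ ν ≥ 2` pays for that cost and leaves the loss itself
(`two_mul_loss_sub_le`). The price is of order `Lip_ℓ ε` in general. If `|ℓ'|` is at most `D |u -
y|`, Young's inequality lowers it to order `ε²` (`two_mul_loss_sub_le_of_abs_deriv_le`), which is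
the difference between (i) and (ii).

Expectations over the batches use that `w_t` depends only on batches before `t`, so a fresh batch is
unbiased (`IsBatchSampling.integral_sum_mem`). Almost surely the gradients along the run are
orthogonal to the kernel of the averaged covariance, so the random rank is at most the intrinsic
rank (`ae_rank_sum_batchGram_le`). Passing to the average iterate combines convexity of the loss
with near linearity of the network (`IsNearlyLinearOn.abs_mean_sub_le`).

The comparator is the initialization displaced by `m^{-1/2}` times the transport maps of the target,
with signs matching the mirrored neurons. It lies in the ball, and the network linearized at `w₀`
takes there the empirical mean of the target's random features (`inner_gradient_transport`). With
high probability this mean is within `O(1/√m)` of the label, and the output weights are bounded by a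
multiple of `√(log m)` in maximum and by a constant in mean square, up to factors in `log (n/δ)`
(`initLaw_not_good_le`). The maximum controls the linearization error, of order `√(log m) / √m`; the
mean square controls the gradients and the predictions. In (i) the squared error `log m / m` is at
most `2 / √m`, so no logarithm of the width survives. -/

namespace SGN

/-! ### Positive semidefinite matrices -/

section LinearAlgebra

open Matrix
open scoped MatrixOrder

variable {p : Type*} [Fintype p]

theorem exists_eq_transpose_mul_self [DecidableEq p] {A : Matrix p p ℝ} (hA : A.PosSemidef) :
    ∃ R : Matrix p p ℝ, A = Rᵀ * R := by
  obtain ⟨R, hR⟩ := CStarAlgebra.nonneg_iff_eq_star_mul_self.mp hA.nonneg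
  exact ⟨R, by simpa [star_eq_conjTranspose] using hR⟩

theorem dotProduct_transpose_mul_self_mulVec {q : Type*} [Fintype q] (R : Matrix q p ℝ)
    (g : p → ℝ) : g ⬝ᵥ (Rᵀ * R) *ᵥ g = ∑ i, (R i ⬝ᵥ g) ^ 2 := by
  rw [← mulVec_mulVec, dotProduct_mulVec, vecMul_transpose]
  simp [dotProduct, mulVec, sq]

/-- Cauchy–Schwarz for each row of a factor `R` with `A = Rᵀ R`. The trace, rather than the operator
norm, is the quantity that the potential argument controls. -/
theorem dotProduct_mulVec_le_trace_mul [DecidableEq p] {A : Matrix p p ℝ} (hA : A.PosSemidef)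
    (g : p → ℝ) : g ⬝ᵥ A *ᵥ g ≤ A.trace * ∑ i, g i ^ 2 := by
  obtain ⟨R, rfl⟩ := exists_eq_transpose_mul_self hA
  have htr : (Rᵀ * R).trace = ∑ i, ∑ j, R i j ^ 2 := by
    simp only [trace, diag, mul_apply, transpose_apply]
    rw [Finset.sum_comm]
    simp [sq]
  rw [dotProduct_transpose_mul_self_mulVec, htr, Finset.sum_mul]
  refine Finset.sum_le_sum fun i _ => ?_
  exact Finset.sum_mul_sq_le_sq_mul_sq _ _ _

/-- This is `log μ ≤ μ - 1` summed over the eigenvalues. -/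
theorem card_sub_trace_le_neg_log_det [DecidableEq p] {A : Matrix p p ℝ} (hA : A.PosDef) :
    (Fintype.card p : ℝ) - A.trace ≤ -Real.log A.det := by
  rw [hA.isHermitian.trace_eq_sum_eigenvalues, hA.isHermitian.det_eq_prod_eigenvalues]
  simp only [RCLike.ofReal_real_eq_id, id]
  rw [Real.log_prod fun i _ => (hA.eigenvalues_pos i).ne']
  have : ∑ i, Real.log (hA.isHermitian.eigenvalues i)
      ≤ ∑ i, (hA.isHermitian.eigenvalues i - 1) :=
    Finset.sum_le_sum fun i _ => Real.log_le_sub_one_of_pos (hA.eigenvalues_pos i)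
  rw [Finset.sum_sub_distrib] at this
  simp at this
  linarith

/-- A step of the elliptical potential lemma. -/
theorem trace_inv_mul_le_log_det_sub [DecidableEq p] {H H' S : Matrix p p ℝ} (hH' : H'.PosDef)
    (hS : S.PosSemidef) (h : H = H' + S) :
    (H⁻¹ * S).trace ≤ Real.log H.det - Real.log H'.det := by
  have hH : H.PosDef := h ▸ hH'.add_posSemidef hS
  obtain ⟨R, hR⟩ := exists_eq_transpose_mul_self hH.inv.posSemidef
  have hRdet : R.det * R.det = H.det⁻¹ := by
    have := congrArg det hR
    rw [det_mul, det_transpose, det_nonsing_inv, Ring.inverse_eq_inv'] at this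
    exact this.symm
  have hRu : IsUnit R.det := by
    rw [isUnit_iff_ne_zero]
    intro h0
    rw [h0, mul_zero] at hRdet
    exact (inv_pos.mpr hH.det_pos).ne hRdet
  -- Conjugation by a factor of `H⁻¹` replaces `H⁻¹ H'`, which need not be symmetric, by a positive
  -- definite matrix with the same trace and determinant.
  have hP : (R * H' * Rᵀ).PosDef := by
    have := hH'.mul_mul_conjTranspose_same (B := R)
      (by
        have : IsUnit R := (isUnit_iff_isUnit_det R).mpr hRu
        exact vecMul_injective_of_isUnit this)
    simpa using this
  have key := card_sub_trace_le_neg_log_det hP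
  have hdet : (R * H' * Rᵀ).det = H.det⁻¹ * H'.det := by
    rw [det_mul, det_mul, det_transpose, ← hRdet]; ring
  have htr : (R * H' * Rᵀ).trace = (H⁻¹ * H').trace := by
    rw [hR, trace_mul_comm, ← mul_assoc]
  rw [hdet, htr, Real.log_mul (inv_pos.mpr hH.det_pos).ne' hH'.det_pos.ne', Real.log_inv] at key
  have hS' : H⁻¹ * S = 1 - H⁻¹ * H' := by
    have : S = H - H' := by rw [h]; abel
    rw [this, mul_sub, nonsing_inv_mul _ hH.det_pos.ne'.isUnit]
  rw [hS', trace_sub, trace_one]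
  linarith

/-- Each eigenvalue `μ` contributes `log (1 + μ / lam)`, which vanishes for `μ = 0` and is otherwise
bounded through `μ ≤ tr A`. Hence the rank appears in place of the dimension. -/
theorem log_det_add_smul_one_le [DecidableEq p] {A : Matrix p p ℝ} (hA : A.PosSemidef) {lam : ℝ}
    (hlam : 0 < lam) :
    Real.log (A + lam • (1 : Matrix p p ℝ)).det - Real.log (lam • (1 : Matrix p p ℝ)).det
      ≤ A.rank * Real.log (1 + A.trace / lam) := by
  set μ := hA.isHermitian.eigenvalues with hμ
  have hμ0 : ∀ i, 0 ≤ μ i := hA.eigenvalues_nonneg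
  -- Up to sign, the determinant is the characteristic polynomial of `A` at `-lam`.
  have hdet : (A + lam • (1 : Matrix p p ℝ)).det = ∏ i, (μ i + lam) := by
    have h1 := eval_charpoly A (-lam)
    rw [hA.isHermitian.charpoly_eq, Polynomial.eval_prod] at h1
    have h2 : (scalar p) (-lam) - A = -(A + lam • (1 : Matrix p p ℝ)) := by
      rw [scalar_apply, ← smul_one_eq_diagonal]
      rw [neg_smul]; abel
    rw [h2, det_neg] at h1
    have h3 : ∏ i, (μ i + lam) = (-1) ^ Fintype.card p * ∏ i, (-lam - μ i) := by
      rw [← Finset.card_univ, ← Finset.prod_const, ← Finset.prod_mul_distrib]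
      exact Finset.prod_congr rfl fun i _ => by ring
    simp only [Polynomial.eval_sub, Polynomial.eval_X, Polynomial.eval_C,
      RCLike.ofReal_real_eq_id, id] at h1
    rw [h3, h1, ← mul_assoc, ← mul_pow]
    simp
  have hdet1 : (lam • (1 : Matrix p p ℝ)).det = ∏ _i : p, lam := by
    simp
  rw [hdet, hdet1, Real.log_prod fun i _ => (add_pos_of_nonneg_of_pos (hμ0 i) hlam).ne',
    Real.log_prod fun i _ => hlam.ne', ← Finset.sum_sub_distrib,
    hA.isHermitian.rank_eq_card_non_zero_eigs, Fintype.card_subtype, ← nsmul_eq_mul,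
    ← Finset.sum_const]
  rw [Finset.sum_filter]
  refine Finset.sum_le_sum fun i _ => ?_
  split_ifs with h
  · rw [← Real.log_div (add_pos_of_nonneg_of_pos (hμ0 i) hlam).ne' hlam.ne']
    have hle : μ i ≤ A.trace := by
      rw [hA.isHermitian.trace_eq_sum_eigenvalues]
      exact Finset.single_le_sum (f := fun i => μ i) (fun j _ => hμ0 j) (Finset.mem_univ i)
    have h1 : (μ i + lam) / lam = 1 + μ i / lam := by field_simp; ring
    rw [h1]
    have h2 : 0 ≤ μ i / lam := div_nonneg (hμ0 i) hlam.le
    apply Real.log_le_log (by linarith)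
    gcongr
  · have : μ i = 0 := not_not.mp h
    simp [this]

theorem rank_le_rank_of_mulVec_eq_zero {q r : Type*} [Fintype q] [Fintype r] {A : Matrix q p ℝ}
    {S : Matrix r p ℝ} (h : ∀ v, S *ᵥ v = 0 → A *ᵥ v = 0) : A.rank ≤ S.rank := by
  have hA := LinearMap.finrank_range_add_finrank_ker A.mulVecLin
  have hS := LinearMap.finrank_range_add_finrank_ker S.mulVecLin
  have hker : Module.finrank ℝ (LinearMap.ker S.mulVecLin)
      ≤ Module.finrank ℝ (LinearMap.ker A.mulVecLin) :=
    Submodule.finrank_mono fun v hv => by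
      simp only [LinearMap.mem_ker, mulVecLin_apply] at hv ⊢
      exact h v hv
  unfold Matrix.rank
  omega

end LinearAlgebra

/-! ### The projection in the metric of a positive semidefinite matrix -/

section Regret

open Matrix

variable {p : Type} [Fintype p]

theorem sqNorm_nonneg {H : Matrix p p ℝ} (hH : H.PosSemidef) (v : EuclideanSpace ℝ p) :
    0 ≤ sqNorm H v := by
  simpa [sqNorm] using hH.dotProduct_mulVec_nonneg v.ofLp

theorem sqNorm_add {H : Matrix p p ℝ} (hH : H.PosSemidef) (u v : EuclideanSpace ℝ p) :
    sqNorm H (u + v) = sqNorm H u + 2 * (u.ofLp ⬝ᵥ H *ᵥ v.ofLp) + sqNorm H v := by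
  have hsymm : v.ofLp ⬝ᵥ H *ᵥ u.ofLp = u.ofLp ⬝ᵥ H *ᵥ v.ofLp := by
    have h1 : Hᵀ = H := by simpa using hH.isHermitian.eq
    rw [dotProduct_mulVec, ← mulVec_transpose, h1, dotProduct_comm]
  simp only [sqNorm, WithLp.ofLp_add, mulVec_add, add_dotProduct, dotProduct_add, hsymm]
  ring

theorem sqNorm_smul (H : Matrix p p ℝ) (r : ℝ) (v : EuclideanSpace ℝ p) :
    sqNorm H (r • v) = r ^ 2 * sqNorm H v := by
  simp only [sqNorm, WithLp.ofLp_smul, mulVec_smul, smul_dotProduct, dotProduct_smul, smul_eq_mul]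
  ring

theorem sqNorm_smul_one [DecidableEq p] (r : ℝ) (v : EuclideanSpace ℝ p) :
    sqNorm (r • (1 : Matrix p p ℝ)) v = r * ‖v‖ ^ 2 := by
  rw [EuclideanSpace.real_norm_sq_eq, Finset.mul_sum]
  simp only [sqNorm, smul_mulVec, one_mulVec, dotProduct, Pi.smul_apply, smul_eq_mul]
  exact Finset.sum_congr rfl fun i _ => by ring

theorem continuous_sqNorm (H : Matrix p p ℝ) : Continuous (sqNorm H) := by
  unfold sqNorm
  simp only [dotProduct, mulVec]
  fun_prop

theorem metricProj_spec {C : Set (EuclideanSpace ℝ p)} (hC : IsCompact C) (hne : C.Nonempty)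
    (H : Matrix p p ℝ) (u : EuclideanSpace ℝ p) :
    metricProj C H u ∈ C ∧ ∀ v ∈ C, sqNorm H (metricProj C H u - u) ≤ sqNorm H (v - u) := by
  have hcont : ContinuousOn (fun v => sqNorm H (v - u)) C :=
    ((continuous_sqNorm H).comp (by fun_prop : Continuous fun v => v - u)).continuousOn
  obtain ⟨v, hv, hmin⟩ := hC.exists_isMinOn hne hcont
  exact Classical.epsilon_spec
    (p := fun v => v ∈ C ∧ ∀ v' ∈ C, sqNorm H (v - u) ≤ sqNorm H (v' - u))
    ⟨v, hv, fun v' hv' => hmin hv'⟩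

/-- The projection onto a convex set does not increase the distance to the points of the set. -/
theorem sqNorm_metricProj_sub_le {C : Set (EuclideanSpace ℝ p)} (hC : IsCompact C)
    (hconv : Convex ℝ C) {H : Matrix p p ℝ} (hH : H.PosSemidef) (u : EuclideanSpace ℝ p)
    {v : EuclideanSpace ℝ p} (hv : v ∈ C) :
    sqNorm H (metricProj C H u - v) ≤ sqNorm H (u - v) := by
  obtain ⟨hmem, hmin⟩ := metricProj_spec hC ⟨v, hv⟩ H u
  set z := metricProj C H u
  set b := (z - u).ofLp ⬝ᵥ H *ᵥ (v - z).ofLp with hb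
  -- Minimality of `z` tested on the segment towards `v`; letting `r` be small gives the obtuse
  -- angle condition `0 ≤ b`.
  have hvar : ∀ r : ℝ, 0 < r → r ≤ 1 → 0 ≤ 2 * b + r * sqNorm H (v - z) := by
    intro r h0 h1
    have hin : z + r • (v - z) ∈ C := hconv.add_smul_sub_mem hmem hv ⟨h0.le, h1⟩
    have h2 := hmin _ hin
    have h3 : z + r • (v - z) - u = (z - u) + r • (v - z) := by abel
    rw [h3, sqNorm_add hH, sqNorm_smul, WithLp.ofLp_smul, mulVec_smul, dotProduct_smul,
      smul_eq_mul, ← hb] at h2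
    have h4 : 0 ≤ r * (2 * b + r * sqNorm H (v - z)) := by linarith
    exact nonneg_of_mul_nonneg_right h4 h0
  have hb0 : 0 ≤ b := by
    by_contra! hneg
    have hq := sqNorm_nonneg hH (v - z)
    -- This `r` makes the quadratic term at most `-b`; the `+ 1` avoids dividing by a vanishing
    -- seminorm.
    have h1 := hvar (min 1 (-b / (sqNorm H (v - z) + 1)))
      (lt_min one_pos (div_pos (neg_pos.mpr hneg) (by linarith))) (min_le_left _ _)
    have h2 : min 1 (-b / (sqNorm H (v - z) + 1)) * sqNorm H (v - z) ≤ -b := by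
      calc _ ≤ -b / (sqNorm H (v - z) + 1) * (sqNorm H (v - z) + 1) := by
            gcongr
            · exact div_nonneg (by linarith) (by linarith)
            · exact min_le_right _ _
            · linarith
        _ = -b := by field_simp
    linarith
  have h5 : v - u = (z - u) + (v - z) := by abel
  have hneg : ∀ w : EuclideanSpace ℝ p, sqNorm H (-w) = sqNorm H w := fun w => by
    simpa using sqNorm_smul H (-1) w
  have h6 := sqNorm_add hH (z - u) (v - z)
  rw [← h5, ← hb] at h6
  rw [← neg_sub v z, hneg, ← neg_sub v u, hneg, h6]
  linarith [sqNorm_nonneg hH (z - u)]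

/-! ### The regret of stochastic Gauss-Newton along a fixed sequence of batches -/

/-- Expand the square of the unprojected step. In the cross term `H` cancels against `H⁻¹`. Passing
from `H` to `H'` produces the term `α (J e)²`, kept on the left for the curvature of the loss to
absorb. The remaining `Gᵀ J H⁻¹ Jᵀ G` is at most `‖G‖²` times a trace bounded by the growth of `log
det`. -/
theorem sqNorm_gaussNewton_step_le [DecidableEq p] {q : Type*} [Fintype q] {C : Set (EuclideanSpace ℝ p)}
    (hC : IsCompact C) (hconv : Convex ℝ C) {H' H : Matrix p p ℝ} (hH' : H'.PosDef)
    (J : Matrix q p ℝ) (G : q → ℝ) {η α : ℝ} (hα : 0 < α) (hH : H = H' + α • (Jᵀ * J))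
    (w : EuclideanSpace ℝ p) {v : EuclideanSpace ℝ p} (hv : v ∈ C) :
    sqNorm H (metricProj C H (w - η • WithLp.toLp 2 (H⁻¹ *ᵥ (Jᵀ *ᵥ G))) - v)
        + ∑ i, (2 * η * (G i * (J i ⬝ᵥ (w - v).ofLp)) - α * (J i ⬝ᵥ (w - v).ofLp) ^ 2)
      ≤ sqNorm H' (w - v)
        + η ^ 2 / α * (∑ i, G i ^ 2) * (Real.log H.det - Real.log H'.det) := by
  have hJJ : (Jᵀ * J).PosSemidef := by
    simpa using posSemidef_conjTranspose_mul_self J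
  have hHp : H.PosDef := hH ▸ hH'.add_posSemidef (hJJ.smul hα.le)
  have hHu : IsUnit H.det := hHp.det_pos.ne'.isUnit
  have hproj := sqNorm_metricProj_sub_le hC hconv hHp.posSemidef
    (w - η • WithLp.toLp 2 (H⁻¹ *ᵥ (Jᵀ *ᵥ G))) hv
  set e : p → ℝ := (w - v).ofLp with he
  have hquad : sqNorm H (w - v) = sqNorm H' (w - v) + α * ∑ i, (J i ⬝ᵥ e) ^ 2 := by
    rw [hH, sqNorm, add_mulVec, dotProduct_add, smul_mulVec, dotProduct_smul,
      dotProduct_transpose_mul_self_mulVec, smul_eq_mul, sqNorm]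
  have hexp : sqNorm H (w - η • WithLp.toLp 2 (H⁻¹ *ᵥ (Jᵀ *ᵥ G)) - v)
      = sqNorm H (w - v) - 2 * η * ∑ i, G i * (J i ⬝ᵥ e)
        + η ^ 2 * (G ⬝ᵥ (J * H⁻¹ * Jᵀ) *ᵥ G) := by
    have h1 : w - η • WithLp.toLp 2 (H⁻¹ *ᵥ (Jᵀ *ᵥ G)) - v
        = (-η) • WithLp.toLp 2 (H⁻¹ *ᵥ (Jᵀ *ᵥ G)) + (w - v) := by
      rw [neg_smul]; abel
    have hsymm : (H⁻¹)ᵀ = H⁻¹ := by simpa using hHp.inv.isHermitian.eq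
    have h2 : (H⁻¹ *ᵥ (Jᵀ *ᵥ G)) ⬝ᵥ H *ᵥ e = ∑ i, G i * (J i ⬝ᵥ e) := by
      rw [dotProduct_mulVec, ← mulVec_transpose, mulVec_mulVec]
      have h3 : Hᵀ = H := by simpa using hHp.isHermitian.eq
      rw [h3, mul_nonsing_inv _ hHu, one_mulVec, mulVec_transpose, ← dotProduct_mulVec]
      rfl
    have h4 : sqNorm H (WithLp.toLp 2 (H⁻¹ *ᵥ (Jᵀ *ᵥ G))) = G ⬝ᵥ (J * H⁻¹ * Jᵀ) *ᵥ G := by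
      rw [sqNorm, mulVec_mulVec _ H, mul_nonsing_inv _ hHu, one_mulVec, dotProduct_mulVec,
        vecMul_transpose, mulVec_mulVec, mulVec_mulVec, dotProduct_comm]
    rw [h1, sqNorm_add hHp.posSemidef, sqNorm_smul, h4, WithLp.ofLp_smul, smul_dotProduct, h2,
      smul_eq_mul]
    ring
  have hpsd : (J * H⁻¹ * Jᵀ).PosSemidef := by
    simpa using hHp.inv.posSemidef.mul_mul_conjTranspose_same J
  have htr : (J * H⁻¹ * Jᵀ).trace ≤ (Real.log H.det - Real.log H'.det) / α := by
    have h1 := trace_inv_mul_le_log_det_sub hH' (hJJ.smul hα.le) hH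
    rw [Matrix.mul_smul, trace_smul, smul_eq_mul] at h1
    rw [le_div_iff₀ hα, Matrix.mul_assoc, trace_mul_comm, Matrix.mul_assoc, mul_comm]
    exact h1
  have hG : 0 ≤ ∑ i, G i ^ 2 := Finset.sum_nonneg fun i _ => sq_nonneg _
  classical
  have hbound := (dotProduct_mulVec_le_trace_mul hpsd G).trans
    (mul_le_mul_of_nonneg_right htr hG)
  have hbound' := mul_le_mul_of_nonneg_left hbound (sq_nonneg η)
  rw [Finset.sum_sub_distrib, ← Finset.mul_sum, ← Finset.mul_sum]
  rw [hexp, hquad] at hproj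
  have : η ^ 2 * ((Real.log H.det - Real.log H'.det) / α * ∑ i, G i ^ 2)
      = η ^ 2 / α * (∑ i, G i ^ 2) * (Real.log H.det - Real.log H'.det) := by ring
  linarith

variable {d n : ℕ} {φ : EuclideanSpace ℝ p → EuclideanSpace ℝ (Fin d) → ℝ}
  {ℓ : ℝ → Sample d → ℝ} {s : Fin n → Sample d} {C : Set (EuclideanSpace ℝ p)} {η α lam : ℝ}
  {w₀ : EuclideanSpace ℝ p} {I : ℕ → Finset (Fin n)}

theorem jacobian_dotProduct (I : Finset (Fin n)) (w v : EuclideanSpace ℝ p) (j : I) :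
    jacobian φ s I w j ⬝ᵥ v.ofLp = ⟪∇ (fun v => φ v (s j).1) w, v⟫ := by
  rw [PiLp.inner_apply]
  simp [jacobian, dotProduct, mul_comm]

theorem batchGram_posSemidef (I : Finset (Fin n)) (w : EuclideanSpace ℝ p) :
    (batchGram φ s I w).PosSemidef := by
  simpa [batchGram] using posSemidef_conjTranspose_mul_self (jacobian φ s I w)

theorem trace_batchGram (I : Finset (Fin n)) (w : EuclideanSpace ℝ p) :
    (batchGram φ s I w).trace = ∑ j ∈ I, ‖∇ (fun v => φ v (s j).1) w‖ ^ 2 := by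
  rw [batchGram, trace_mul_comm, ← Finset.sum_coe_sort]
  refine Finset.sum_congr rfl fun j _ => ?_
  rw [EuclideanSpace.real_norm_sq_eq]
  simp [mul_apply, jacobian, sq]

theorem batchGram_mulVec_eq_zero {I : Finset (Fin n)} {w v : EuclideanSpace ℝ p}
    (h : ∀ j ∈ I, ⟪∇ (fun v => φ v (s j).1) w, v⟫ = 0) :
    batchGram φ s I w *ᵥ v.ofLp = 0 := by
  rw [batchGram, ← mulVec_mulVec]
  have : jacobian φ s I w *ᵥ v.ofLp = 0 := by
    funext j
    exact (jacobian_dotProduct I w v j).trans (h j j.2)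
  rw [this, mulVec_zero]

variable [DecidableEq p]

theorem sgnIter_mem (hC : IsCompact C) (hw₀ : w₀ ∈ C) (k : ℕ) :
    sgnIter φ ℓ s C η α lam w₀ I k ∈ C := by
  cases k with
  | zero => exact hw₀
  | succ k =>
    rw [sgnIter_succ]
    exact (metricProj_spec hC ⟨w₀, hw₀⟩ _ _).1

theorem sgnState_snd_posDef (hα : 0 < α) (hlam : 0 < lam) (k : ℕ) :
    (sgnState φ ℓ s C η α lam w₀ I k).2.PosDef := by
  induction k with
  | zero => exact PosDef.one.smul hlam
  | succ k ih => exact ih.add_posSemidef ((batchGram_posSemidef _ _).smul hα.le)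

/-- The regret of stochastic Gauss-Newton against `v ∈ C`, with the curvature of the squared loss
subtracted. -/
theorem sgn_regret_le (hC : IsCompact C) (hconv : Convex ℝ C) (hα : 0 < α) (hlam : 0 < lam)
    {v : EuclideanSpace ℝ p} (hv : v ∈ C) {b : ℝ} {k : ℕ}
    (hb : ∀ t < k, ∑ j ∈ I t, deriv (fun u => ℓ u (s j))
      (φ (sgnIter φ ℓ s C η α lam w₀ I t) (s j).1) ^ 2 ≤ b) :
    ∑ t ∈ Finset.range k, ∑ j ∈ I t,
        (2 * η * (deriv (fun u => ℓ u (s j)) (φ (sgnIter φ ℓ s C η α lam w₀ I t) (s j).1)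
            * ⟪∇ (fun u => φ u (s j).1) (sgnIter φ ℓ s C η α lam w₀ I t),
                sgnIter φ ℓ s C η α lam w₀ I t - v⟫)
          - α * ⟪∇ (fun u => φ u (s j).1) (sgnIter φ ℓ s C η α lam w₀ I t),
                sgnIter φ ℓ s C η α lam w₀ I t - v⟫ ^ 2)
      ≤ lam * ‖w₀ - v‖ ^ 2 + η ^ 2 / α * b *
        ((∑ t ∈ Finset.range k, batchGram φ s (I t) (sgnIter φ ℓ s C η α lam w₀ I t)).rank
          * Real.log (1 + α * (∑ t ∈ Finset.range k, ∑ j ∈ I t,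
              ‖∇ (fun u => φ u (s j).1) (sgnIter φ ℓ s C η α lam w₀ I t)‖ ^ 2) / lam)) := by
  set w := sgnIter φ ℓ s C η α lam w₀ I with hw
  -- The index is shifted: `H t` is the preconditioner before batch `t` is added, so `H 0` is the
  -- damping alone.
  set H : ℕ → Matrix p p ℝ := fun t => (sgnState φ ℓ s C η α lam w₀ I t).2 with hH
  have hHpos : ∀ t, (H t).PosDef := sgnState_snd_posDef hα hlam
  have hHsucc : ∀ t, H (t + 1) = H t + α • batchGram φ s (I t) (w t) := fun t => rfl
  -- Monotonicity is what allows the gradient sums of the individual steps to be replaced by the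
  -- common bound `b` before telescoping.
  have hlog : ∀ t, Real.log (H t).det ≤ Real.log (H (t + 1)).det := fun t => by
    have h1 := trace_inv_mul_le_log_det_sub (hHpos t)
      ((batchGram_posSemidef (φ := φ) (s := s) (I t) (w t)).smul hα.le) (hHsucc t)
    obtain ⟨R, hR⟩ := exists_eq_transpose_mul_self (hHpos (t + 1)).inv.posSemidef
    have h2 : 0 ≤ ((H (t + 1))⁻¹ * α • batchGram φ s (I t) (w t)).trace := by
      rw [hR, Matrix.mul_assoc, trace_mul_comm]
      simpa using (((batchGram_posSemidef (φ := φ) (s := s) (I t) (w t)).smul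
        hα.le).mul_mul_conjTranspose_same R).trace_nonneg
    linarith
  have hrec : ∀ m ≤ k, sqNorm (H m) (w m - v) + ∑ t ∈ Finset.range m, ∑ j ∈ I t,
        (2 * η * (deriv (fun u => ℓ u (s j)) (φ (w t) (s j).1)
            * ⟪∇ (fun u => φ u (s j).1) (w t), w t - v⟫)
          - α * ⟪∇ (fun u => φ u (s j).1) (w t), w t - v⟫ ^ 2)
      ≤ lam * ‖w₀ - v‖ ^ 2
        + η ^ 2 / α * b * (Real.log (H m).det - Real.log (H 0).det) := by
    intro m
    induction m with
    | zero =>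
      intro _
      have : sqNorm (H 0) (w 0 - v) = lam * ‖w₀ - v‖ ^ 2 := sqNorm_smul_one lam (w₀ - v)
      simp [this]
    | succ m ih =>
      intro hm
      have hstep := sqNorm_gaussNewton_step_le hC hconv (hHpos m)
        (jacobian φ s (I m) (w m)) (lossGrad φ ℓ s (I m) (w m)) (η := η) hα (hHsucc m) (w m) hv
      simp only [jacobian_dotProduct, lossGrad] at hstep
      rw [Finset.sum_coe_sort (I m) fun j => 2 * η * (deriv (fun u => ℓ u (s j)) (φ (w m) (s j).1)
            * ⟪∇ (fun u => φ u (s j).1) (w m), w m - v⟫)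
          - α * ⟪∇ (fun u => φ u (s j).1) (w m), w m - v⟫ ^ 2,
        Finset.sum_coe_sort (I m) fun j => deriv (fun u => ℓ u (s j)) (φ (w m) (s j).1) ^ 2]
        at hstep
      have hih := ih (by omega)
      have hb' := mul_le_mul_of_nonneg_right (hb m (by omega)) (sub_nonneg.mpr (hlog m))
      have hb'' := mul_le_mul_of_nonneg_left hb' (div_nonneg (sq_nonneg η) hα.le)
      rw [Finset.sum_range_succ]
      change sqNorm (H (m + 1)) (w (m + 1) - v) + _ ≤ _ at hstep
      linarith
  have hfin := hrec k le_rfl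
  have hHk : H k = α • ∑ t ∈ Finset.range k, batchGram φ s (I t) (w t) + lam • (1 : Matrix p p ℝ) := by
    cases k with
    | zero => simp [hH, sgnState]
    | succ k => exact sgnState_succ_snd φ ℓ s C η α lam w₀ I k
  have hpsd : (∑ t ∈ Finset.range k, batchGram φ s (I t) (w t)).PosSemidef :=
    posSemidef_sum _ fun t _ => batchGram_posSemidef _ _
  have hdet := log_det_add_smul_one_le (hpsd.smul hα.le) hlam
  rw [← hHk, trace_smul, trace_sum, smul_eq_mul] at hdet
  simp only [trace_batchGram] at hdet
  have hrank : (α • ∑ t ∈ Finset.range k, batchGram φ s (I t) (w t)).rank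
      ≤ (∑ t ∈ Finset.range k, batchGram φ s (I t) (w t)).rank :=
    rank_le_rank_of_mulVec_eq_zero fun v hv => by rw [smul_mulVec, hv, smul_zero]
  have hlog0 : 0 ≤ Real.log (1 + α * (∑ t ∈ Finset.range k, ∑ j ∈ I t,
      ‖∇ (fun u => φ u (s j).1) (w t)‖ ^ 2) / lam) :=
    Real.log_nonneg (le_add_of_nonneg_right (by positivity))
  have hq := sqNorm_nonneg (hHpos k).posSemidef (w k - v)
  -- Nonnegativity of `b` is read off from its bound at `t = 0`, which says nothing when `k = 0`.
  rcases Nat.eq_zero_or_pos k with rfl | hk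
  · simpa [hH] using mul_nonneg hlam.le (sq_nonneg ‖w₀ - v‖)
  have hb0 : 0 ≤ b := (Finset.sum_nonneg fun j _ => sq_nonneg _).trans (hb 0 hk)
  have h0 : H 0 = lam • (1 : Matrix p p ℝ) := rfl
  have h1 : Real.log (H k).det - Real.log (H 0).det
      ≤ (∑ t ∈ Finset.range k, batchGram φ s (I t) (w t)).rank
        * Real.log (1 + α * (∑ t ∈ Finset.range k, ∑ j ∈ I t,
      ‖∇ (fun u => φ u (s j).1) (w t)‖ ^ 2) / lam) := by
    rw [h0]
    refine hdet.trans (mul_le_mul_of_nonneg_right ?_ hlog0)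
    exact_mod_cast hrank
  have h2 := mul_le_mul_of_nonneg_left h1
    (mul_nonneg (div_nonneg (sq_nonneg η) hα.le) hb0)
  linarith

end Regret

/-! ### Random batches -/

section Batches

variable {Ω : Type*} [MeasurableSpace Ω] {P : Measure Ω} {n B : ℕ} {I : ℕ → Ω → Finset (Fin n)}

theorem measurable_top_of_measurableSet_eq {X : Ω → Finset (Fin n)}
    (h : ∀ M, MeasurableSet {ω | X ω = M}) : Measurable[_, ⊤] X := by
  let _ : MeasurableSpace (Finset (Fin n)) := ⊤
  exact measurable_to_countable' fun M => h M

/-- A function of the first `k` batches, as a function of a finite tuple. -/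
theorem exists_eq_comp_restrict {β : Type*} {F : (ℕ → Finset (Fin n)) → β} {k : ℕ}
    (hF : DependsOn F (Finset.range k : Set ℕ)) :
    ∃ G : (Finset.range k → Finset (Fin n)) → β, ∀ x, F x = G fun i => x i := by
  -- The value `∅` at later times is arbitrary, since `F` does not see it.
  refine ⟨fun y => F fun t => if h : t ∈ Finset.range k then y ⟨t, h⟩ else ∅, fun x => ?_⟩
  refine hF fun t ht => ?_
  dsimp only
  rw [dif_pos (show t ∈ Finset.range k from ht)]

/-- Finitely many batches take finitely many values, so every function of them is measurable and
bounded. Nothing about the measurability of the selection in `metricProj` is needed. -/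
theorem integrable_of_dependsOn [IsProbabilityMeasure P] (hI : ∀ k M, MeasurableSet {ω | I k ω = M})
    {F : (ℕ → Finset (Fin n)) → ℝ} {k : ℕ} (hF : DependsOn F (Finset.range k : Set ℕ)) :
    Integrable (fun ω => F fun t => I t ω) P := by
  let _ : MeasurableSpace (Finset (Fin n)) := ⊤
  obtain ⟨G, hG⟩ := exists_eq_comp_restrict hF
  simp only [hG]
  have hX : Measurable fun ω (i : Finset.range k) => I i ω :=
    measurable_pi_lambda _ fun i => measurable_top_of_measurableSet_eq (hI i)
  obtain ⟨c, hc⟩ := (Set.finite_range fun y => ‖G y‖).bddAbove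
  refine Integrable.of_bound (C := c)
    ((Measurable.of_discrete (f := G)).comp hX).aestronglyMeasurable ?_
  exact Filter.Eventually.of_forall fun ω => hc ⟨_, rfl⟩

/-- Discarding the sets that avoid `j` leaves `(n-1).choose (B-1)` sets by Pascal's rule, and `n *
(n-1).choose (B-1) = B * n.choose B`. -/
theorem choose_inv_mul_card_filter_mem (hB : 1 ≤ B) (hBn : B ≤ n) (j : Fin n) :
    ((n.choose B : ℕ) : ℝ)⁻¹ * ((Finset.powersetCard B Finset.univ).filter (j ∈ ·)).card
      = B / n := by
  have hnot : (Finset.powersetCard B (Finset.univ : Finset (Fin n))).filter (j ∉ ·)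
      = Finset.powersetCard B (Finset.univ.erase j) := by
    ext M
    simp only [Finset.mem_filter, Finset.mem_powersetCard, Finset.subset_univ, true_and,
      Finset.subset_erase]
    tauto
  have hcard := Finset.card_filter_add_card_filter_not
    (s := Finset.powersetCard B (Finset.univ : Finset (Fin n))) (j ∈ ·)
  rw [hnot, Finset.card_powersetCard, Finset.card_powersetCard, Finset.card_erase_of_mem
    (Finset.mem_univ j), Finset.card_univ, Fintype.card_fin] at hcard
  obtain ⟨b, rfl⟩ : ∃ b, B = b + 1 := ⟨B - 1, by omega⟩
  obtain ⟨n', rfl⟩ : ∃ n', n = n' + 1 := ⟨n - 1, by omega⟩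
  rw [Nat.choose_succ_succ', Nat.add_sub_cancel] at hcard
  have hc : ((Finset.powersetCard (b + 1) (Finset.univ : Finset (Fin (n' + 1)))).filter
      (j ∈ ·)).card = n'.choose b := by omega
  have hmul := Nat.add_one_mul_choose_eq n' b
  rw [hc, inv_mul_eq_div, div_eq_div_iff]
  · exact_mod_cast by linarith
  · exact_mod_cast (Nat.choose_pos hBn).ne'
  · positivity

theorem IsBatchSampling.measureReal_mem [IsProbabilityMeasure P] (hI : IsBatchSampling P B I) (hB : 1 ≤ B)
    (hBn : B ≤ n) (k : ℕ) (j : Fin n) : P.real {ω | j ∈ I k ω} = B / n := by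
  have hae : {ω | j ∈ I k ω} =ᵐ[P]
      ⋃ M ∈ (Finset.powersetCard B (Finset.univ : Finset (Fin n))).filter (j ∈ ·),
        {ω | I k ω = M} := by
    filter_upwards [hI.card_eq k] with ω hω
    refine propext ?_
    change j ∈ I k ω ↔ ω ∈ (⋃ M ∈ _, {ω | I k ω = M})
    simp [hω]
  rw [measureReal_congr hae, measureReal_biUnion_finset]
  · rw [Finset.sum_congr rfl fun M hM => ?_, Finset.sum_const, nsmul_eq_mul, mul_comm]
    · exact choose_inv_mul_card_filter_mem hB hBn j
    · rw [measureReal_def, hI.uniform k M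
        (Finset.mem_powersetCard.mp (Finset.mem_filter.mp hM).1).2]
      simp
  · intro M _ M' _ hne
    rw [Function.onFun, Set.disjoint_left]
    intro ω h1 h2
    exact hne (Eq.trans (Eq.symm h1) h2)
  · exact fun M _ => hI.measurable k M

/-- The sum over the batch `k` of functions of the past batches, in expectation. -/
theorem IsBatchSampling.integral_sum_mem [IsProbabilityMeasure P] (hI : IsBatchSampling P B I)
    (hB : 1 ≤ B) (hBn : B ≤ n) {k : ℕ} {F : Fin n → (ℕ → Finset (Fin n)) → ℝ}
    (hF : ∀ j, DependsOn (F j) (Finset.range k : Set ℕ)) :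
    ∫ ω, ∑ j ∈ I k ω, F j (fun t => I t ω) ∂P
      = (B / n : ℝ) * ∑ j, ∫ ω, F j (fun t => I t ω) ∂P := by
  let _ : MeasurableSpace (Finset (Fin n)) := ⊤
  have hmeas : ∀ k, Measurable (I k) := fun k => measurable_top_of_measurableSet_eq (hI.measurable k)
  have hsum : ∀ ω, ∑ j ∈ I k ω, F j (fun t => I t ω)
      = ∑ j, (if j ∈ I k ω then 1 else 0) * F j (fun t => I t ω) := fun ω => by simp
  have hindep : ∀ j, IndepFun (fun ω => (if j ∈ I k ω then (1 : ℝ) else 0))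
      (fun ω => F j (fun t => I t ω)) P := fun j => by
    obtain ⟨G, hG⟩ := exists_eq_comp_restrict (hF j)
    have h1 := iIndepFun.indepFun_finset (Finset.range k) {k} (by simp) hI.indep hmeas
    have h2 := h1.symm.comp
      (φ := fun y : ({k} : Finset ℕ) → Finset (Fin n) =>
        if j ∈ y ⟨k, Finset.mem_singleton_self k⟩ then (1 : ℝ) else 0)
      (ψ := G) Measurable.of_discrete Measurable.of_discrete
    simp only [hG]
    exact h2
  have hint : ∀ j, Integrable (fun ω => (if j ∈ I k ω then (1 : ℝ) else 0)
      * F j (fun t => I t ω)) P := fun j => by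
    refine integrable_of_dependsOn (k := k + 1) hI.measurable
      (F := fun x => (if j ∈ x k then (1 : ℝ) else 0) * F j x) fun x y hxy => ?_
    dsimp only
    rw [hxy k (by simp), hF j fun t ht => hxy t (by simp at ht ⊢; omega)]
  have hmem : ∀ j, ∫ ω, (if j ∈ I k ω then (1 : ℝ) else 0) ∂P = B / n := fun j => by
    rw [← hI.measureReal_mem hB hBn k j, ← integral_indicator_one]
    · exact integral_congr_ae (Filter.Eventually.of_forall fun ω => by
        simp [Set.indicator_apply])
    · exact hmeas k (show MeasurableSet {M | j ∈ M} from trivial)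
  simp only [hsum]
  rw [integral_finsetSum _ fun j _ => hint j, Finset.mul_sum]
  refine Finset.sum_congr rfl fun j _ => ?_
  rw [IndepFun.integral_fun_mul_eq_mul_integral (hindep j), hmem]
  · refine (Measurable.aestronglyMeasurable ?_)
    exact (Measurable.of_discrete
      (f := fun M : Finset (Fin n) => if j ∈ M then (1 : ℝ) else 0)).comp (hmeas k)
  · exact (integrable_of_dependsOn hI.measurable (hF j)).aestronglyMeasurable

end Batches

/-! ### Adaptedness of the iterates and the intrinsic rank -/

section Rank

open Matrix

variable {p : Type} [Fintype p] {d n : ℕ}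
  {φ : EuclideanSpace ℝ p → EuclideanSpace ℝ (Fin d) → ℝ} {s : Fin n → Sample d}

theorem dependsOn_sgnState [DecidableEq p] {ℓ : ℝ → Sample d → ℝ} {C : Set (EuclideanSpace ℝ p)} {η α lam : ℝ}
    {w₀ : EuclideanSpace ℝ p} (k : ℕ) :
    DependsOn (fun I => sgnState φ ℓ s C η α lam w₀ I k) (Finset.range k : Set ℕ) := by
  induction k with
  | zero => exact fun _ _ _ => rfl
  | succ k ih =>
    intro x y hxy
    have h1 : sgnState φ ℓ s C η α lam w₀ x k = sgnState φ ℓ s C η α lam w₀ y k :=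
      ih fun t ht => hxy t (by simp at ht ⊢; omega)
    have h2 : x k = y k := hxy k (by simp)
    simp only [sgnState, h1, h2]

theorem dependsOn_sgnIter [DecidableEq p] {ℓ : ℝ → Sample d → ℝ} {C : Set (EuclideanSpace ℝ p)} {η α lam : ℝ}
    {w₀ : EuclideanSpace ℝ p} {t k : ℕ} (h : t ≤ k) :
    DependsOn (fun I => sgnIter φ ℓ s C η α lam w₀ I t) (Finset.range k : Set ℕ) :=
  fun _ _ hxy => congrArg Prod.fst (dependsOn_sgnState t fun i hi =>
    hxy i (by simp at hi ⊢; omega))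

theorem dotProduct_jacCov_mulVec (w : EuclideanSpace ℝ p) (v : p → ℝ) :
    v ⬝ᵥ jacCov φ s w *ᵥ v
      = 1 / n * ∑ j, ⟪∇ (fun u => φ u (s j).1) w, WithLp.toLp 2 v⟫ ^ 2 := by
  rw [jacCov, smul_mulVec, dotProduct_smul, smul_eq_mul, sum_mulVec, dotProduct_sum]
  congr 1
  refine Finset.sum_congr rfl fun j _ => ?_
  rw [vecMulVec_mulVec, dotProduct_smul, PiLp.inner_apply]
  simp only [dotProduct, MulOpposite.smul_eq_mul_unop, MulOpposite.unop_op, RCLike.inner_apply,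
    conj_trivial, sq]
  simp only [mul_comm]

variable {Ω : Type*} [MeasurableSpace Ω] {P : Measure Ω} {w : ℕ → Ω → EuclideanSpace ℝ p}

/-- The quadratic form of the averaged covariance at `v` is a positive multiple of a sum of
expectations of squares; if it vanishes, so does each square almost surely. -/
theorem ae_inner_gradient_eq_zero (hw : ∀ t a b, Integrable (fun ω => jacCov φ s (w t ω) a b) P)
    {k : ℕ} {v : p → ℝ}
    (hv : ((1 / (k : ℝ)) • ∑ t ∈ Finset.range k,
      (Matrix.of fun a b => ∫ ω, jacCov φ s (w t ω) a b ∂P : Matrix p p ℝ)) *ᵥ v = 0) :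
    ∀ᵐ ω ∂P, ∀ t < k, ∀ j, ⟪∇ (fun u => φ u (s j).1) (w t ω), WithLp.toLp 2 v⟫ = 0 := by
  rcases Nat.eq_zero_or_pos k with rfl | hk
  · simp
  have hquad : ∀ t, v ⬝ᵥ (Matrix.of fun a b => ∫ ω, jacCov φ s (w t ω) a b ∂P : Matrix p p ℝ) *ᵥ v
      = ∫ ω, v ⬝ᵥ jacCov φ s (w t ω) *ᵥ v ∂P := by
    intro t
    simp only [dotProduct, mulVec, of_apply]
    rw [integral_finsetSum]
    · refine Finset.sum_congr rfl fun a _ => ?_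
      rw [integral_const_mul, integral_finsetSum]
      · simp only [integral_mul_const]
      · exact fun b _ => (hw t a b).mul_const _
    · exact fun a _ => (integrable_finsetSum _ fun b _ => (hw t a b).mul_const _).const_mul _
  have hint : ∀ t, Integrable (fun ω => v ⬝ᵥ jacCov φ s (w t ω) *ᵥ v) P := fun t => by
    simp only [dotProduct, mulVec]
    exact integrable_finsetSum _ fun a _ =>
      (integrable_finsetSum _ fun b _ => (hw t a b).mul_const _).const_mul _
  have hnn : ∀ t ω, 0 ≤ v ⬝ᵥ jacCov φ s (w t ω) *ᵥ v := fun t ω => by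
    rw [dotProduct_jacCov_mulVec]; positivity
  have hzero : ∑ t ∈ Finset.range k, ∫ ω, v ⬝ᵥ jacCov φ s (w t ω) *ᵥ v ∂P = 0 := by
    have h1 := congrArg (v ⬝ᵥ ·) hv
    simp only [smul_mulVec, dotProduct_smul, sum_mulVec, dotProduct_sum, hquad,
      dotProduct_zero, smul_eq_mul] at h1
    have hk' : (1 / (k : ℝ)) ≠ 0 := by positivity
    exact (mul_eq_zero.mp h1).resolve_left hk'
  have hall : ∀ t, t < k → ∀ᵐ ω ∂P, ∀ j,
      ⟪∇ (fun u => φ u (s j).1) (w t ω), WithLp.toLp 2 v⟫ = 0 := by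
    intro t ht
    have h1 := (Finset.sum_eq_zero_iff_of_nonneg
      fun t _ => integral_nonneg (hnn t)).mp hzero t (Finset.mem_range.mpr ht)
    rw [integral_eq_zero_iff_of_nonneg (hnn t) (hint t)] at h1
    filter_upwards [h1] with ω hω j
    rw [dotProduct_jacCov_mulVec] at hω
    have hn : (1 / (n : ℝ)) ≠ 0 := by
      have := j.pos
      positivity
    have h2 := (mul_eq_zero.mp hω).resolve_left hn
    have h3 := (Finset.sum_eq_zero_iff_of_nonneg fun j _ => sq_nonneg _).mp h2 j
      (Finset.mem_univ j)
    exact pow_eq_zero_iff two_ne_zero |>.mp h3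
  have := ae_all_iff.mpr fun t : ℕ => Filter.eventually_imp_distrib_left.mpr (hall t)
  exact this

/-- Almost surely, the gradients along the run vanish on the kernel of the averaged covariance. -/
theorem ae_forall_inner_gradient_eq_zero
    (hw : ∀ t a b, Integrable (fun ω => jacCov φ s (w t ω) a b) P) (k : ℕ) :
    ∀ᵐ ω ∂P, ∀ v : p → ℝ, ((1 / (k : ℝ)) • ∑ t ∈ Finset.range k,
      (Matrix.of fun a b => ∫ ω, jacCov φ s (w t ω) a b ∂P : Matrix p p ℝ)) *ᵥ v = 0 →
      ∀ t < k, ∀ j, ⟪∇ (fun u => φ u (s j).1) (w t ω), WithLp.toLp 2 v⟫ = 0 := by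
  set S : Matrix p p ℝ := (1 / (k : ℝ)) • ∑ t ∈ Finset.range k,
      (Matrix.of fun a b => ∫ ω, jacCov φ s (w t ω) a b ∂P : Matrix p p ℝ) with hS
  -- The exceptional null set depends on `v`; a finite basis of the kernel yields one that serves
  -- all `v`.
  set b := Module.finBasis ℝ (LinearMap.ker S.mulVecLin)
  have hb : ∀ᵐ ω ∂P, ∀ i, ∀ t < k, ∀ j,
      ⟪∇ (fun u => φ u (s j).1) (w t ω), WithLp.toLp 2 (b i : p → ℝ)⟫ = 0 :=
    ae_all_iff.mpr fun i => ae_inner_gradient_eq_zero hw (by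
      exact LinearMap.mem_ker.mp (b i).2)
  filter_upwards [hb] with ω hω v hv t ht j
  have hvk : v ∈ LinearMap.ker S.mulVecLin := by simpa using hv
  have hrepr := congrArg Subtype.val (b.sum_repr ⟨v, hvk⟩)
  simp only [Submodule.coe_sum, Submodule.coe_smul] at hrepr
  rw [← hrepr, WithLp.toLp_sum, inner_sum]
  refine Finset.sum_eq_zero fun i _ => ?_
  rw [WithLp.toLp_smul, inner_smul_right, hω i t ht j, mul_zero]

theorem ae_rank_sum_batchGram_le [DecidableEq p] {I : ℕ → Ω → Finset (Fin n)}
    (hw : ∀ t a b, Integrable (fun ω => jacCov φ s (w t ω) a b) P) (k : ℕ) :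
    ∀ᵐ ω ∂P, (∑ t ∈ Finset.range k, batchGram φ s (I t ω) (w t ω)).rank
      ≤ intrinsicRank P φ s w k := by
  filter_upwards [ae_forall_inner_gradient_eq_zero hw k] with ω hω
  refine rank_le_rank_of_mulVec_eq_zero fun v hv => ?_
  rw [sum_mulVec]
  exact Finset.sum_eq_zero fun t ht => batchGram_mulVec_eq_zero (v := WithLp.toLp 2 v)
    fun j _ => hω v hv t (Finset.mem_range.mp ht) j

/-- Needed because the damping term of the regret carries no factor of the rank: when the rank is
zero, the regret has to vanish for another reason. -/
theorem ae_gradient_eq_zero_of_intrinsicRank_eq_zero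
    (hw : ∀ t a b, Integrable (fun ω => jacCov φ s (w t ω) a b) P) {k : ℕ}
    (hr : intrinsicRank P φ s w k = 0) :
    ∀ᵐ ω ∂P, ∀ t < k, ∀ j, ∇ (fun u => φ u (s j).1) (w t ω) = 0 := by
  filter_upwards [ae_forall_inner_gradient_eq_zero hw k] with ω hω t ht j
  refine ext_inner_right ℝ fun v => ?_
  rw [inner_zero_left]
  refine hω v.ofLp ?_ t ht j
  rw [intrinsicRank, Matrix.rank, Submodule.finrank_eq_zero, LinearMap.range_eq_bot] at hr
  exact congrArg (· v.ofLp) hr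

end Rank

/-! ### Strongly convex losses -/

section Loss

/-- The tangent line inequality for the convex function `f - ν/2 x²`. -/
theorem add_deriv_mul_sub_le_of_strongConvexOn {f : ℝ → ℝ} {ν : ℝ} (hf : Differentiable ℝ f)
    (hconv : StrongConvexOn Set.univ ν f) (u v : ℝ) :
    f u + deriv f u * (v - u) + ν / 2 * (v - u) ^ 2 ≤ f v := by
  have hg : ConvexOn ℝ Set.univ fun x => f x - ν / 2 * x ^ 2 := by
    simpa [sq_abs] using strongConvexOn_iff_convex.mp hconv
  have hd : HasDerivAt (fun x => f x - ν / 2 * x ^ 2) (deriv f u - ν * u) u := by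
    refine ((hf u).hasDerivAt.sub ((hasDerivAt_pow 2 u).const_mul (ν / 2))).congr_deriv ?_
    norm_num
    ring
  rcases lt_trichotomy u v with h | rfl | h
  · have h1 := hg.le_slope_of_hasDerivAt (Set.mem_univ u) (Set.mem_univ v) h hd
    rw [slope_def_field, le_div_iff₀ (sub_pos.mpr h)] at h1
    nlinarith
  · simp
  · have h1 := hg.slope_le_of_hasDerivAt (Set.mem_univ v) (Set.mem_univ u) h hd
    rw [slope_def_field, div_le_iff₀ (sub_pos.mpr h)] at h1
    nlinarith

/-- Immediate in the interior; continuity of the derivative extends the bound to the endpoints,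
which predictions may attain. -/
theorem abs_deriv_le_of_lipschitzOnWith_Icc {f : ℝ → ℝ} {a b : ℝ} {K : ℝ≥0} (hab : a < b)
    (hf : Continuous (deriv f)) (hlip : LipschitzOnWith K f (Set.Icc a b)) {u : ℝ}
    (hu : u ∈ Set.Icc a b) : |deriv f u| ≤ K := by
  have hclosed : IsClosed {x | |deriv f x| ≤ K} :=
    isClosed_le hf.abs continuous_const
  have hsub : Set.Ioo a b ⊆ {x | |deriv f x| ≤ K} := fun x hx =>
    norm_deriv_le_of_lipschitzOn (Icc_mem_nhds hx.1 hx.2) hlip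
  have := hclosed.closure_subset_iff.mpr hsub
  rw [closure_Ioo hab.ne] at this
  exact this hu

variable {f : ℝ → ℝ} {ν ξ y : ℝ}

/-- The curvature of the loss pays for the error `ε` of the linearized prediction. -/
theorem two_mul_loss_sub_le (hf : Differentiable ℝ f) (hconv : StrongConvexOn Set.univ ν f)
    (hξ : 0 ≤ ξ) (hν : 2 ≤ ξ * ν) (hy : f y = 0) {u a b ε : ℝ} (hb : |deriv f u| ≤ b)
    (hε : |u - a - y| ≤ ε) :
    2 * ξ * f u - (2 * ξ * b * ε + 3 * ε ^ 2) ≤ 2 * ξ * (deriv f u * a) - a ^ 2 := by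
  have h1 := add_deriv_mul_sub_le_of_strongConvexOn hf hconv u y
  rw [hy] at h1
  set g := deriv f u
  set e := y - (u - a) with he
  have ha : a = (u - y) + e := by rw [he]; ring
  have heε : |e| ≤ ε := by rw [he, abs_sub_comm]; exact hε
  have hge : |g * e| ≤ b * ε := by
    rw [abs_mul]; exact mul_le_mul hb heε (abs_nonneg _) ((abs_nonneg _).trans hb)
  have hge' := (abs_le.mp hge).1
  have he2 : e ^ 2 ≤ ε ^ 2 := sq_le_sq' (by linarith [(abs_le.mp heε).1]) (abs_le.mp heε).2
  have h2 := mul_le_mul_of_nonneg_left h1 hξ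
  have h3 := mul_le_mul_of_nonneg_left hge' hξ
  have h4 : 2 * (u - y) ^ 2 ≤ ξ * ν * (u - y) ^ 2 :=
    mul_le_mul_of_nonneg_right hν (sq_nonneg _)
  rw [ha]
  -- With `x = u - y`, what remains is `2x² - (x + e)² + 3e² = (x - e)² + e²`.
  nlinarith [sq_nonneg ((u - y) - e), sq_nonneg ((u - y) - 2 * e)]

/-- The error `f'(u) e` is now at most `D |u - y| ε`. Young's inequality charges part of it to the
curvature term and leaves only `ε²`. The remainder is exactly `(x - 2e)² / 2` with `x = u - y`, up
to `e² ≤ ε²`. -/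
theorem two_mul_loss_sub_le_of_abs_deriv_le (hf : Differentiable ℝ f)
    (hconv : StrongConvexOn Set.univ ν f) (hξ : 0 ≤ ξ) (hν : 2 ≤ ξ * ν) (hy : f y = 0)
    {u a D ε : ℝ} (hD : |deriv f u| ≤ D * |u - y|) (hε : |u - a - y| ≤ ε) :
    2 * ξ * f u - (2 * ξ ^ 2 * D ^ 2 * ε ^ 2 + 3 * ε ^ 2)
      ≤ 2 * ξ * (deriv f u * a) - a ^ 2 := by
  have h1 := add_deriv_mul_sub_le_of_strongConvexOn hf hconv u y
  rw [hy] at h1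
  set g := deriv f u
  set e := y - (u - a) with he
  have ha : a = (u - y) + e := by rw [he]; ring
  have heε : |e| ≤ ε := by rw [he, abs_sub_comm]; exact hε
  have hge : |g * e| ≤ (D * |u - y|) * ε := by
    rw [abs_mul]; exact mul_le_mul hD heε (abs_nonneg _) ((abs_nonneg _).trans hD)
  have hge' := (abs_le.mp hge).1
  have he2 : e ^ 2 ≤ ε ^ 2 := sq_le_sq' (by linarith [(abs_le.mp heε).1]) (abs_le.mp heε).2
  have h2 := mul_le_mul_of_nonneg_left h1 hξ
  have h3 := mul_le_mul_of_nonneg_left hge' hξ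
  have h4 : 2 * (u - y) ^ 2 ≤ ξ * ν * (u - y) ^ 2 :=
    mul_le_mul_of_nonneg_right hν (sq_nonneg _)
  have h5 : 2 * (ξ * (D * |u - y| * ε)) ≤ 1 / 2 * (u - y) ^ 2 + 2 * ξ ^ 2 * D ^ 2 * ε ^ 2 := by
    have := sq_nonneg (|u - y| - 2 * (ξ * D * ε))
    nlinarith [sq_abs (u - y)]
  rw [ha]
  nlinarith [sq_nonneg ((u - y) - 2 * e)]

theorem loss_le_add_mul (hf : Differentiable ℝ f) (hconv : StrongConvexOn Set.univ ν f)
    (hν : 0 ≤ ν) {u v b τ : ℝ} (hb : |deriv f v| ≤ b) (hτ : |u - v| ≤ τ) :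
    f v ≤ f u + b * τ := by
  have h1 := add_deriv_mul_sub_le_of_strongConvexOn hf hconv v u
  have h2 : |deriv f v * (u - v)| ≤ b * τ := by
    rw [abs_mul]; exact mul_le_mul hb hτ (abs_nonneg _) ((abs_nonneg _).trans hb)
  have h3 := (abs_le.mp h2).1
  have : 0 ≤ ν / 2 * (u - v) ^ 2 := by positivity
  linarith

/-- Quadratic growth at the minimizer, `(v - y)² ≤ ξ f(v)`, lets Young's inequality hide the
first-order change of the loss in `f(v) / 2`; this is the origin of the factor `2`. -/
theorem loss_le_two_mul_add (hf : Differentiable ℝ f) (hconv : StrongConvexOn Set.univ ν f)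
    (hν0 : 0 ≤ ν) (hξ : 0 < ξ) (hν : 2 ≤ ξ * ν) (hy : f y = 0) {u v D τ : ℝ}
    (hD : |deriv f v| ≤ D * |v - y|) (hDy : deriv f y = 0) (hτ : |u - v| ≤ τ) :
    f v ≤ 2 * f u + ξ * D ^ 2 * τ ^ 2 := by
  have h1 := loss_le_add_mul hf hconv hν0 hD hτ
  have h2 := add_deriv_mul_sub_le_of_strongConvexOn hf hconv y v
  rw [hy, hDy] at h2
  have h3 : (v - y) ^ 2 ≤ ξ * f v := by
    have h4 := mul_le_mul_of_nonneg_left h2 hξ.le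
    have h5 : 2 * (v - y) ^ 2 ≤ ξ * ν * (v - y) ^ 2 :=
      mul_le_mul_of_nonneg_right hν (sq_nonneg _)
    nlinarith
  have h6 : D * |v - y| * τ ≤ f v / 2 + ξ * D ^ 2 * τ ^ 2 / 2 := by
    have h7 := sq_nonneg (|v - y| - ξ * (D * τ))
    have h8 : ξ * (D * |v - y| * τ) ≤ ξ * (f v / 2 + ξ * D ^ 2 * τ ^ 2 / 2) := by
      nlinarith [sq_abs (v - y)]
    exact le_of_mul_le_mul_left h8 hξ
  linarith

theorem convexOn_of_strongConvexOn (hν : 0 ≤ ν) (hconv : StrongConvexOn Set.univ ν f) :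
    ConvexOn ℝ Set.univ f :=
  strongConvexOn_zero.mp (hconv.mono hν)

end Loss

/-! ### Averages -/

section Average

variable {p : Type} {d n : ℕ} {φ : EuclideanSpace ℝ p → EuclideanSpace ℝ (Fin d) → ℝ}
  {ℓ : ℝ → Sample d → ℝ} {s : Fin n → Sample d}

theorem average_mem {C : Set (EuclideanSpace ℝ p)} (hconv : Convex ℝ C) {w : ℕ → EuclideanSpace ℝ p} (hw : ∀ t, w t ∈ C) {k : ℕ}
    (hk : 0 < k) : average w k ∈ C := by
  have hk' : (0 : ℝ) < k := by exact_mod_cast hk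
  rw [average, Finset.smul_sum]
  refine hconv.sum_mem (fun _ _ => by positivity) ?_ fun t _ => hw t
  rw [Finset.sum_const, Finset.card_range, nsmul_eq_mul]
  field_simp

theorem loss_mean_le {f : ℝ → ℝ} (hf : ConvexOn ℝ Set.univ f) (x : ℕ → ℝ) {k : ℕ} (hk : 0 < k) :
    f ((1 / (k : ℝ)) * ∑ t ∈ Finset.range k, x t)
      ≤ (1 / (k : ℝ)) * ∑ t ∈ Finset.range k, f (x t) := by
  have hk' : (0 : ℝ) < k := by exact_mod_cast hk
  have := hf.map_sum_le (t := Finset.range k) (w := fun _ => 1 / (k : ℝ)) (p := x)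
    (fun _ _ => by positivity) (by
      rw [Finset.sum_const, Finset.card_range, nsmul_eq_mul]
      field_simp) fun _ _ => Set.mem_univ _
  simpa [Finset.mul_sum] using this

theorem empRisk_average_le {c e : ℝ} {w : ℕ → EuclideanSpace ℝ p} {k : ℕ}
    (hn : 0 < n) (hpt : ∀ j, ℓ (φ (average w k) (s j).1) (s j)
      ≤ c * ((1 / (k : ℝ)) * ∑ t ∈ Finset.range k, ℓ (φ (w t) (s j).1) (s j)) + e) :
    empRisk ℓ s (φ (average w k))
      ≤ c * ((1 / (k : ℝ)) * ∑ t ∈ Finset.range k, empRisk ℓ s (φ (w t))) + e := by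
  have hn' : (0 : ℝ) < n := by exact_mod_cast hn
  calc empRisk ℓ s (φ (average w k))
      ≤ (1 / (n : ℝ)) * ∑ j,
        (c * ((1 / (k : ℝ)) * ∑ t ∈ Finset.range k, ℓ (φ (w t) (s j).1) (s j)) + e) := by
        unfold empRisk
        gcongr with j
        exact hpt j
    _ = _ := by
        unfold empRisk
        rw [Finset.sum_add_distrib, ← Finset.mul_sum, ← Finset.mul_sum, Finset.sum_comm,
          ← Finset.mul_sum, Finset.sum_const, Finset.card_univ, Fintype.card_fin, nsmul_eq_mul]
        field_simp

/-- `φ` is linear in the parameter up to an error `τ` on `C`. -/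
def IsNearlyLinearOn [Fintype p]
    (φ : EuclideanSpace ℝ p → EuclideanSpace ℝ (Fin d) → ℝ) (s : Fin n → Sample d)
    (C : Set (EuclideanSpace ℝ p)) (τ : ℝ) : Prop :=
  ∀ w ∈ C, ∀ w' ∈ C, ∀ j,
    |φ w' (s j).1 - φ w (s j).1 - ⟪∇ (fun u => φ u (s j).1) w, w' - w⟫| ≤ τ

/-- Linearize at the average itself: the first-order terms then sum to zero. -/
theorem IsNearlyLinearOn.abs_mean_sub_le [Fintype p] {C : Set (EuclideanSpace ℝ p)} {τ : ℝ}
    (h : IsNearlyLinearOn φ s C τ)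
    (hconv : Convex ℝ C) {w : ℕ → EuclideanSpace ℝ p} (hw : ∀ t, w t ∈ C) {k : ℕ} (hk : 0 < k)
    (j : Fin n) :
    |(1 / (k : ℝ)) * ∑ t ∈ Finset.range k, φ (w t) (s j).1 - φ (average w k) (s j).1| ≤ τ := by
  have hk' : (0 : ℝ) < k := by exact_mod_cast hk
  set z := average w k with hz
  have hsum : ∑ t ∈ Finset.range k, (w t - z) = 0 := by
    rw [Finset.sum_sub_distrib, Finset.sum_const, Finset.card_range, hz, average,
      ← Nat.cast_smul_eq_nsmul ℝ, smul_smul, mul_one_div, div_self hk'.ne', one_smul, sub_self]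
  have heq : (1 / (k : ℝ)) * ∑ t ∈ Finset.range k, φ (w t) (s j).1 - φ z (s j).1
      = (1 / (k : ℝ)) * ∑ t ∈ Finset.range k,
        (φ (w t) (s j).1 - φ z (s j).1 - ⟪∇ (fun u => φ u (s j).1) z, w t - z⟫) := by
    rw [Finset.sum_sub_distrib, ← inner_sum, hsum, inner_zero_right, Finset.sum_sub_distrib,
      Finset.sum_const, Finset.card_range, nsmul_eq_mul]
    field_simp
    ring
  rw [heq, abs_mul, abs_of_pos (by positivity : (0 : ℝ) < 1 / k)]
  calc _ ≤ (1 / (k : ℝ)) * ∑ _t ∈ Finset.range k, τ := by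
        gcongr
        refine (Finset.abs_sum_le_sum_abs _ _).trans (Finset.sum_le_sum fun t _ => ?_)
        exact h z (average_mem hconv hw hk) (w t) (hw t) j
    _ = τ := by
        rw [Finset.sum_const, Finset.card_range, nsmul_eq_mul]
        field_simp

end Average

/-! ### Convergence of stochastic Gauss-Newton in expectation -/

section Convergence

variable {p : Type} [Fintype p] [DecidableEq p] {d n B : ℕ}
  {φ : EuclideanSpace ℝ p → EuclideanSpace ℝ (Fin d) → ℝ} {ℓ : ℝ → Sample d → ℝ}
  {s : Fin n → Sample d} {C : Set (EuclideanSpace ℝ p)} {w₀ v : EuclideanSpace ℝ p}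
  {Ω : Type*} [MeasurableSpace Ω] {P : Measure Ω} [IsProbabilityMeasure P]
  {I : ℕ → Ω → Finset (Fin n)}

theorem integrable_jacCov_sgnIter (hI : IsBatchSampling P B I) {η α lam : ℝ} (t : ℕ) (a b : p) :
    Integrable (fun ω => jacCov φ s (sgnIter φ ℓ s C η α lam w₀ (fun t' => I t' ω) t) a b) P :=
  integrable_of_dependsOn hI.measurable
    (F := fun x => jacCov φ s (sgnIter φ ℓ s C η α lam w₀ x t) a b) (k := t)
    fun _ _ hxy => congrArg (fun w => jacCov φ s w a b) (dependsOn_sgnIter le_rfl hxy)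

theorem integrable_empRisk_sgnIter (hI : IsBatchSampling P B I) {η α lam : ℝ} (t : ℕ) :
    Integrable (fun ω =>
      empRisk ℓ s (φ (sgnIter φ ℓ s C η α lam w₀ (fun t' => I t' ω) t))) P :=
  integrable_of_dependsOn hI.measurable
    (F := fun x => empRisk ℓ s (φ (sgnIter φ ℓ s C η α lam w₀ x t))) (k := t)
    fun _ _ hxy => congrArg (fun w => empRisk ℓ s (φ w)) (dependsOn_sgnIter le_rfl hxy)

theorem integrable_empRisk_average (hI : IsBatchSampling P B I) {η α lam : ℝ} (k : ℕ) :
    Integrable (fun ω =>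
      empRisk ℓ s (φ (average (sgnIter φ ℓ s C η α lam w₀ fun t' => I t' ω) k))) P := by
  refine integrable_of_dependsOn hI.measurable
    (F := fun x => empRisk ℓ s (φ (average (sgnIter φ ℓ s C η α lam w₀ x) k))) (k := k)
    fun x y hxy => ?_
  have : average (sgnIter φ ℓ s C η α lam w₀ x) k = average (sgnIter φ ℓ s C η α lam w₀ y) k := by
    unfold average
    congr 1
    exact Finset.sum_congr rfl fun t ht => dependsOn_sgnIter (Finset.mem_range.mp ht).le hxy
  exact congrArg (fun w => empRisk ℓ s (φ w)) this

/-- The pathwise regret in expectation. The hypothesis `hE` leaves the per-sample error `E` open, so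
that both the first-order and the second-order error can be inserted. With `η = ξ α` and `λ`
proportional to `α B`, both `α` and `B` cancel. -/
theorem sum_integral_empRisk_sgnIter_le (hI : IsBatchSampling P B I) (hB : 1 ≤ B) (hBn : B ≤ n)
    (hC : IsCompact C) (hconv : Convex ℝ C) (hw₀ : w₀ ∈ C) (hv : v ∈ C) {α ξ γ L ρ b E : ℝ}
    (hα : 0 < α) (hξ : 0 < ξ) (hγ : 0 < γ) (hL : 0 ≤ L) (hρ : ‖w₀ - v‖ ≤ ρ)
    (hLip : ∀ w ∈ C, ∀ j, ‖∇ (fun u => φ u (s j).1) w‖ ≤ L)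
    (hb : ∀ w ∈ C, ∀ j, |deriv (fun u => ℓ u (s j)) (φ w (s j).1)| ≤ b)
    (hE : ∀ w ∈ C, ∀ j, 2 * ξ * ℓ (φ w (s j).1) (s j) - E
      ≤ 2 * ξ * (deriv (fun u => ℓ u (s j)) (φ w (s j).1)
          * ⟪∇ (fun u => φ u (s j).1) w, w - v⟫) - ⟪∇ (fun u => φ u (s j).1) w, w - v⟫ ^ 2)
    {k : ℕ} (hk : 0 < k) :
    (1 / (k : ℝ)) * ∑ t ∈ Finset.range k, ∫ ω, empRisk ℓ s (φ
        (sgnIter φ ℓ s C (ξ * α) α (γ * α * L ^ 2 * B) w₀ (fun t' => I t' ω) t)) ∂P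
      ≤ E / (2 * ξ) + intrinsicRank P φ s
          (fun t ω => sgnIter φ ℓ s C (ξ * α) α (γ * α * L ^ 2 * B) w₀ (fun t' => I t' ω) t) k
        * (γ * L ^ 2 * ρ ^ 2 + ξ ^ 2 * b ^ 2 * Real.log (1 + k / γ)) / (2 * ξ * k) := by
  set lam := γ * α * L ^ 2 * B with hlamdef
  set W : ℕ → Ω → EuclideanSpace ℝ p :=
    fun t ω => sgnIter φ ℓ s C (ξ * α) α lam w₀ (fun t' => I t' ω) t with hW
  set r := intrinsicRank P φ s W k with hr
  have hWC : ∀ t ω, W t ω ∈ C := fun t ω => sgnIter_mem hC hw₀ t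
  have hk' : (0 : ℝ) < k := by exact_mod_cast hk
  have hB' : (0 : ℝ) < B := by exact_mod_cast hB
  have hn' : (0 : ℝ) < n := by exact_mod_cast hB.trans hBn
  have hlog0 : 0 ≤ Real.log (1 + k / γ) := Real.log_nonneg (by
    have : 0 ≤ k / γ := by positivity
    linarith)
  have hlam0 : 0 ≤ lam := by positivity
  set R := r * (lam * ρ ^ 2 + ξ ^ 2 * α * (B * b ^ 2) * Real.log (1 + k / γ)) with hR
  have hR0 : 0 ≤ R := by positivity
  have hint : ∀ t a b, Integrable (fun ω => jacCov φ s (W t ω) a b) P :=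
    fun t a b => integrable_jacCov_sgnIter hI t a b
  have hpath : ∀ᵐ ω ∂P, ∑ t ∈ Finset.range k, ∑ j ∈ I t ω,
        (2 * (ξ * α) * (deriv (fun u => ℓ u (s j)) (φ (W t ω) (s j).1)
            * ⟪∇ (fun u => φ u (s j).1) (W t ω), W t ω - v⟫)
          - α * ⟪∇ (fun u => φ u (s j).1) (W t ω), W t ω - v⟫ ^ 2) ≤ R := by
    have hzero : ∀ ω, (∀ t < k, ∀ j, ∇ (fun u => φ u (s j).1) (W t ω) = 0) →
        ∑ t ∈ Finset.range k, ∑ j ∈ I t ω,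
        (2 * (ξ * α) * (deriv (fun u => ℓ u (s j)) (φ (W t ω) (s j).1)
            * ⟪∇ (fun u => φ u (s j).1) (W t ω), W t ω - v⟫)
          - α * ⟪∇ (fun u => φ u (s j).1) (W t ω), W t ω - v⟫ ^ 2) ≤ R := by
      intro ω hω
      refine le_trans (le_of_eq ?_) hR0
      refine Finset.sum_eq_zero fun t ht => Finset.sum_eq_zero fun j _ => ?_
      rw [hω t (Finset.mem_range.mp ht) j, inner_zero_left]
      ring
    -- Two degenerate cases: for `L = 0` there is no damping, and for `r = 0` the term `lam ρ²`
    -- cannot be charged to the rank. In both the gradients vanish along the run, so the left side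
    -- is zero.
    rcases hL.eq_or_lt with hL0 | hLpos
    · refine Filter.Eventually.of_forall fun ω => hzero ω fun t _ j => ?_
      have := hLip _ (hWC t ω) j
      rw [← hL0] at this
      exact norm_le_zero_iff.mp this
    rcases Nat.eq_zero_or_pos r with hr0 | hrpos
    · filter_upwards [ae_gradient_eq_zero_of_intrinsicRank_eq_zero hint hr0] with ω hω
      exact hzero ω hω
    have hlam : 0 < lam := by positivity
    have hcard := ae_all_iff.mpr hI.card_eq
    filter_upwards [ae_rank_sum_batchGram_le (I := I) hint k, hcard] with ω hrank hω
    have hreg := sgn_regret_le (φ := φ) (ℓ := ℓ) (s := s) (η := ξ * α) (w₀ := w₀)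
      (I := fun t => I t ω) hC hconv hα hlam hv (b := B * b ^ 2) (k := k) (fun t _ => by
        calc _ ≤ ∑ _j ∈ I t ω, b ^ 2 := Finset.sum_le_sum fun j _ => by
              rw [← sq_abs]
              exact pow_le_pow_left₀ (abs_nonneg _) (hb _ (hWC t ω) j) 2
          _ = B * b ^ 2 := by rw [Finset.sum_const, hω t, nsmul_eq_mul])
    -- The damping is scaled so that this ratio is free of `α`, `B` and `L`.
    have htr : α * (∑ t ∈ Finset.range k, ∑ j ∈ I t ω,
        ‖∇ (fun u => φ u (s j).1) (W t ω)‖ ^ 2) / lam ≤ k / γ := by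
      have h1 : ∑ t ∈ Finset.range k, ∑ j ∈ I t ω,
          ‖∇ (fun u => φ u (s j).1) (W t ω)‖ ^ 2 ≤ k * (B * L ^ 2) := by
        calc _ ≤ ∑ _t ∈ Finset.range k, (B * L ^ 2 : ℝ) := Finset.sum_le_sum fun t _ => by
              calc _ ≤ ∑ _j ∈ I t ω, L ^ 2 := Finset.sum_le_sum fun j _ =>
                    pow_le_pow_left₀ (norm_nonneg _) (hLip _ (hWC t ω) j) 2
                _ = B * L ^ 2 := by rw [Finset.sum_const, hω t, nsmul_eq_mul]
          _ = k * (B * L ^ 2) := by rw [Finset.sum_const, Finset.card_range, nsmul_eq_mul]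
      rw [div_le_div_iff₀ hlam hγ, hlamdef]
      calc _ ≤ α * (k * (B * L ^ 2)) * γ := by gcongr
        _ = _ := by ring
    have h0 : 0 ≤ α * (∑ t ∈ Finset.range k, ∑ j ∈ I t ω,
        ‖∇ (fun u => φ u (s j).1) (W t ω)‖ ^ 2) / lam := by positivity
    refine hreg.trans ?_
    have hr1 : (1 : ℝ) ≤ r := by exact_mod_cast hrpos
    have e1 : lam * ‖w₀ - v‖ ^ 2 ≤ r * (lam * ρ ^ 2) := by
      calc lam * ‖w₀ - v‖ ^ 2 ≤ 1 * (lam * ρ ^ 2) := by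
            rw [one_mul]; gcongr
        _ ≤ _ := by gcongr
    have e2 : (ξ * α) ^ 2 / α = ξ ^ 2 * α := by field_simp
    have e3 : ((∑ t ∈ Finset.range k, batchGram φ s (I t ω) (W t ω)).rank : ℝ)
        * Real.log (1 + α * (∑ t ∈ Finset.range k, ∑ j ∈ I t ω,
          ‖∇ (fun u => φ u (s j).1) (W t ω)‖ ^ 2) / lam) ≤ r * Real.log (1 + k / γ) := by
      have := Real.log_le_log (by linarith) (add_le_add_right htr 1)
      refine mul_le_mul ?_ this (Real.log_nonneg (by linarith)) (by positivity)
      exact_mod_cast hrank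
    have e4 := mul_le_mul_of_nonneg_left e3 (show 0 ≤ ξ ^ 2 * α * (B * b ^ 2) by positivity)
    rw [e2, hR]
    calc _ ≤ _ := add_le_add e1 e4
      _ = _ := by ring
  have hpath2 : ∀ᵐ ω ∂P, 2 * ξ * α * ∑ t ∈ Finset.range k, ∑ j ∈ I t ω,
      ℓ (φ (W t ω) (s j).1) (s j) ≤ R + α * E * k * B := by
    filter_upwards [hpath, ae_all_iff.mpr hI.card_eq] with ω hω hcard
    have h1 : ∑ t ∈ Finset.range k, ∑ j ∈ I t ω,
        α * (2 * ξ * ℓ (φ (W t ω) (s j).1) (s j) - E) ≤ R := by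
      refine le_trans ?_ hω
      refine Finset.sum_le_sum fun t _ => Finset.sum_le_sum fun j _ => ?_
      have := mul_le_mul_of_nonneg_left (hE _ (hWC t ω) j) hα.le
      linarith
    have h2 : ∑ t ∈ Finset.range k, ∑ j ∈ I t ω,
        α * (2 * ξ * ℓ (φ (W t ω) (s j).1) (s j) - E)
        = 2 * ξ * α * ∑ t ∈ Finset.range k, ∑ j ∈ I t ω, ℓ (φ (W t ω) (s j).1) (s j)
          - α * E * k * B := by
      simp only [mul_sub, Finset.sum_sub_distrib, Finset.sum_const, hcard, Finset.mul_sum,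
        Finset.card_range, nsmul_eq_mul]
      congr 1
      · exact Finset.sum_congr rfl fun t _ => Finset.sum_congr rfl fun j _ => by ring
      · ring
    linarith
  have hdep : ∀ t j, DependsOn (fun x => ℓ (φ (sgnIter φ ℓ s C (ξ * α) α lam w₀ x t) (s j).1) (s j))
      (Finset.range t : Set ℕ) := fun t j _ _ hxy =>
    congrArg (fun w => ℓ (φ w (s j).1) (s j)) (dependsOn_sgnIter le_rfl hxy)
  have hintb : ∀ t, Integrable (fun ω => ∑ j ∈ I t ω, ℓ (φ (W t ω) (s j).1) (s j)) P := fun t => by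
    refine integrable_of_dependsOn hI.measurable (k := t + 1)
      (F := fun x => ∑ j ∈ x t, ℓ (φ (sgnIter φ ℓ s C (ξ * α) α lam w₀ x t) (s j).1) (s j))
      fun x y hxy => ?_
    have h1 : sgnIter φ ℓ s C (ξ * α) α lam w₀ x t = sgnIter φ ℓ s C (ξ * α) α lam w₀ y t :=
      dependsOn_sgnIter (Nat.le_succ t) hxy
    have h2 : x t = y t := hxy t (by simp)
    simp only [h1, h2]
  have hintj : ∀ t j, Integrable (fun ω => ℓ (φ (W t ω) (s j).1) (s j)) P := fun t j =>
    integrable_of_dependsOn hI.measurable (hdep t j)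
  -- The iterate `W t` uses only batches before `t`, so batch `t` samples its losses without bias.
  have hexp : ∀ t, ∫ ω, ∑ j ∈ I t ω, ℓ (φ (W t ω) (s j).1) (s j) ∂P
      = B * ∫ ω, empRisk ℓ s (φ (W t ω)) ∂P := by
    intro t
    have h1 := hI.integral_sum_mem hB hBn (hdep t)
    change ∫ ω, ∑ j ∈ I t ω, ℓ (φ (W t ω) (s j).1) (s j) ∂P
      = (B / n : ℝ) * ∑ j, ∫ ω, ℓ (φ (W t ω) (s j).1) (s j) ∂P at h1
    rw [h1]
    simp only [empRisk]
    rw [integral_const_mul, integral_finsetSum _ fun j _ => hintj t j]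
    ring
  have hfin : 2 * ξ * α * ∑ t ∈ Finset.range k, (B * ∫ ω, empRisk ℓ s (φ (W t ω)) ∂P)
      ≤ R + α * E * k * B := by
    have h1 := integral_mono_ae
      ((integrable_finsetSum (Finset.range k) fun t _ => hintb t).const_mul (2 * ξ * α))
      (integrable_const (μ := P) (R + α * E * k * B)) hpath2
    rw [integral_const_mul, integral_finsetSum _ fun t _ => hintb t] at h1
    simpa [hexp] using h1
  rw [← Finset.mul_sum] at hfin
  have hden : 0 < 2 * ξ * α * B * k := by positivity
  have e5 : E / (2 * ξ) + r * (γ * L ^ 2 * ρ ^ 2 + ξ ^ 2 * b ^ 2 * Real.log (1 + k / γ)) / (2 * ξ * k)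
      = (R + α * E * k * B) / (2 * ξ * α * B * k) := by
    rw [hR, hlamdef]
    field_simp
    ring
  rw [e5, le_div_iff₀ hden]
  calc _ = 2 * ξ * α * (B * ∑ t ∈ Finset.range k, ∫ ω, empRisk ℓ s (φ (W t ω)) ∂P) := by
        field_simp
        rfl
    _ ≤ _ := hfin


variable {Z : Set (Sample d)} {ν ξ : ℝ} {β : Set ℝ → ℝ≥0}

theorem IsLoss.strongConvexity_bound (hℓ : IsLoss Z ν β ℓ) (hξ : 2 / ν ≤ ξ) :
    0 < ξ ∧ 2 ≤ ξ * ν :=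
  ⟨(div_pos two_pos hℓ.pos).trans_le hξ, (div_le_iff₀ hℓ.pos).mp hξ⟩

theorem IsLoss.abs_deriv_le (hℓ : IsLoss Z ν β ℓ) {z : Sample d} (hz : z ∈ Z) {R : ℝ} (hR : 0 < R)
    {u : ℝ} (hu : u ∈ Set.Icc (-R) R) :
    |deriv (fun u => ℓ u z) u| ≤ β (Set.Icc (-R) R) :=
  abs_deriv_le_of_lipschitzOnWith_Icc (by linarith) (hℓ.differentiable_deriv z hz).continuous
    (hℓ.lipschitz z hz _ isCompact_Icc) hu

/-- Of the term `2 β ε`, one half comes from the regret and the other from replacing the mean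
prediction by the prediction of the average iterate. -/
theorem integral_empRisk_average_le (hI : IsBatchSampling P B I) (hB : 1 ≤ B) (hBn : B ≤ n)
    (hC : IsCompact C) (hconv : Convex ℝ C) (hw₀ : w₀ ∈ C) (hv : v ∈ C)
    (hℓ : IsLoss Z ν β ℓ) (hξν : 2 / ν ≤ ξ) (hs : ∀ j, s j ∈ Z) (hy : ∀ j, ℓ (s j).2 (s j) = 0)
    {α γ L ρ R τ ε : ℝ} (hα : 0 < α) (hγ : 0 < γ) (hL : 0 ≤ L) (hρ : ‖w₀ - v‖ ≤ ρ)
    (hLip : ∀ w ∈ C, ∀ j, ‖∇ (fun u => φ u (s j).1) w‖ ≤ L)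
    (hR : 0 < R) (hφ : ∀ w ∈ C, ∀ j, φ w (s j).1 ∈ Set.Icc (-R) R)
    (hτ : IsNearlyLinearOn φ s C τ) (hτε : τ ≤ ε) (hε : ∀ w ∈ C, ∀ j,
      |φ w (s j).1 - ⟪∇ (fun u => φ u (s j).1) w, w - v⟫ - (s j).2| ≤ ε) {k : ℕ} (hk : 0 < k) :
    ∫ ω, empRisk ℓ s (φ (average (sgnIter φ ℓ s C (ξ * α) α (γ * α * L ^ 2 * B) w₀
        fun t => I t ω) k)) ∂P
      ≤ 2 * β (Set.Icc (-R) R) * ε + 3 * ε ^ 2 / (2 * ξ)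
        + intrinsicRank P φ s
          (fun t ω => sgnIter φ ℓ s C (ξ * α) α (γ * α * L ^ 2 * B) w₀ (fun t' => I t' ω) t) k
        * (γ * L ^ 2 * ρ ^ 2
          + ξ ^ 2 * β (Set.Icc (-R) R) ^ 2 * Real.log (1 + k / γ)) / (2 * ξ * k) := by
  obtain ⟨hξ, hξν'⟩ := hℓ.strongConvexity_bound hξν
  set b : ℝ := ((β (Set.Icc (-R) R) : ℝ≥0) : ℝ) with hbdef
  have hb : ∀ w ∈ C, ∀ j, |deriv (fun u => ℓ u (s j)) (φ w (s j).1)| ≤ b := fun w hw j =>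
    hℓ.abs_deriv_le (hs j) hR (hφ w hw j)
  have hb0 : 0 ≤ b := (β (Set.Icc (-R) R)).2
  have hmain := sum_integral_empRisk_sgnIter_le hI hB hBn hC hconv hw₀ hv hα hξ hγ hL hρ hLip hb
    (fun w hw j => two_mul_loss_sub_le (hℓ.differentiable _ (hs j)) (hℓ.strongConvex _ (hs j))
      hξ.le hξν' (hy j) (hb w hw j) (hε w hw j)) hk
  have hpt : ∀ ω, empRisk ℓ s (φ (average (sgnIter φ ℓ s C (ξ * α) α (γ * α * L ^ 2 * B) w₀
      fun t => I t ω) k)) ≤ 1 * ((1 / (k : ℝ)) * ∑ t ∈ Finset.range k, empRisk ℓ s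
        (φ (sgnIter φ ℓ s C (ξ * α) α (γ * α * L ^ 2 * B) w₀ (fun t => I t ω) t))) + b * ε := by
    intro ω
    have hmem := fun t => sgnIter_mem (φ := φ) (ℓ := ℓ) (s := s) (η := ξ * α) (α := α)
      (lam := γ * α * L ^ 2 * B) (I := fun t => I t ω) hC hw₀ t
    refine empRisk_average_le (hB.trans hBn) fun j => ?_
    have h1 := loss_le_add_mul (hℓ.differentiable _ (hs j)) (hℓ.strongConvex _ (hs j)) hℓ.pos.le
      (hb _ (average_mem hconv hmem hk) j) ((hτ.abs_mean_sub_le hconv hmem hk j).trans hτε)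
    have h2 := loss_mean_le (convexOn_of_strongConvexOn hℓ.pos.le (hℓ.strongConvex _ (hs j)))
      (fun t => φ (sgnIter φ ℓ s C (ξ * α) α (γ * α * L ^ 2 * B) w₀ (fun t => I t ω) t) (s j).1) hk
    linarith
  have hint := integral_mono (integrable_empRisk_average hI k)
    ((((integrable_finsetSum (Finset.range k) fun t _ => integrable_empRisk_sgnIter hI t).const_mul
      (1 / (k : ℝ))).const_mul 1).add (integrable_const (b * ε))) hpt
  simp only [Pi.add_apply] at hint
  rw [integral_add, integral_const_mul, integral_const_mul,
    integral_finsetSum _ fun t _ => integrable_empRisk_sgnIter hI t] at hint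
  · simp only [integral_const, probReal_univ, one_smul, one_mul] at hint
    have e1 : (2 * ξ * b * ε + 3 * ε ^ 2) / (2 * ξ) = b * ε + 3 * ε ^ 2 / (2 * ξ) := by
      field_simp
    rw [e1] at hmain
    linarith
  · exact ((integrable_finsetSum (Finset.range k) fun t _ =>
      integrable_empRisk_sgnIter hI t).const_mul (1 / (k : ℝ))).const_mul 1
  · exact integrable_const (b * ε)

/-- Averaging doubles the mean risk, hence the denominator `ξ k` in place of `2 ξ k`, and `3 ξ D²
ε²` is `2 ξ D² ε²` from the regret plus `ξ D² ε²` from averaging. -/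
theorem integral_empRisk_average_le_of_abs_deriv_le (hI : IsBatchSampling P B I) (hB : 1 ≤ B)
    (hBn : B ≤ n) (hC : IsCompact C) (hconv : Convex ℝ C) (hw₀ : w₀ ∈ C) (hv : v ∈ C)
    (hℓ : IsLoss Z ν β ℓ) (hξν : 2 / ν ≤ ξ) (hs : ∀ j, s j ∈ Z) (hy : ∀ j, ℓ (s j).2 (s j) = 0)
    {α γ L ρ R τ ε D : ℝ} (hα : 0 < α) (hγ : 0 < γ) (hL : 0 ≤ L) (hρ : ‖w₀ - v‖ ≤ ρ)
    (hLip : ∀ w ∈ C, ∀ j, ‖∇ (fun u => φ u (s j).1) w‖ ≤ L)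
    (hR : 0 < R) (hφ : ∀ w ∈ C, ∀ j, φ w (s j).1 ∈ Set.Icc (-R) R)
    (hyR : ∀ j, (s j).2 ∈ Set.Icc (-R) R)
    (hD : ∀ j, ∀ t ∈ Set.Icc (-R) R, |deriv (fun r => ℓ r (s j)) t| ≤ D * |t - (s j).2|)
    (hτ : IsNearlyLinearOn φ s C τ) (hτε : τ ≤ ε) (hε : ∀ w ∈ C, ∀ j,
      |φ w (s j).1 - ⟪∇ (fun u => φ u (s j).1) w, w - v⟫ - (s j).2| ≤ ε) {k : ℕ} (hk : 0 < k) :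
    ∫ ω, empRisk ℓ s (φ (average (sgnIter φ ℓ s C (ξ * α) α (γ * α * L ^ 2 * B) w₀
        fun t => I t ω) k)) ∂P
      ≤ 3 * ξ * D ^ 2 * ε ^ 2 + 3 * ε ^ 2 / ξ
        + intrinsicRank P φ s
          (fun t ω => sgnIter φ ℓ s C (ξ * α) α (γ * α * L ^ 2 * B) w₀ (fun t' => I t' ω) t) k
        * (γ * L ^ 2 * ρ ^ 2
          + ξ ^ 2 * β (Set.Icc (-R) R) ^ 2 * Real.log (1 + k / γ)) / (ξ * k) := by
  obtain ⟨hξ, hξν'⟩ := hℓ.strongConvexity_bound hξν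
  set b : ℝ := ((β (Set.Icc (-R) R) : ℝ≥0) : ℝ) with hbdef
  have hb : ∀ w ∈ C, ∀ j, |deriv (fun u => ℓ u (s j)) (φ w (s j).1)| ≤ b := fun w hw j =>
    hℓ.abs_deriv_le (hs j) hR (hφ w hw j)
  have hk' : (0 : ℝ) < k := by exact_mod_cast hk
  have hmain := sum_integral_empRisk_sgnIter_le hI hB hBn hC hconv hw₀ hv hα hξ hγ hL hρ hLip hb
    (fun w hw j => two_mul_loss_sub_le_of_abs_deriv_le (hℓ.differentiable _ (hs j))
      (hℓ.strongConvex _ (hs j)) hξ.le hξν' (hy j) (hD j _ (hφ w hw j)) (hε w hw j)) hk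
  -- The bound `hD` at the label itself forces a critical point there.
  have hDy : ∀ j, deriv (fun r => ℓ r (s j)) (s j).2 = 0 := fun j => by
    have := hD j _ (hyR j)
    rw [sub_self, abs_zero, mul_zero] at this
    exact abs_nonpos_iff.mp this
  have hpt : ∀ ω, empRisk ℓ s (φ (average (sgnIter φ ℓ s C (ξ * α) α (γ * α * L ^ 2 * B) w₀
      fun t => I t ω) k)) ≤ 2 * ((1 / (k : ℝ)) * ∑ t ∈ Finset.range k, empRisk ℓ s
        (φ (sgnIter φ ℓ s C (ξ * α) α (γ * α * L ^ 2 * B) w₀ (fun t => I t ω) t)))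
        + ξ * D ^ 2 * ε ^ 2 := by
    intro ω
    have hmem := fun t => sgnIter_mem (φ := φ) (ℓ := ℓ) (s := s) (η := ξ * α) (α := α)
      (lam := γ * α * L ^ 2 * B) (I := fun t => I t ω) hC hw₀ t
    refine empRisk_average_le (hB.trans hBn) fun j => ?_
    have h1 := loss_le_two_mul_add (hℓ.differentiable _ (hs j)) (hℓ.strongConvex _ (hs j))
      hℓ.pos.le hξ hξν' (hy j) (hD j _ (hφ _ (average_mem hconv hmem hk) j)) (hDy j)
      ((hτ.abs_mean_sub_le hconv hmem hk j).trans hτε)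
    have h2 := loss_mean_le (convexOn_of_strongConvexOn hℓ.pos.le (hℓ.strongConvex _ (hs j)))
      (fun t => φ (sgnIter φ ℓ s C (ξ * α) α (γ * α * L ^ 2 * B) w₀ (fun t => I t ω) t) (s j).1) hk
    linarith
  have hint := integral_mono (integrable_empRisk_average hI k)
    ((((integrable_finsetSum (Finset.range k) fun t _ => integrable_empRisk_sgnIter hI t).const_mul
      (1 / (k : ℝ))).const_mul 2).add (integrable_const (ξ * D ^ 2 * ε ^ 2))) hpt
  simp only [Pi.add_apply] at hint
  rw [integral_add, integral_const_mul, integral_const_mul,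
    integral_finsetSum _ fun t _ => integrable_empRisk_sgnIter hI t] at hint
  · simp only [integral_const, probReal_univ, one_smul] at hint
    have hmain2 := mul_le_mul_of_nonneg_left hmain zero_le_two
    have e1 : 2 * ((2 * ξ ^ 2 * D ^ 2 * ε ^ 2 + 3 * ε ^ 2) / (2 * ξ)
        + intrinsicRank P φ s (fun t ω => sgnIter φ ℓ s C (ξ * α) α (γ * α * L ^ 2 * B) w₀
          (fun t' => I t' ω) t) k * (γ * L ^ 2 * ρ ^ 2 + ξ ^ 2 * b ^ 2 * Real.log (1 + k / γ))
          / (2 * ξ * k))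
        = 2 * ξ * D ^ 2 * ε ^ 2 + 3 * ε ^ 2 / ξ
          + intrinsicRank P φ s (fun t ω => sgnIter φ ℓ s C (ξ * α) α (γ * α * L ^ 2 * B) w₀
          (fun t' => I t' ω) t) k * (γ * L ^ 2 * ρ ^ 2 + ξ ^ 2 * b ^ 2 * Real.log (1 + k / γ))
          / (ξ * k) := by
      field_simp
    rw [e1] at hmain2
    linarith
  · exact ((integrable_finsetSum (Finset.range k) fun t _ =>
      integrable_empRisk_sgnIter hI t).const_mul (1 / (k : ℝ))).const_mul 2
  · exact integrable_const (ξ * D ^ 2 * ε ^ 2)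

end Convergence

/-! ### Single-hidden-layer networks -/

section Activation

variable {σ : ℝ → ℝ} {σ₀ σ₁ σ₂ : ℝ}

theorem IsActivation.differentiable (hσ : IsActivation σ σ₀ σ₁ σ₂) : Differentiable ℝ σ :=
  hσ.contDiff.differentiable two_ne_zero

theorem IsActivation.differentiable_deriv (hσ : IsActivation σ σ₀ σ₁ σ₂) :
    Differentiable ℝ (deriv σ) :=
  (ContDiff.deriv' (n := 1) (by simpa [one_add_one_eq_two] using hσ.contDiff)).differentiable
    one_ne_zero

theorem IsActivation.nonneg₀ (hσ : IsActivation σ σ₀ σ₁ σ₂) : 0 ≤ σ₀ :=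
  (abs_nonneg _).trans (hσ.bound 0)

theorem IsActivation.nonneg₁ (hσ : IsActivation σ σ₀ σ₁ σ₂) : 0 ≤ σ₁ :=
  (abs_nonneg _).trans (hσ.bound_deriv 0)

theorem IsActivation.nonneg₂ (hσ : IsActivation σ σ₀ σ₁ σ₂) : 0 ≤ σ₂ :=
  (abs_nonneg _).trans (hσ.bound_deriv_deriv 0)

theorem IsActivation.abs_sub_le (hσ : IsActivation σ σ₀ σ₁ σ₂) (s t : ℝ) :
    |σ t - σ s| ≤ σ₁ * |t - s| :=
  convex_univ.norm_image_sub_le_of_norm_deriv_le (fun x _ => hσ.differentiable x)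
    (fun x _ => hσ.bound_deriv x) (Set.mem_univ s) (Set.mem_univ t)

theorem IsActivation.abs_deriv_sub_le (hσ : IsActivation σ σ₀ σ₁ σ₂) (s t : ℝ) :
    |deriv σ t - deriv σ s| ≤ σ₂ * |t - s| :=
  convex_univ.norm_image_sub_le_of_norm_deriv_le (fun x _ => hσ.differentiable_deriv x)
    (fun x _ => hσ.bound_deriv_deriv x) (Set.mem_univ s) (Set.mem_univ t)

/-- The mean value inequality for `σ - σ'(s) x` between `s` and `t`; the sharper factor `1/2` is not
needed. -/
theorem IsActivation.abs_taylor_le (hσ : IsActivation σ σ₀ σ₁ σ₂) (s t : ℝ) :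
    |σ t - σ s - deriv σ s * (t - s)| ≤ σ₂ * (t - s) ^ 2 := by
  have hd : ∀ x, HasDerivAt (fun x => σ x - deriv σ s * x) (deriv σ x - deriv σ s) x := fun x => by
    exact ((hσ.differentiable x).hasDerivAt.sub
      ((hasDerivAt_id x).const_mul (deriv σ s))).congr_deriv (by rw [mul_one])
  have h1 := (convex_uIcc s t).norm_image_sub_le_of_norm_deriv_le
    (f := fun x => σ x - deriv σ s * x) (C := σ₂ * |t - s|)
    (fun x _ => (hd x).differentiableAt) (fun x hx => by
      rw [(hd x).deriv]
      refine (hσ.abs_deriv_sub_le s x).trans ?_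
      exact mul_le_mul_of_nonneg_left (Set.abs_sub_left_of_mem_uIcc hx) hσ.nonneg₂)
    Set.left_mem_uIcc Set.right_mem_uIcc
  rw [Real.norm_eq_abs, Real.norm_eq_abs, mul_assoc, ← sq, sq_abs] at h1
  convert h1 using 2
  ring

end Activation

/-! ### Gradient and linearization error of the network -/

section Network

variable {σ : ℝ → ℝ} {σ₀ σ₁ σ₂ : ℝ} {m d : ℕ}

theorem neuron_sub (w v : Params m d) (i : Fin m) : neuron (w - v) i = neuron w i - neuron v i := rfl

theorem innerWeight_sub (u v : EuclideanSpace ℝ (Fin (d + 1))) :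
    innerWeight (u - v) = innerWeight u - innerWeight v := rfl

theorem norm_sq_eq_add_innerWeight (u : EuclideanSpace ℝ (Fin (d + 1))) :
    ‖u‖ ^ 2 = u 0 ^ 2 + ‖innerWeight u‖ ^ 2 := by
  rw [EuclideanSpace.real_norm_sq_eq, EuclideanSpace.real_norm_sq_eq, Fin.sum_univ_succ]
  rfl

theorem norm_sq_eq_sum_neuron (w : Params m d) : ‖w‖ ^ 2 = ∑ i, ‖neuron w i‖ ^ 2 := by
  rw [EuclideanSpace.real_norm_sq_eq, Fintype.sum_prod_type]
  simp only [EuclideanSpace.real_norm_sq_eq]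
  rfl

/-- The output weight of the neuron `i`, as a linear form in the parameters. -/
noncomputable def outputForm (m d : ℕ) (i : Fin m) : Params m d →L[ℝ] ℝ :=
  EuclideanSpace.proj (i, (0 : Fin (d + 1)))

/-- The input `⟪W_i, x⟫` of the neuron `i`, as a linear form in the parameters. -/
noncomputable def inputForm (x : EuclideanSpace ℝ (Fin d)) (i : Fin m) : Params m d →L[ℝ] ℝ :=
  ∑ a, x a • (EuclideanSpace.proj (i, a.succ) : Params m d →L[ℝ] ℝ)

theorem outputForm_apply (w : Params m d) (i : Fin m) : outputForm m d i w = neuron w i 0 := rfl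

theorem inputForm_apply (x : EuclideanSpace ℝ (Fin d)) (w : Params m d) (i : Fin m) :
    inputForm x i w = ⟪innerWeight (neuron w i), x⟫ := by
  simp [inputForm, PiLp.inner_apply, innerWeight, neuron]

theorem hasFDerivAt_network (hσ : IsActivation σ σ₀ σ₁ σ₂) (x : EuclideanSpace ℝ (Fin d))
    (w : Params m d) :
    HasFDerivAt (fun v => network σ m d v x)
      ((1 / √(m : ℝ)) • ∑ i, (neuron w i 0 • (deriv σ ⟪innerWeight (neuron w i), x⟫ • inputForm x i)
        + σ ⟪innerWeight (neuron w i), x⟫ • outputForm m d i)) w := by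
  unfold network
  refine HasFDerivAt.const_mul (HasFDerivAt.fun_sum fun i _ => ?_) _
  have h1 : HasFDerivAt (fun v : Params m d => neuron v i 0) (outputForm m d i) w :=
    (outputForm m d i).hasFDerivAt
  have h2 : HasFDerivAt (fun v : Params m d => ⟪innerWeight (neuron v i), x⟫) (inputForm x i) w := by
    simpa only [← inputForm_apply] using (inputForm x i).hasFDerivAt
  exact h1.mul ((hσ.differentiable _).hasDerivAt.comp_hasFDerivAt w h2)

theorem inner_gradient_network (hσ : IsActivation σ σ₀ σ₁ σ₂) (x : EuclideanSpace ℝ (Fin d))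
    (w v : Params m d) :
    ⟪∇ (fun u => network σ m d u x) w, v⟫ = (1 / √(m : ℝ)) * ∑ i,
      (neuron w i 0 * (deriv σ ⟪innerWeight (neuron w i), x⟫ * ⟪innerWeight (neuron v i), x⟫)
        + σ ⟪innerWeight (neuron w i), x⟫ * neuron v i 0) := by
  rw [inner_gradient_left, (hasFDerivAt_network hσ x w).fderiv]
  simp [inputForm_apply, outputForm_apply]

theorem abs_inner_innerWeight_le {x : EuclideanSpace ℝ (Fin d)} (hx : ‖x‖ ≤ 1)
    (u : EuclideanSpace ℝ (Fin (d + 1))) : |⟪innerWeight u, x⟫| ≤ ‖innerWeight u‖ :=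
  (abs_real_inner_le_norm _ _).trans (mul_le_of_le_one_right (norm_nonneg _) hx)

/-- Pair the gradient with itself and apply Cauchy–Schwarz within and then across neurons. Only the
mean square of the output weights enters, so no factor `log m` arises. -/
theorem norm_sq_gradient_network_le (hσ : IsActivation σ σ₀ σ₁ σ₂) (hm : 0 < m)
    {x : EuclideanSpace ℝ (Fin d)} (hx : ‖x‖ ≤ 1) (w : Params m d) :
    ‖∇ (fun u => network σ m d u x) w‖ ^ 2
      ≤ σ₀ ^ 2 + σ₁ ^ 2 * ((1 / (m : ℝ)) * ∑ i, neuron w i 0 ^ 2) := by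
  have hm' : (0 : ℝ) < m := by exact_mod_cast hm
  set v := ∇ (fun u => network σ m d u x) w with hv
  have hn0 := hσ.nonneg₀
  have hn1 := hσ.nonneg₁
  have h1 : ‖v‖ ^ 2 ≤ (1 / √(m : ℝ)) * ∑ i,
      √(σ₀ ^ 2 + σ₁ ^ 2 * neuron w i 0 ^ 2) * ‖neuron v i‖ := by
    rw [← real_inner_self_eq_norm_sq v]
    conv_lhs => rw [hv]
    rw [← hv, inner_gradient_network hσ]
    refine mul_le_mul_of_nonneg_left (Finset.sum_le_sum fun i _ => ?_) (by positivity)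
    set c := neuron w i 0
    set z := ⟪innerWeight (neuron w i), x⟫
    have hz := abs_inner_innerWeight_le hx (neuron v i)
    have hnorm := norm_sq_eq_add_innerWeight (neuron v i)
    set y := ⟪innerWeight (neuron v i), x⟫
    set q := ‖innerWeight (neuron v i)‖
    set e := neuron v i 0
    have hq : 0 ≤ q := norm_nonneg _
    refine le_trans (le_abs_self _) (abs_le_of_sq_le_sq ?_ (by positivity))|>.trans le_rfl
    rw [mul_pow, Real.sq_sqrt (by positivity), hnorm]
    have hA : (c * deriv σ z) ^ 2 ≤ σ₁ ^ 2 * c ^ 2 := by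
      rw [mul_pow, mul_comm]
      exact mul_le_mul_of_nonneg_right (sq_le_sq' (abs_le.mp (hσ.bound_deriv z)).1
        (abs_le.mp (hσ.bound_deriv z)).2) (sq_nonneg _)
    have hS : σ z ^ 2 ≤ σ₀ ^ 2 :=
      sq_le_sq' (abs_le.mp (hσ.bound z)).1 (abs_le.mp (hσ.bound z)).2
    have hy : y ^ 2 ≤ q ^ 2 := sq_le_sq' (abs_le.mp hz).1 (abs_le.mp hz).2
    calc (c * (deriv σ z * y) + σ z * e) ^ 2
        ≤ ((c * deriv σ z) ^ 2 + σ z ^ 2) * (y ^ 2 + e ^ 2) := by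
          nlinarith [sq_nonneg (c * deriv σ z * e - σ z * y)]
      _ ≤ (σ₁ ^ 2 * c ^ 2 + σ₀ ^ 2) * (q ^ 2 + e ^ 2) := by gcongr
      _ = _ := by ring
  have h2 : ∑ i, √(σ₀ ^ 2 + σ₁ ^ 2 * neuron w i 0 ^ 2) * ‖neuron v i‖
      ≤ √(m * σ₀ ^ 2 + σ₁ ^ 2 * ∑ i, neuron w i 0 ^ 2) * ‖v‖ := by
    refine abs_le_of_sq_le_sq ?_ (by positivity) |> (le_abs_self _).trans
    rw [mul_pow, Real.sq_sqrt (by positivity), norm_sq_eq_sum_neuron v]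
    refine (Finset.sum_mul_sq_le_sq_mul_sq _ _ _).trans (le_of_eq ?_)
    congr 1
    rw [Finset.sum_congr rfl fun i _ => Real.sq_sqrt (by positivity), Finset.sum_add_distrib,
      Finset.mul_sum]
    simp
  have h3 : ‖v‖ ^ 2 ≤ (1 / √(m : ℝ)) * (√(m * σ₀ ^ 2 + σ₁ ^ 2 * ∑ i, neuron w i 0 ^ 2) * ‖v‖) :=
    h1.trans (mul_le_mul_of_nonneg_left h2 (by positivity))
  have h4 : (1 / √(m : ℝ)) * (√(m * σ₀ ^ 2 + σ₁ ^ 2 * ∑ i, neuron w i 0 ^ 2) * ‖v‖)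
      = √(σ₀ ^ 2 + σ₁ ^ 2 * ((1 / (m : ℝ)) * ∑ i, neuron w i 0 ^ 2)) * ‖v‖ := by
    rw [← mul_assoc, one_div, inv_mul_eq_div, ← Real.sqrt_div (by positivity)]
    congr 2
    field_simp
  rw [h4, sq] at h3
  have h5 : ‖v‖ ≤ √(σ₀ ^ 2 + σ₁ ^ 2 * ((1 / (m : ℝ)) * ∑ i, neuron w i 0 ^ 2)) := by
    rcases (norm_nonneg v).eq_or_lt with h0 | h0
    · rw [← h0]; positivity
    · exact le_of_mul_le_mul_right h3 h0
  exact (Real.le_sqrt (norm_nonneg _) (by positivity)).mp h5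

/-- The linearization error of the network is quadratic, with a constant of order `1 / √m`. -/
theorem abs_network_sub_linearization_le (hσ : IsActivation σ σ₀ σ₁ σ₂)
    {x : EuclideanSpace ℝ (Fin d)} (hx : ‖x‖ ≤ 1) {w : Params m d} {b : ℝ}
    (hb : ∀ i, |neuron w i 0| ≤ b) (hb0 : 0 ≤ b) (w' : Params m d) :
    |network σ m d w' x - network σ m d w x - ⟪∇ (fun u => network σ m d u x) w, w' - w⟫|
      ≤ (1 / √(m : ℝ)) * ((σ₁ + b * σ₂) * ‖w' - w‖ ^ 2) := by
  have hn1 := hσ.nonneg₁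
  have hn2 := hσ.nonneg₂
  rw [inner_gradient_network hσ, network, network, ← mul_sub, ← mul_sub, abs_mul,
    abs_of_nonneg (by positivity : 0 ≤ 1 / √(m : ℝ)), ← Finset.sum_sub_distrib,
    ← Finset.sum_sub_distrib, norm_sq_eq_sum_neuron, Finset.mul_sum]
  refine mul_le_mul_of_nonneg_left ((Finset.abs_sum_le_sum_abs _ _).trans
    (Finset.sum_le_sum fun i _ => ?_)) (by positivity)
  have hz := abs_inner_innerWeight_le hx (neuron (w' - w) i)
  have hnorm := norm_sq_eq_add_innerWeight (neuron (w' - w) i)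
  have he : ⟪innerWeight (neuron (w' - w) i), x⟫
      = ⟪innerWeight (neuron w' i), x⟫ - ⟪innerWeight (neuron w i), x⟫ := by
    rw [neuron_sub, innerWeight_sub, inner_sub_left]
  have hc : neuron (w' - w) i 0 = neuron w' i 0 - neuron w i 0 := rfl
  rw [he] at hz ⊢
  rw [hnorm, hc]
  set z' := ⟪innerWeight (neuron w' i), x⟫
  set z := ⟪innerWeight (neuron w i), x⟫
  set c' := neuron w' i 0
  set c := neuron w i 0
  set q := ‖innerWeight (neuron (w' - w) i)‖
  -- A product of two increments plus a Taylor remainder of `σ`, both quadratic in the displacement.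
  have h1 : c' * σ z' - c * σ z - (c * (deriv σ z * (z' - z)) + σ z * (c' - c))
      = (c' - c) * (σ z' - σ z) + c * (σ z' - σ z - deriv σ z * (z' - z)) := by ring
  have h2 : |(c' - c) * (σ z' - σ z)| ≤ σ₁ * ((c' - c) ^ 2 + (z' - z) ^ 2) := by
    rw [abs_mul]
    calc |c' - c| * |σ z' - σ z| ≤ |c' - c| * (σ₁ * |z' - z|) := by
          gcongr; exact hσ.abs_sub_le z z'
      _ = σ₁ * (|c' - c| * |z' - z|) := by ring
      _ ≤ σ₁ * ((c' - c) ^ 2 + (z' - z) ^ 2) := by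
          gcongr
          rw [← sq_abs (c' - c), ← sq_abs (z' - z)]
          nlinarith [sq_nonneg (|c' - c| - |z' - z|), sq_nonneg (|c' - c|), sq_nonneg (|z' - z|)]
  have h3 : |c * (σ z' - σ z - deriv σ z * (z' - z))| ≤ b * (σ₂ * (z' - z) ^ 2) := by
    rw [abs_mul]
    exact mul_le_mul (hb i) (hσ.abs_taylor_le z z') (abs_nonneg _) hb0
  have h4 : (z' - z) ^ 2 ≤ q ^ 2 := sq_le_sq' (abs_le.mp hz).1 (abs_le.mp hz).2
  rw [h1]
  calc _ ≤ _ := abs_add_le _ _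
    _ ≤ σ₁ * ((c' - c) ^ 2 + (z' - z) ^ 2) + b * (σ₂ * (z' - z) ^ 2) := add_le_add h2 h3
    _ ≤ σ₁ * ((c' - c) ^ 2 + q ^ 2) + b * (σ₂ * ((c' - c) ^ 2 + q ^ 2)) := by
        gcongr
        nlinarith [sq_nonneg (c' - c)]
    _ = _ := by ring

theorem abs_neuron_zero_le_norm (w : Params m d) (i : Fin m) : |neuron w i 0| ≤ ‖w‖ :=
  PiLp.norm_apply_le w (i, 0)

theorem sum_sq_neuron_zero_le (w : Params m d) : ∑ i, neuron w i 0 ^ 2 ≤ ‖w‖ ^ 2 := by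
  rw [norm_sq_eq_sum_neuron]
  refine Finset.sum_le_sum fun i _ => ?_
  rw [norm_sq_eq_add_innerWeight]
  linarith [sq_nonneg ‖innerWeight (neuron w i)‖]

end Network

/-! ### The symmetric initialization -/

section SymInit

variable {σ : ℝ → ℝ} {σ₀ σ₁ σ₂ : ℝ} {h d : ℕ}

theorem sum_fin_two_mul (f : Fin (2 * h) → ℝ) :
    ∑ i, f i = ∑ i : Fin h, (f ⟨i, by omega⟩ + f ⟨h + i, by omega⟩) := by
  rw [← Equiv.sum_comp (finCongr (two_mul h)).symm, Fin.sum_univ_add, Finset.sum_add_distrib]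
  rfl

theorem neuron_symInit_left (ω : Fin h → EuclideanSpace ℝ (Fin (d + 1))) (i : Fin h)
    (hi : (i : ℕ) < 2 * h) : neuron (symInit ω) ⟨i, hi⟩ = ω i := by
  ext a
  simp [neuron, symInit]

theorem neuron_symInit_right_zero (ω : Fin h → EuclideanSpace ℝ (Fin (d + 1))) (i : Fin h)
    (hi : h + (i : ℕ) < 2 * h) : neuron (symInit ω) ⟨h + i, hi⟩ 0 = -ω i 0 := by
  simp [neuron, symInit]

theorem innerWeight_neuron_symInit_right (ω : Fin h → EuclideanSpace ℝ (Fin (d + 1))) (i : Fin h)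
    (hi : h + (i : ℕ) < 2 * h) :
    innerWeight (neuron (symInit ω) ⟨h + i, hi⟩) = innerWeight (ω i) := by
  ext a
  simp [neuron, symInit, innerWeight]

theorem network_symInit (ω : Fin h → EuclideanSpace ℝ (Fin (d + 1)))
    (x : EuclideanSpace ℝ (Fin d)) : network σ (2 * h) d (symInit ω) x = 0 := by
  rw [network, sum_fin_two_mul]
  simp [neuron_symInit_left, neuron_symInit_right_zero, innerWeight_neuron_symInit_right]

/-- The displacement of the symmetric initialization along the transport maps `g` and `t`. -/
noncomputable def transport (g : EuclideanSpace ℝ (Fin (d + 1)) → ℝ)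
    (t : EuclideanSpace ℝ (Fin (d + 1)) → EuclideanSpace ℝ (Fin d))
    (ω : Fin h → EuclideanSpace ℝ (Fin (d + 1))) : Params (2 * h) d :=
  WithLp.toLp 2 fun q => (1 / √((2 * h : ℕ) : ℝ)) *
    if hi : (q.1 : ℕ) < h then
      Fin.cases (g (ω ⟨q.1, hi⟩)) (fun a => t (ω ⟨q.1, hi⟩) a) q.2
    else
      Fin.cases (g (ω ⟨q.1 - h, by have := q.1.isLt; omega⟩))
        (fun a => -t (ω ⟨q.1 - h, by have := q.1.isLt; omega⟩) a) q.2

variable {g : EuclideanSpace ℝ (Fin (d + 1)) → ℝ}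
  {t : EuclideanSpace ℝ (Fin (d + 1)) → EuclideanSpace ℝ (Fin d)}

theorem neuron_transport_left_zero (ω : Fin h → EuclideanSpace ℝ (Fin (d + 1))) (i : Fin h)
    (hi : (i : ℕ) < 2 * h) :
    neuron (transport g t ω) ⟨i, hi⟩ 0 = (1 / √((2 * h : ℕ) : ℝ)) * g (ω i) := by
  simp [neuron, transport]

theorem neuron_transport_right_zero (ω : Fin h → EuclideanSpace ℝ (Fin (d + 1))) (i : Fin h)
    (hi : h + (i : ℕ) < 2 * h) :
    neuron (transport g t ω) ⟨h + i, hi⟩ 0 = (1 / √((2 * h : ℕ) : ℝ)) * g (ω i) := by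
  simp [neuron, transport]

theorem innerWeight_transport_left (ω : Fin h → EuclideanSpace ℝ (Fin (d + 1))) (i : Fin h)
    (hi : (i : ℕ) < 2 * h) :
    innerWeight (neuron (transport g t ω) ⟨i, hi⟩) = (1 / √((2 * h : ℕ) : ℝ)) • t (ω i) := by
  ext a
  simp [neuron, transport, innerWeight]

theorem innerWeight_transport_right (ω : Fin h → EuclideanSpace ℝ (Fin (d + 1))) (i : Fin h)
    (hi : h + (i : ℕ) < 2 * h) :
    innerWeight (neuron (transport g t ω) ⟨h + i, hi⟩) = -((1 / √((2 * h : ℕ) : ℝ)) • t (ω i)) := by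
  ext a
  simp [neuron, transport, innerWeight]

/-- Each of the `2h` neurons moves by at most `√(vc² + vW²) / √(2h)`. Thus the comparator stays in
the ball at every width. -/
theorem norm_transport_le (hh : 0 < h) {vc vW : ℝ} (hg : ∀ ω, |g ω| ≤ vc) (ht : ∀ ω, ‖t ω‖ ≤ vW)
    (ω : Fin h → EuclideanSpace ℝ (Fin (d + 1))) :
    ‖transport g t ω‖ ≤ √(vc ^ 2 + vW ^ 2) := by
  have hh' : (0 : ℝ) < (2 * h : ℕ) := by exact_mod_cast (by omega)
  refine Real.le_sqrt_of_sq_le ?_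
  rw [norm_sq_eq_sum_neuron, sum_fin_two_mul]
  simp only [norm_sq_eq_add_innerWeight, neuron_transport_left_zero, neuron_transport_right_zero,
    innerWeight_transport_left, innerWeight_transport_right, norm_neg, norm_smul, mul_pow,
    Real.norm_eq_abs, sq_abs, div_pow, one_pow, Real.sq_sqrt hh'.le]
  calc _ ≤ ∑ _i : Fin h, (2 / ((2 * h : ℕ) : ℝ)) * (vc ^ 2 + vW ^ 2) := by
        refine Finset.sum_le_sum fun i _ => ?_
        have h1 : g (ω i) ^ 2 ≤ vc ^ 2 :=
          sq_le_sq' (abs_le.mp (hg _)).1 (abs_le.mp (hg _)).2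
        have h2 : ‖t (ω i)‖ ^ 2 ≤ vW ^ 2 := pow_le_pow_left₀ (norm_nonneg _) (ht _) 2
        calc _ = (2 / ((2 * h : ℕ) : ℝ)) * (g (ω i) ^ 2 + ‖t (ω i)‖ ^ 2) := by ring
          _ ≤ _ := by gcongr
    _ = vc ^ 2 + vW ^ 2 := by
        rw [Finset.sum_const, Finset.card_univ, Fintype.card_fin, nsmul_eq_mul]
        push_cast at hh' ⊢
        have : (h : ℝ) ≠ 0 := by linarith [hh'] |> fun h0 : (0 : ℝ) < h => h0.ne'
        field_simp

/-- The feature of the class `ntkClass` at the weights `ω`. -/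
noncomputable def ntkFeature (σ : ℝ → ℝ) (g : EuclideanSpace ℝ (Fin (d + 1)) → ℝ)
    (t : EuclideanSpace ℝ (Fin (d + 1)) → EuclideanSpace ℝ (Fin d)) (x : EuclideanSpace ℝ (Fin d))
    (ω : EuclideanSpace ℝ (Fin (d + 1))) : ℝ :=
  g ω * σ ⟪innerWeight ω, x⟫ + ⟪t ω, (ω 0 * deriv σ ⟪innerWeight ω, x⟫) • x⟫

/-- The sign flip of the inner displacement cancels that of the output weight, so mirror neurons
contribute equally. -/
theorem inner_gradient_transport (hσ : IsActivation σ σ₀ σ₁ σ₂) (hh : 0 < h)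
    (ω : Fin h → EuclideanSpace ℝ (Fin (d + 1))) (x : EuclideanSpace ℝ (Fin d)) :
    ⟪∇ (fun u => network σ (2 * h) d u x) (symInit ω), transport g t ω⟫
      = (1 / (h : ℝ)) * ∑ i, ntkFeature σ g t x (ω i) := by
  have hh' : (0 : ℝ) < h := by exact_mod_cast hh
  rw [inner_gradient_network hσ, sum_fin_two_mul, Finset.mul_sum, Finset.mul_sum]
  refine Finset.sum_congr rfl fun i _ => ?_
  simp only [neuron_symInit_left, neuron_symInit_right_zero, innerWeight_neuron_symInit_right,
    neuron_transport_left_zero, neuron_transport_right_zero, innerWeight_transport_left,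
    innerWeight_transport_right, ntkFeature, inner_neg_left, inner_smul_left, inner_smul_right,
    conj_trivial]
  have hs : (1 / √((2 * h : ℕ) : ℝ)) * (1 / √((2 * h : ℕ) : ℝ)) = 1 / (2 * h) := by
    rw [div_mul_div_comm, Real.mul_self_sqrt (by positivity)]
    push_cast; ring
  set r := 1 / √((2 * h : ℕ) : ℝ)
  calc _ = (r * r) * (2 * (g (ω i) * σ ⟪innerWeight (ω i), x⟫
        + ω i 0 * deriv σ ⟪innerWeight (ω i), x⟫ * ⟪t (ω i), x⟫)) := by ring
    _ = _ := by rw [hs]; field_simp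

theorem sum_sq_neuron_symInit (ω : Fin h → EuclideanSpace ℝ (Fin (d + 1))) :
    ∑ i, neuron (symInit ω) i 0 ^ 2 = 2 * ∑ i, ω i 0 ^ 2 := by
  rw [sum_fin_two_mul, Finset.mul_sum]
  refine Finset.sum_congr rfl fun i _ => ?_
  rw [neuron_symInit_left, neuron_symInit_right_zero]
  ring

theorem abs_neuron_symInit_le {ω : Fin h → EuclideanSpace ℝ (Fin (d + 1))} {b : ℝ}
    (hb : ∀ i, |ω i 0| ≤ b) (i : Fin (2 * h)) : |neuron (symInit ω) i 0| ≤ b := by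
  rcases lt_or_ge (i : ℕ) h with hi | hi
  · have := neuron_symInit_left ω ⟨i, hi⟩ i.isLt
    simp only [Fin.eta] at this
    rw [this]
    exact hb _
  · have h1 : (i : ℕ) - h < h := by have := i.isLt; omega
    have h2 : i = ⟨h + (⟨i - h, h1⟩ : Fin h), by simp; omega⟩ := by ext; simp; omega
    rw [h2, neuron_symInit_right_zero, abs_neg]
    exact hb _

variable {ω : Fin h → EuclideanSpace ℝ (Fin (d + 1))} {ρ a b : ℝ}

theorem norm_gradient_network_le_of_mem_closedBall (hσ : IsActivation σ σ₀ σ₁ σ₂) (hh : 0 < h)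
    (ha : (1 / (h : ℝ)) * ∑ i, ω i 0 ^ 2 ≤ a) {w : Params (2 * h) d}
    (hw : w ∈ Metric.closedBall (symInit ω) ρ) {x : EuclideanSpace ℝ (Fin d)} (hx : ‖x‖ ≤ 1) :
    ‖∇ (fun u => network σ (2 * h) d u x) w‖ ≤ √(σ₀ ^ 2 + σ₁ ^ 2 * (2 * (a + ρ ^ 2))) := by
  have hh' : (1 : ℝ) ≤ h := by exact_mod_cast hh
  refine Real.le_sqrt_of_sq_le ((norm_sq_gradient_network_le hσ (by omega) hx w).trans ?_)
  refine add_le_add le_rfl (mul_le_mul_of_nonneg_left ?_ (sq_nonneg _))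
  rw [mem_closedBall_iff_norm] at hw
  have hw2 : ‖w - symInit ω‖ ^ 2 ≤ ρ ^ 2 := pow_le_pow_left₀ (norm_nonneg _) hw 2
  have h1 : ∑ i, neuron w i 0 ^ 2 ≤ 2 * (2 * ∑ i, ω i 0 ^ 2) + 2 * ρ ^ 2 := by
    calc ∑ i, neuron w i 0 ^ 2
        ≤ ∑ i, (2 * neuron (symInit ω) i 0 ^ 2 + 2 * neuron (w - symInit ω) i 0 ^ 2) := by
          refine Finset.sum_le_sum fun i _ => ?_
          have : neuron w i 0 = neuron (symInit ω) i 0 + neuron (w - symInit ω) i 0 := by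
            rw [neuron_sub, PiLp.sub_apply]; ring
          rw [this]
          nlinarith [sq_nonneg (neuron (symInit ω) i 0 - neuron (w - symInit ω) i 0)]
      _ = 2 * (2 * ∑ i, ω i 0 ^ 2) + 2 * ∑ i, neuron (w - symInit ω) i 0 ^ 2 := by
          rw [Finset.sum_add_distrib, ← Finset.mul_sum, ← Finset.mul_sum, sum_sq_neuron_symInit]
      _ ≤ _ := by
          have := sum_sq_neuron_zero_le (w - symInit ω)
          linarith
  have h2 : ∑ i, ω i 0 ^ 2 ≤ a * h := by
    rw [one_div, inv_mul_le_iff₀ (by linarith)] at ha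
    linarith
  push_cast
  rw [one_div, inv_mul_le_iff₀ (by linarith)]
  nlinarith [sq_nonneg ρ]

theorem abs_network_le_of_mem_closedBall (hσ : IsActivation σ σ₀ σ₁ σ₂) (hh : 0 < h)
    (ha : (1 / (h : ℝ)) * ∑ i, ω i 0 ^ 2 ≤ a) (hρ : 0 ≤ ρ) {w : Params (2 * h) d}
    (hw : w ∈ Metric.closedBall (symInit ω) ρ) {x : EuclideanSpace ℝ (Fin d)} (hx : ‖x‖ ≤ 1) :
    |network σ (2 * h) d w x| ≤ √(σ₀ ^ 2 + σ₁ ^ 2 * (2 * (a + ρ ^ 2))) * ρ := by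
  have h1 := (convex_closedBall (symInit ω) ρ).norm_image_sub_le_of_norm_fderiv_le (𝕜 := ℝ)
    (f := fun v => network σ (2 * h) d v x)
    (C := √(σ₀ ^ 2 + σ₁ ^ 2 * (2 * (a + ρ ^ 2))))
    (fun v _ => (hasFDerivAt_network hσ x v).differentiableAt) (fun v hv => by
      have := norm_gradient_network_le_of_mem_closedBall hσ hh ha hv hx
      rw [← toDual_gradient, LinearIsometryEquiv.norm_map]
      exact this) (Metric.mem_closedBall_self hρ) hw
  rw [network_symInit, sub_zero] at h1
  exact h1.trans (mul_le_mul_of_nonneg_left (mem_closedBall_iff_norm.mp hw) (Real.sqrt_nonneg _))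

theorem abs_network_sub_linearization_le_of_mem_closedBall (hσ : IsActivation σ σ₀ σ₁ σ₂)
    (hb0 : 0 ≤ b) (hb : ∀ i, |ω i 0| ≤ b) (hρ : 0 ≤ ρ) {w w' : Params (2 * h) d}
    (hw : w ∈ Metric.closedBall (symInit ω) ρ) (hw' : w' ∈ Metric.closedBall (symInit ω) ρ)
    {x : EuclideanSpace ℝ (Fin d)} (hx : ‖x‖ ≤ 1) :
    |network σ (2 * h) d w' x - network σ (2 * h) d w x
        - ⟪∇ (fun u => network σ (2 * h) d u x) w, w' - w⟫|
      ≤ (σ₁ + (b + ρ) * σ₂) * (4 * ρ ^ 2) / √((2 * h : ℕ) : ℝ) := by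
  have hn1 := hσ.nonneg₁
  have hn2 := hσ.nonneg₂
  rw [mem_closedBall_iff_norm] at hw hw'
  have hc : ∀ i, |neuron w i 0| ≤ b + ρ := fun i => by
    have : neuron w i 0 = neuron (symInit ω) i 0 + neuron (w - symInit ω) i 0 := by
      rw [neuron_sub, PiLp.sub_apply]; ring
    rw [this]
    exact (abs_add_le _ _).trans (add_le_add (abs_neuron_symInit_le hb i)
      ((abs_neuron_zero_le_norm _ i).trans hw))
  have hn : ‖w' - w‖ ≤ 2 * ρ := by
    have : w' - w = (w' - symInit ω) - (w - symInit ω) := by abel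
    rw [this]
    linarith [norm_sub_le (w' - symInit ω) (w - symInit ω)]
  refine (abs_network_sub_linearization_le hσ hx hc (by linarith) w').trans ?_
  rw [one_div, inv_mul_eq_div]
  gcongr
  calc ‖w' - w‖ ^ 2 ≤ (2 * ρ) ^ 2 := by gcongr
    _ = _ := by ring

/-- On the ball, the linearized prediction at `w` of the transported parameter is close to the
empirical mean of the features. -/
theorem abs_linearization_sub_mean_le (hσ : IsActivation σ σ₀ σ₁ σ₂) (hh : 0 < h)
    (hb0 : 0 ≤ b) (hb : ∀ i, |ω i 0| ≤ b) (hρ : 0 ≤ ρ) (hv : ‖transport g t ω‖ ≤ ρ)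
    {w : Params (2 * h) d} (hw : w ∈ Metric.closedBall (symInit ω) ρ)
    {x : EuclideanSpace ℝ (Fin d)} (hx : ‖x‖ ≤ 1) :
    |network σ (2 * h) d w x
        - ⟪∇ (fun u => network σ (2 * h) d u x) w, w - (symInit ω + transport g t ω)⟫
        - (1 / (h : ℝ)) * ∑ i, ntkFeature σ g t x (ω i)|
      ≤ 2 * ((σ₁ + (b + ρ) * σ₂) * (4 * ρ ^ 2) / √((2 * h : ℕ) : ℝ)) := by
  set v := symInit ω + transport g t ω with hvdef
  have hvC : v ∈ Metric.closedBall (symInit ω) ρ := by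
    rw [mem_closedBall_iff_norm, hvdef, add_sub_cancel_left]
    exact hv
  -- Linearizations at `w` and at the initialization both approximate the prediction at `v`. The
  -- second equals the mean of the features, because the network vanishes at the initialization.
  have h1 := abs_network_sub_linearization_le_of_mem_closedBall hσ hb0 hb hρ hw hvC hx
  have h2 := abs_network_sub_linearization_le_of_mem_closedBall hσ hb0 hb hρ
    (Metric.mem_closedBall_self hρ) hvC hx
  have h3 : v - symInit ω = transport g t ω := by rw [hvdef, add_sub_cancel_left]
  rw [h3, inner_gradient_transport hσ hh, network_symInit] at h2
  rw [← neg_sub w v, inner_neg_right] at h1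
  rw [abs_le] at *
  constructor <;> linarith

end SymInit

/-! ### Concentration of the initialization -/

section Chernoff

theorem measure_le_sum_le_exp_neg {E : Type*} [MeasurableSpace E] {μ : Measure E}
    [IsProbabilityMeasure μ] {h : ℕ} {X : E → ℝ} {κ s : ℝ}
    (hint : Integrable (fun x => Real.exp (X x)) μ) (hκ : ∫ x, Real.exp (X x) ∂μ ≤ Real.exp κ) :
    Measure.pi (fun _ : Fin h => μ) {u | h * κ + s ≤ ∑ i, X (u i)} ≤ ENNReal.ofReal (Real.exp (-s)) := by
  have hprod : ∀ u : Fin h → E, Real.exp (∑ i, X (u i)) = ∏ i, Real.exp (X (u i)) :=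
    fun u => Real.exp_sum _ _
  have hint' : Integrable (fun u : Fin h → E => Real.exp (∑ i, X (u i)))
      (Measure.pi fun _ : Fin h => μ) := by
    simp only [hprod]
    exact Integrable.fintype_prod fun _ => hint
  have h1 : ∫ u : Fin h → E, Real.exp (∑ i, X (u i)) ∂(Measure.pi fun _ : Fin h => μ)
      ≤ Real.exp (h * κ) := by
    simp only [hprod]
    rw [integral_fintype_prod_eq_pow (fun x => Real.exp (X x)), Fintype.card_fin, Real.exp_nat_mul]
    exact pow_le_pow_left₀ (integral_nonneg fun x => (Real.exp_pos _).le) hκ _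
  have h2 := mul_meas_ge_le_integral_of_nonneg
    (Filter.Eventually.of_forall fun u => (Real.exp_pos _).le) hint' (Real.exp (h * κ + s))
  simp only [Real.exp_le_exp] at h2
  rw [ENNReal.le_ofReal_iff_toReal_le (measure_ne_top _ _) (Real.exp_pos _).le]
  have h3 := h2.trans h1
  rw [Real.exp_add, mul_assoc] at h3
  have h4 := le_of_mul_le_mul_left (h3.trans_eq (mul_one _).symm) (Real.exp_pos _)
  rw [Real.exp_neg, ← one_div, le_div_iff₀ (Real.exp_pos _), mul_comm]
  exact h4

/-- For a centered variable the linear term integrates to zero, which leaves a moment generating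
function `1 + O(θ²)`. -/
theorem exp_le_one_add_add_sq_mul_exp_abs (x : ℝ) :
    Real.exp x ≤ 1 + x + x ^ 2 * Real.exp |x| := by
  have h1 : Real.exp x - 1 ≤ x * Real.exp x := by
    have := Real.add_one_le_exp (-x)
    have h2 := mul_le_mul_of_nonneg_right this (Real.exp_pos x).le
    rw [← Real.exp_add, neg_add_cancel, Real.exp_zero] at h2
    linarith
  rcases le_total 0 x with h | h
  · rw [abs_of_nonneg h]
    nlinarith
  · have h3 : 1 ≤ Real.exp |x| := Real.one_le_exp (abs_nonneg x)
    have h4 := Real.add_one_le_exp x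
    nlinarith [sq_nonneg x]

theorem sq_mul_exp_le_two_mul_exp {x : ℝ} (hx : 0 ≤ x) :
    x ^ 2 * Real.exp x ≤ 2 * Real.exp (2 * x) := by
  have h1 := Real.quadratic_le_exp_of_nonneg hx
  rw [two_mul x, Real.exp_add]
  nlinarith [Real.exp_pos x]

end Chernoff

/-! ### Exponential moments of a Gaussian output weight -/

section Gaussian

theorem integral_exp_sq_div_four_gaussianReal :
    ∫ x, Real.exp (x ^ 2 / 4) ∂(gaussianReal 0 1) = √2 := by
  rw [integral_gaussianReal_eq_integral_smul one_ne_zero]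
  have h1 : ∀ x : ℝ, gaussianPDFReal 0 1 x • Real.exp (x ^ 2 / 4)
      = (√(2 * Real.pi))⁻¹ * Real.exp (-(1 / 4) * x ^ 2) := fun x => by
    rw [gaussianPDFReal_def, smul_eq_mul, mul_assoc, ← Real.exp_add]
    simp only [NNReal.coe_one, mul_one, sub_zero]
    congr 2
    ring
  simp only [h1]
  rw [integral_const_mul, integral_gaussian, inv_mul_eq_div, ← Real.sqrt_div (by positivity)]
  congr 1
  field_simp
  norm_num

variable {d : ℕ}

theorem map_apply_zero_stdGaussian :
    (stdGaussian (EuclideanSpace ℝ (Fin (d + 1)))).map (fun ω => ω 0) = gaussianReal 0 1 := by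
  rw [← map_pi_eq_stdGaussian, Measure.map_map (by fun_prop) (by fun_prop)]
  exact (measurePreserving_eval (fun _ : Fin (d + 1) => gaussianReal 0 1) 0).map_eq

theorem integral_exp_sq_div_four_stdGaussian :
    ∫ ω, Real.exp (ω 0 ^ 2 / 4) ∂(stdGaussian (EuclideanSpace ℝ (Fin (d + 1)))) = √2 := by
  rw [← integral_exp_sq_div_four_gaussianReal, ← map_apply_zero_stdGaussian (d := d),
    integral_map (by fun_prop) (by fun_prop)]

/-- The integral of a non-integrable function would be zero, whereas this one is `√2`. -/
theorem integrable_exp_sq_div_four_stdGaussian :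
    Integrable (fun ω => Real.exp (ω 0 ^ 2 / 4))
      (stdGaussian (EuclideanSpace ℝ (Fin (d + 1)))) := by
  by_contra h
  have h1 := integral_undef h
  rw [integral_exp_sq_div_four_stdGaussian] at h1
  have : (0 : ℝ) < √2 := by positivity
  linarith

theorem integral_exp_sq_div_four_stdGaussian_le_two :
    ∫ ω, Real.exp (ω 0 ^ 2 / 4) ∂(stdGaussian (EuclideanSpace ℝ (Fin (d + 1)))) ≤ 2 := by
  rw [integral_exp_sq_div_four_stdGaussian]
  exact Real.sqrt_le_iff.mpr ⟨by norm_num, by norm_num⟩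

theorem abs_le_exp_sq_div_four (c : ℝ) : |c| ≤ Real.exp (c ^ 2 / 4) := by
  have h1 := Real.add_one_le_exp (c ^ 2 / 4)
  have h2 := sq_nonneg (|c| / 2 - 1)
  nlinarith [sq_abs c]

theorem exp_two_mul_abs_le (c : ℝ) : Real.exp (2 * |c|) ≤ Real.exp 4 * Real.exp (c ^ 2 / 4) := by
  rw [← Real.exp_add, Real.exp_le_exp]
  nlinarith [sq_abs c, sq_nonneg (|c| / 2 - 2)]

/-- The moment generating function of a centered function of at most linear growth in the output
weight. -/
theorem integral_exp_mul_le {Y : EuclideanSpace ℝ (Fin (d + 1)) → ℝ} (hm : Measurable Y)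
    (hY : ∀ ω, |Y ω| ≤ 4 + |ω 0|)
    (h0 : ∫ ω, Y ω ∂(stdGaussian (EuclideanSpace ℝ (Fin (d + 1)))) = 0) {θ : ℝ} (hθ : |θ| ≤ 1) :
    Integrable (fun ω => Real.exp (θ * Y ω)) (stdGaussian (EuclideanSpace ℝ (Fin (d + 1)))) ∧
    ∫ ω, Real.exp (θ * Y ω) ∂(stdGaussian (EuclideanSpace ℝ (Fin (d + 1))))
      ≤ Real.exp (4 * Real.exp 12 * θ ^ 2) := by
  -- Here `12 = 8 + 4`: twice the constant `4` of the growth bound, and `2 |c| ≤ 4 + c² / 4`.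
  have hexp : ∀ ω, Real.exp (2 * |Y ω|) ≤ Real.exp 12 * Real.exp (ω 0 ^ 2 / 4) := fun ω => by
    calc Real.exp (2 * |Y ω|) ≤ Real.exp (8 + 2 * |ω 0|) :=
          Real.exp_le_exp.mpr (by linarith [hY ω])
      _ = Real.exp 8 * Real.exp (2 * |ω 0|) := Real.exp_add _ _
      _ ≤ Real.exp 8 * (Real.exp 4 * Real.exp (ω 0 ^ 2 / 4)) := by
          gcongr; exact exp_two_mul_abs_le _
      _ = _ := by rw [← mul_assoc, ← Real.exp_add]; norm_num
  have hbase := integrable_exp_sq_div_four_stdGaussian (d := d)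
  have habs : ∀ ω, |θ * Y ω| ≤ |Y ω| := fun ω => by
    rw [abs_mul]; exact mul_le_of_le_one_left (abs_nonneg _) hθ
  have hintexp : Integrable (fun ω => Real.exp (θ * Y ω))
      (stdGaussian (EuclideanSpace ℝ (Fin (d + 1)))) := by
    refine (hbase.const_mul (Real.exp 12)).mono'
      (Real.measurable_exp.comp (hm.const_mul θ)).aestronglyMeasurable
      (Filter.Eventually.of_forall fun ω => ?_)
    rw [Real.norm_eq_abs, Real.abs_exp]
    refine le_trans (Real.exp_le_exp.mpr ?_) (hexp ω)
    linarith [le_abs_self (θ * Y ω), habs ω, abs_nonneg (Y ω)]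
  have hintY : Integrable Y (stdGaussian (EuclideanSpace ℝ (Fin (d + 1)))) := by
    refine (hbase.const_mul (Real.exp 12)).mono' hm.aestronglyMeasurable
      (Filter.Eventually.of_forall fun ω => ?_)
    rw [Real.norm_eq_abs]
    refine le_trans ?_ (hexp ω)
    linarith [Real.add_one_le_exp (2 * |Y ω|), abs_nonneg (Y ω)]
  have hpt : ∀ ω, Real.exp (θ * Y ω)
      ≤ 1 + θ * Y ω + 2 * Real.exp 12 * θ ^ 2 * Real.exp (ω 0 ^ 2 / 4) := fun ω => by
    have h1 := exp_le_one_add_add_sq_mul_exp_abs (θ * Y ω)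
    have h2 : Y ω ^ 2 * Real.exp |Y ω| ≤ 2 * Real.exp (2 * |Y ω|) := by
      have := sq_mul_exp_le_two_mul_exp (abs_nonneg (Y ω))
      rwa [sq_abs] at this
    have h3 : (θ * Y ω) ^ 2 * Real.exp |θ * Y ω|
        ≤ 2 * Real.exp 12 * θ ^ 2 * Real.exp (ω 0 ^ 2 / 4) := by
      calc (θ * Y ω) ^ 2 * Real.exp |θ * Y ω| ≤ (θ * Y ω) ^ 2 * Real.exp |Y ω| :=
            mul_le_mul_of_nonneg_left (Real.exp_le_exp.mpr (habs ω)) (sq_nonneg _)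
        _ = θ ^ 2 * (Y ω ^ 2 * Real.exp |Y ω|) := by ring
        _ ≤ θ ^ 2 * (2 * (Real.exp 12 * Real.exp (ω 0 ^ 2 / 4))) := by
            refine mul_le_mul_of_nonneg_left (h2.trans ?_) (sq_nonneg _)
            linarith [hexp ω]
        _ = _ := by ring
    linarith
  refine ⟨hintexp, ?_⟩
  have hi1 := (integrable_const (1 : ℝ)
    (μ := stdGaussian (EuclideanSpace ℝ (Fin (d + 1))))).add (hintY.const_mul θ)
  have hi2 := hbase.const_mul (2 * Real.exp 12 * θ ^ 2)
  have hmono := integral_mono hintexp (hi1.add hi2) hpt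
  have hval : ∫ ω, (1 + θ * Y ω + 2 * Real.exp 12 * θ ^ 2 * Real.exp (ω 0 ^ 2 / 4))
      ∂(stdGaussian (EuclideanSpace ℝ (Fin (d + 1))))
      = 1 + 2 * Real.exp 12 * θ ^ 2 *
        ∫ ω, Real.exp (ω 0 ^ 2 / 4) ∂(stdGaussian (EuclideanSpace ℝ (Fin (d + 1)))) := by
    rw [integral_add (f := fun ω => 1 + θ * Y ω) hi1 hi2,
      integral_add (integrable_const _) (hintY.const_mul θ), integral_const_mul,
      integral_const_mul, h0]
    simp
  refine hmono.trans (hval.le.trans ?_)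
  have h2 := mul_le_mul_of_nonneg_left (integral_exp_sq_div_four_stdGaussian_le_two (d := d))
    (show 0 ≤ 2 * Real.exp 12 * θ ^ 2 by positivity)
  have h3 := Real.add_one_le_exp (4 * Real.exp 12 * θ ^ 2)
  linarith

end Gaussian

/-! ### High-probability bounds for the initialization -/

section InitLaw

variable {h d : ℕ} {δ : ℝ}

instance : IsProbabilityMeasure (initLaw h d) := by
  unfold initLaw; infer_instance

theorem initLaw_sum_sq_le (hh : 0 < h) (s : ℝ) :
    initLaw h d {u | 4 * (1 + s) < (1 / (h : ℝ)) * ∑ i, u i 0 ^ 2}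
      ≤ ENNReal.ofReal (Real.exp (-s)) := by
  -- The Chernoff bound concerns the threshold `h + s`, which lies below `h (1 + s)` once `0 ≤ s`;
  -- for negative `s` the claim is trivial.
  by_cases hs : s < 0
  · refine prob_le_one.trans ?_
    rw [ENNReal.one_le_ofReal]
    exact Real.one_le_exp (by linarith)
  have hh' : (1 : ℝ) ≤ h := by exact_mod_cast hh
  refine le_trans (measure_mono fun u hu => ?_) (measure_le_sum_le_exp_neg (h := h) (κ := 1) (s := s)
    (integrable_exp_sq_div_four_stdGaussian (d := d))
    (integral_exp_sq_div_four_stdGaussian_le_two.trans (by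
      linarith [Real.add_one_le_exp 1])))
  simp only [Set.mem_ofPred_eq] at hu ⊢
  rw [one_div, inv_mul_eq_div, lt_div_iff₀ (by linarith)] at hu
  rw [← Finset.sum_div, le_div_iff₀ (by norm_num)]
  nlinarith

theorem initLaw_exists_sq_gt_le (s : ℝ) :
    initLaw h d {u | ∃ i, 4 * s < u i 0 ^ 2} ≤ ENNReal.ofReal (h * (2 * Real.exp (-s))) := by
  have hone : ∀ i : Fin h, initLaw h d {u | 4 * s < u i 0 ^ 2}
      ≤ ENNReal.ofReal (2 * Real.exp (-s)) := by
    intro i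
    have hmeas : MeasurableSet {ω : EuclideanSpace ℝ (Fin (d + 1)) | 4 * s < ω 0 ^ 2} :=
      measurableSet_lt measurable_const (by fun_prop)
    have h1 : initLaw h d {u | 4 * s < u i 0 ^ 2}
        = stdGaussian (EuclideanSpace ℝ (Fin (d + 1))) {ω | 4 * s < ω 0 ^ 2} :=
      (measurePreserving_eval (fun _ : Fin h => stdGaussian (EuclideanSpace ℝ (Fin (d + 1))))
        i).measure_preimage hmeas.nullMeasurableSet
    rw [h1, ENNReal.le_ofReal_iff_toReal_le (measure_ne_top _ _) (by positivity)]
    have h2 := mul_meas_ge_le_integral_of_nonneg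
      (Filter.Eventually.of_forall fun u => (Real.exp_pos _).le)
      (integrable_exp_sq_div_four_stdGaussian (d := d)) (Real.exp s)
    simp only [Real.exp_le_exp] at h2
    have h3 : (stdGaussian (EuclideanSpace ℝ (Fin (d + 1)))).real {ω | 4 * s < ω 0 ^ 2}
        ≤ (stdGaussian (EuclideanSpace ℝ (Fin (d + 1)))).real {ω | s ≤ ω 0 ^ 2 / 4} := by
      refine measureReal_mono (fun ω hω => ?_)
      simp only [Set.mem_ofPred_eq] at hω ⊢
      linarith
    have h4 := h2.trans integral_exp_sq_div_four_stdGaussian_le_two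
    rw [Real.exp_neg, ← div_eq_mul_inv, le_div_iff₀ (Real.exp_pos _), mul_comm]
    exact (mul_le_mul_of_nonneg_left h3 (Real.exp_pos _).le).trans h4
  rw [Set.ofPred_exists]
  refine (measure_iUnion_fintype_le _ _).trans ((Finset.sum_le_sum fun i _ => hone i).trans ?_)
  rw [Finset.sum_const, Finset.card_univ, Fintype.card_fin, nsmul_eq_mul,
    ← ENNReal.ofReal_natCast, ← ENNReal.ofReal_mul (by positivity)]

theorem initLaw_mean_sub_gt_le (hh : 0 < h) {X : EuclideanSpace ℝ (Fin (d + 1)) → ℝ}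
    (hm : Measurable X) {R : ℝ} (hR : 0 < R) (hX : ∀ ω, |X ω| ≤ R * (1 + |ω 0|)) (s : ℝ) :
    initLaw h d {u | R * (4 * Real.exp 12 + s) / √(h : ℝ) < |(1 / (h : ℝ)) * ∑ i, X (u i)
        - ∫ ω, X ω ∂(stdGaussian (EuclideanSpace ℝ (Fin (d + 1))))|}
      ≤ ENNReal.ofReal (2 * Real.exp (-s)) := by
  have hh' : (1 : ℝ) ≤ h := by exact_mod_cast hh
  set μ := ∫ ω, X ω ∂(stdGaussian (EuclideanSpace ℝ (Fin (d + 1)))) with hμ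
  have hbase := integrable_exp_sq_div_four_stdGaussian (d := d)
  have hXle : ∀ ω, |X ω| ≤ R + R * Real.exp (ω 0 ^ 2 / 4) := fun ω => by
    have := mul_le_mul_of_nonneg_left (abs_le_exp_sq_div_four (ω 0)) hR.le
    linarith [hX ω]
  have hbd : Integrable (fun ω => R + R * Real.exp (ω 0 ^ 2 / 4))
      (stdGaussian (EuclideanSpace ℝ (Fin (d + 1)))) :=
    (integrable_const R).add (hbase.const_mul R)
  have hint : Integrable X (stdGaussian (EuclideanSpace ℝ (Fin (d + 1)))) :=
    hbd.mono' hm.aestronglyMeasurable (Filter.Eventually.of_forall hXle)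
  -- Together with the growth of `X` this gives `|X - μ| / R ≤ 4 + |ω 0|`, the form required by
  -- `integral_exp_mul_le`.
  have hμle : |μ| ≤ 3 * R := by
    refine (abs_integral_le_integral_abs).trans ((integral_mono hint.abs hbd hXle).trans ?_)
    rw [integral_add (integrable_const R) (hbase.const_mul R), integral_const_mul]
    have := mul_le_mul_of_nonneg_left (integral_exp_sq_div_four_stdGaussian_le_two (d := d)) hR.le
    simp only [integral_const, probReal_univ, one_smul]
    linarith
  set Y : EuclideanSpace ℝ (Fin (d + 1)) → ℝ := fun ω => (X ω - μ) / R with hYdef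
  have hYm : Measurable Y := (hm.sub_const μ).div_const R
  have hY : ∀ ω, |Y ω| ≤ 4 + |ω 0| := fun ω => by
    rw [hYdef, abs_div, abs_of_pos hR, div_le_iff₀ hR]
    have := abs_sub (X ω) μ
    linarith [hX ω]
  have hY0 : ∫ ω, Y ω ∂(stdGaussian (EuclideanSpace ℝ (Fin (d + 1)))) = 0 := by
    rw [hYdef, integral_div, integral_sub hint (integrable_const μ)]
    simp [hμ]
  set r := √(h : ℝ) with hr
  have hrpos : 0 < r := by positivity
  have hrsq : r * r = h := Real.mul_self_sqrt (by positivity)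
  have hr1 : 1 ≤ r := Real.one_le_sqrt.mpr hh'
  -- At `|θ| = 1/√h` the `h` factors of the moment generating function multiply to a constant.
  have htail : ∀ θ : ℝ, |θ| = 1 / r →
      initLaw h d {u | 4 * Real.exp 12 + s ≤ ∑ i, θ * Y (u i)} ≤ ENNReal.ofReal (Real.exp (-s)) := by
    intro θ hθ
    have hθ1 : |θ| ≤ 1 := by rw [hθ, div_le_one hrpos]; exact hr1
    obtain ⟨h1, h2⟩ := integral_exp_mul_le hYm hY hY0 hθ1
    have h3 := measure_le_sum_le_exp_neg (h := h) (s := s) h1 h2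
    have h4 : (h : ℝ) * (4 * Real.exp 12 * θ ^ 2) = 4 * Real.exp 12 := by
      rw [← sq_abs, hθ, ← hrsq]
      field_simp
    rw [h4] at h3
    exact h3
  have hsub : {u : Fin h → EuclideanSpace ℝ (Fin (d + 1)) |
      R * (4 * Real.exp 12 + s) / r < |(1 / (h : ℝ)) * ∑ i, X (u i) - μ|}
      ⊆ {u | 4 * Real.exp 12 + s ≤ ∑ i, (1 / r) * Y (u i)}
        ∪ {u | 4 * Real.exp 12 + s ≤ ∑ i, (-(1 / r)) * Y (u i)} := by
    intro u hu
    simp only [Set.mem_ofPred_eq, Set.mem_union] at hu ⊢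
    have h1 : (1 / (h : ℝ)) * ∑ i, X (u i) - μ = (R / r) * ∑ i, (1 / r) * Y (u i) := by
      rw [← Finset.mul_sum, hYdef, ← Finset.sum_div, Finset.sum_sub_distrib, Finset.sum_const,
        Finset.card_univ, Fintype.card_fin, nsmul_eq_mul, ← hrsq]
      field_simp
    rw [h1, abs_mul, abs_of_pos (by positivity : 0 < R / r), mul_div_right_comm] at hu
    have h2 := lt_of_mul_lt_mul_left hu (by positivity)
    rcases lt_abs.mp h2 with h3 | h3
    · exact Or.inl h3.le
    · refine Or.inr (h3.le.trans (le_of_eq ?_))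
      rw [← Finset.sum_neg_distrib]
      exact Finset.sum_congr rfl fun i _ => by ring
  refine (measure_mono hsub).trans ((measure_union_le _ _).trans ?_)
  refine (add_le_add (htail (1 / r) (abs_of_pos (by positivity)))
    (htail (-(1 / r)) (by rw [abs_neg]; exact abs_of_pos (by positivity)))).trans ?_
  rw [← ENNReal.ofReal_add (Real.exp_pos _).le (Real.exp_pos _).le, two_mul]

variable {σ : ℝ → ℝ} {σ₀ σ₁ σ₂ : ℝ} {g : EuclideanSpace ℝ (Fin (d + 1)) → ℝ}
  {t : EuclideanSpace ℝ (Fin (d + 1)) → EuclideanSpace ℝ (Fin d)}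

theorem measurable_ntkFeature (hσ : IsActivation σ σ₀ σ₁ σ₂) (hg : Measurable g)
    (ht : Measurable t) (x : EuclideanSpace ℝ (Fin d)) : Measurable (ntkFeature σ g t x) := by
  have h1 : Measurable fun ω : EuclideanSpace ℝ (Fin (d + 1)) => ⟪innerWeight ω, x⟫ := by
    have : Continuous (innerWeight (d := d)) := by
      unfold innerWeight
      fun_prop
    fun_prop
  have h2 := hσ.differentiable.continuous.measurable.comp h1
  have h3 := hσ.differentiable_deriv.continuous.measurable.comp h1
  refine (hg.mul h2).add (ht.inner ?_)
  refine Measurable.smul_const (Measurable.mul ?_ h3) x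
  fun_prop

theorem abs_ntkFeature_le (hσ : IsActivation σ σ₀ σ₁ σ₂) {vc vW : ℝ} (hg : ∀ ω, |g ω| ≤ vc)
    (ht : ∀ ω, ‖t ω‖ ≤ vW) {x : EuclideanSpace ℝ (Fin d)} (hx : ‖x‖ ≤ 1)
    (ω : EuclideanSpace ℝ (Fin (d + 1))) :
    |ntkFeature σ g t x ω| ≤ (1 + (σ₀ + σ₁) * √(vc ^ 2 + vW ^ 2)) * (1 + |ω 0|) := by
  have hn0 := hσ.nonneg₀
  have hn1 := hσ.nonneg₁
  set ρ := √(vc ^ 2 + vW ^ 2)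
  have hρ : 0 ≤ ρ := Real.sqrt_nonneg _
  have hc : |g ω| ≤ ρ := (hg ω).trans (Real.le_sqrt_of_sq_le (by linarith [sq_nonneg vW]))
  have hW : ‖t ω‖ ≤ ρ := (ht ω).trans (Real.le_sqrt_of_sq_le (by linarith [sq_nonneg vc]))
  have h1 : |g ω * σ ⟪innerWeight ω, x⟫| ≤ ρ * σ₀ := by
    rw [abs_mul]; exact mul_le_mul hc (hσ.bound _) (abs_nonneg _) hρ
  have h2 : |⟪t ω, (ω 0 * deriv σ ⟪innerWeight ω, x⟫) • x⟫| ≤ ρ * (|ω 0| * σ₁) := by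
    refine (abs_real_inner_le_norm _ _).trans (mul_le_mul hW ?_ (norm_nonneg _) hρ)
    rw [norm_smul, Real.norm_eq_abs, abs_mul]
    calc _ ≤ |ω 0| * σ₁ * 1 := by
          gcongr; exact hσ.bound_deriv _
      _ = _ := mul_one _
  refine (abs_add_le _ _).trans ((add_le_add h1 h2).trans ?_)
  have h3 : 0 ≤ |ω 0| := abs_nonneg _
  nlinarith [mul_nonneg (mul_nonneg hρ hn0) h3, mul_nonneg hρ hn1]

/-- With probability `1 - δ`, the output weights are bounded in mean square and in maximum, and the
empirical means of the features are close to their expectations. -/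
theorem initLaw_not_good_le (hσ : IsActivation σ σ₀ σ₁ σ₂) (hh : 0 < h) {n : ℕ} (hn : 0 < n)
    (hδ : 0 < δ) (hgm : Measurable g) (htm : Measurable t) {vc vW : ℝ} (hg : ∀ ω, |g ω| ≤ vc)
    (ht : ∀ ω, ‖t ω‖ ≤ vW) {x : Fin n → EuclideanSpace ℝ (Fin d)} (hx : ∀ j, ‖x j‖ ≤ 1) :
    initLaw h d {u | ¬ ((1 / (h : ℝ)) * ∑ i, u i 0 ^ 2 ≤ 4 * (1 + Real.log (4 / δ)) ∧
        (∀ i, u i 0 ^ 2 ≤ 4 * Real.log (8 * h / δ)) ∧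
        ∀ j, |(1 / (h : ℝ)) * ∑ i, ntkFeature σ g t (x j) (u i)
          - ∫ ω, ntkFeature σ g t (x j) ω ∂(stdGaussian (EuclideanSpace ℝ (Fin (d + 1))))|
          ≤ (1 + (σ₀ + σ₁) * √(vc ^ 2 + vW ^ 2)) * (4 * Real.exp 12 + Real.log (4 * n / δ))
            / √(h : ℝ))} ≤ ENNReal.ofReal δ := by
  have hh' : (0 : ℝ) < h := by exact_mod_cast hh
  have hn' : (0 : ℝ) < n := by exact_mod_cast hn
  have hn0 := hσ.nonneg₀
  have hn1 := hσ.nonneg₁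
  -- The thresholds allot `δ/4` to the mean square, `δ/4` to the maximum and `δ/2` to the `n`
  -- feature means.
  have hA := initLaw_sum_sq_le (d := d) hh (Real.log (4 / δ))
  have hB := initLaw_exists_sq_gt_le (h := h) (d := d) (Real.log (8 * h / δ))
  have hC := fun j => initLaw_mean_sub_gt_le hh (measurable_ntkFeature hσ hgm htm (x j))
    (by positivity) (abs_ntkFeature_le hσ hg ht (hx j)) (Real.log (4 * n / δ))
  have e1 : ∀ a : ℝ, 0 < a → Real.exp (-Real.log (a / δ)) = δ / a := fun a ha => by
    rw [Real.exp_neg, Real.exp_log (by positivity), inv_div]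
  rw [e1 _ (by positivity)] at hA hB
  simp only [e1 (4 * n) (by positivity)] at hC
  refine le_trans (measure_mono fun u hu => ?_) ((measure_union_le _ _).trans
    ((add_le_add ((measure_union_le _ _).trans (add_le_add hA hB))
      ((measure_iUnion_fintype_le _ _).trans (Finset.sum_le_sum fun j _ => hC j))).trans ?_))
  · simp only [Set.mem_ofPred_eq, not_and_or, not_le, not_forall] at hu
    simp only [Set.mem_union, Set.mem_iUnion, Set.mem_ofPred_eq]
    tauto
  · rw [Finset.sum_const, Finset.card_univ, Fintype.card_fin, nsmul_eq_mul,
      ← ENNReal.ofReal_natCast, ← ENNReal.ofReal_mul (by positivity),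
      ← ENNReal.ofReal_add (by positivity) (by positivity),
      ← ENNReal.ofReal_add (by positivity) (by positivity)]
    refine ENNReal.ofReal_le_ofReal (le_of_eq ?_)
    field_simp
    norm_num

end InitLaw

/-! ### Numerical estimates -/

section Numerics

variable {δ : ℝ} {n h : ℕ}

theorem log_four_le_two : Real.log 4 ≤ 2 := by
  have : (4 : ℝ) = 2 ^ 2 := by norm_num
  rw [this, Real.log_pow]
  have := Real.log_two_lt_d9
  push_cast
  linarith

theorem half_le_log_of_two_le {x : ℝ} (hx : 2 ≤ x) : 1 / 2 ≤ Real.log x := by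
  have := Real.log_two_gt_d9
  linarith [Real.log_le_log two_pos hx]

theorem log_div_nonneg_of_one_le (hn : 0 < n) (hδ : 0 < δ) (hδ1 : δ ≤ 1) :
    0 ≤ Real.log (n / δ) := by
  have : (1 : ℝ) ≤ n := by exact_mod_cast hn
  exact Real.log_nonneg ((one_le_div hδ).mpr (by linarith))

theorem log_four_mul_div_le (hn : 0 < n) (hδ : 0 < δ) (hδ1 : δ ≤ 1) :
    Real.log (4 * n / δ) ≤ 2 * (1 + Real.log (n / δ)) := by
  have hn' : (0 : ℝ) < n := by exact_mod_cast hn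
  have h0 := log_div_nonneg_of_one_le hn hδ hδ1
  rw [mul_div_assoc, Real.log_mul (by norm_num) (by positivity)]
  linarith [log_four_le_two]

theorem log_four_div_le (hn : 0 < n) (hδ : 0 < δ) (hδ1 : δ ≤ 1) :
    Real.log (4 / δ) ≤ 2 * (1 + Real.log (n / δ)) := by
  have hn' : (1 : ℝ) ≤ n := by exact_mod_cast hn
  refine le_trans (Real.log_le_log (by positivity) ?_) (log_four_mul_div_le hn hδ hδ1)
  gcongr
  linarith

theorem log_eight_mul_div_le (hh : 0 < h) (hn : 0 < n) (hδ : 0 < δ) (hδ1 : δ ≤ 1) :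
    Real.log (8 * h / δ) ≤ 5 * (1 + Real.log (n / δ)) * Real.log (2 * h : ℕ) := by
  have hh' : (1 : ℝ) ≤ h := by exact_mod_cast hh
  have h0 := log_div_nonneg_of_one_le hn hδ hδ1
  have h1 := half_le_log_of_two_le (x := (2 * h : ℕ)) (by push_cast; linarith)
  have h2 : 8 * (h : ℝ) / δ = (2 * h : ℕ) * (4 / δ) := by push_cast; ring
  rw [h2, Real.log_mul (by positivity) (by positivity)]
  have h3 := log_four_div_le hn hδ hδ1
  nlinarith

theorem one_le_two_mul_sqrt_log (hh : 0 < h) : 1 ≤ 2 * √(Real.log (2 * h : ℕ)) := by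
  have hh' : (1 : ℝ) ≤ h := by exact_mod_cast hh
  have h1 := half_le_log_of_two_le (x := (2 * h : ℕ)) (by push_cast; linarith)
  have h2 : 1 / 2 ≤ √(Real.log (2 * h : ℕ)) := Real.le_sqrt_of_sq_le (by linarith)
  linarith

/-- Turns the squared error `log m / m` into the rate `1 / √m` of part (i), without a logarithm. -/
theorem log_div_le_two_div_sqrt {x : ℝ} (hx : 0 < x) : Real.log x / x ≤ 2 * (1 / √x) := by
  have h1 := Real.log_le_self (Real.sqrt_nonneg x)
  rw [Real.log_sqrt hx.le] at h1
  rw [mul_one_div, div_le_div_iff₀ hx (by positivity)]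
  have h2 := Real.mul_self_sqrt hx.le
  nlinarith [Real.sqrt_nonneg x]

theorem sqrt_log_div_sqrt_le_one {x : ℝ} (hx : 0 < x) : √(Real.log x) / √x ≤ 1 := by
  rw [div_le_one (by positivity)]
  exact Real.sqrt_le_sqrt (Real.log_le_self hx.le)

theorem log_one_add_div_le {γ : ℝ} (hγ : 0 < γ) {k : ℕ} (hk : 2 ≤ k) :
    Real.log (1 + k / γ) ≤ (1 + 2 * Real.log (1 + 1 / γ)) * Real.log k := by
  have hk' : (2 : ℝ) ≤ k := by exact_mod_cast hk
  have h1 := half_le_log_of_two_le hk'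
  have h2 : 0 ≤ Real.log (1 + 1 / γ) := Real.log_nonneg (by
    have : 0 < 1 / γ := by positivity
    linarith)
  have h3 : Real.log (1 + k / γ) ≤ Real.log (k * (1 + 1 / γ)) := by
    refine Real.log_le_log (by positivity) ?_
    rw [mul_add, mul_one_div]
    linarith
  rw [Real.log_mul (by positivity) (by positivity)] at h3
  nlinarith

variable {σ₀ σ₁ σ₂ ρ L : ℝ}

theorem lipschitz_sq_le (h₀ : 0 ≤ σ₀) (h₁ : 0 ≤ σ₁) (h₂ : 0 ≤ σ₂) (hρ : 0 ≤ ρ) (hL : 1 ≤ L) {a : ℝ}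
    (ha : a ≤ 12 * L) :
    √(σ₀ ^ 2 + σ₁ ^ 2 * (2 * (a + ρ ^ 2))) ≤ 5 * (σ₀ + σ₁ + σ₂) * ((1 + ρ) * L) := by
  refine Real.sqrt_le_iff.mpr ⟨by positivity, ?_⟩
  have e0 : σ₀ ^ 2 ≤ (σ₀ + σ₁ + σ₂) ^ 2 := by gcongr; linarith
  have e1 : σ₁ ^ 2 ≤ (σ₀ + σ₁ + σ₂) ^ 2 := by gcongr; linarith
  set s := σ₀ + σ₁ + σ₂
  calc σ₀ ^ 2 + σ₁ ^ 2 * (2 * (a + ρ ^ 2)) ≤ s ^ 2 + σ₁ ^ 2 * (2 * (12 * L + ρ ^ 2)) :=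
        add_le_add e0 (mul_le_mul_of_nonneg_left (by linarith) (sq_nonneg _))
    _ ≤ s ^ 2 + s ^ 2 * (2 * (12 * L + ρ ^ 2)) := by gcongr
    _ = s ^ 2 * (1 + 24 * L + 2 * ρ ^ 2) := by ring
    _ ≤ s ^ 2 * (25 * ((1 + ρ) * L) ^ 2) := by
        gcongr
        have : L ≤ L ^ 2 := by nlinarith
        nlinarith [mul_nonneg hρ (sq_nonneg L), mul_nonneg (sq_nonneg ρ) (sub_nonneg.mpr this),
          mul_nonneg (sq_nonneg ρ) (sub_nonneg.mpr hL)]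
    _ = _ := by ring

theorem linearization_error_le (h₀ : 0 ≤ σ₀) (h₁ : 0 ≤ σ₁) (h₂ : 0 ≤ σ₂) (hρ : 0 ≤ ρ) (hL : 1 ≤ L)
    {q y : ℝ} (hq : 1 ≤ 2 * q) (hy : 0 < y) :
    (σ₁ + (5 * L * q + ρ) * σ₂) * (4 * ρ ^ 2) / y
      ≤ 28 * (σ₀ + σ₁ + σ₂) * ((1 + ρ) ^ 3 * L) * (q / y) := by
  rw [← mul_div_assoc]
  have hq0 : 0 ≤ q := by linarith
  refine div_le_div_of_nonneg_right ?_ hy.le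
  have hLq : q ≤ L * q := by nlinarith
  have e1 : σ₁ + (5 * L * q + ρ) * σ₂ ≤ (σ₀ + σ₁ + σ₂) * (7 * (L * q) * (1 + ρ)) := by
    have e2 : 1 ≤ 7 * (L * q) * (1 + ρ) := by nlinarith
    have e3 : 5 * L * q + ρ ≤ 7 * (L * q) * (1 + ρ) := by nlinarith
    nlinarith [mul_le_mul_of_nonneg_left e2 h₁, mul_le_mul_of_nonneg_left e3 h₂,
      mul_nonneg h₀ (zero_le_one.trans e2)]
  calc (σ₁ + (5 * L * q + ρ) * σ₂) * (4 * ρ ^ 2)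
      ≤ ((σ₀ + σ₁ + σ₂) * (7 * (L * q) * (1 + ρ))) * (4 * (1 + ρ) ^ 2) := by
        gcongr; linarith
    _ = _ := by ring

theorem concentration_error_le (h₀ : 0 ≤ σ₀) (h₁ : 0 ≤ σ₁) (h₂ : 0 ≤ σ₂) (hρ : 0 ≤ ρ) (hL : 1 ≤ L)
    {q c l : ℝ} (hq : 1 ≤ 2 * q) (hh : 0 < h) (hc : 0 ≤ c) (hl : l ≤ 2 * L) :
    (1 + (σ₀ + σ₁) * ρ) * (c + l) / √(h : ℝ)
      ≤ 4 * (1 + (σ₀ + σ₁ + σ₂)) * (c + 2) * ((1 + ρ) ^ 3 * L) * (q / √((2 * h : ℕ) : ℝ)) := by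
  have hh' : (0 : ℝ) < h := by exact_mod_cast hh
  have hs : √((2 * h : ℕ) : ℝ) ≤ 2 * √(h : ℝ) := by
    refine Real.sqrt_le_iff.mpr ⟨by positivity, ?_⟩
    rw [mul_pow, Real.sq_sqrt hh'.le]
    push_cast
    linarith
  have hq0 : 0 ≤ q := by linarith
  have hm : 0 < √((2 * h : ℕ) : ℝ) := Real.sqrt_pos.mpr (by push_cast; linarith)
  rw [← mul_div_assoc, div_le_div_iff₀ (by positivity) hm]
  have e1 : (1 + (σ₀ + σ₁) * ρ) ≤ (1 + (σ₀ + σ₁ + σ₂)) * (1 + ρ) := by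
    nlinarith [mul_nonneg h₂ hρ, mul_nonneg h₀ hρ]
  have e2 : c + l ≤ (c + 2) * L := by nlinarith
  have e3 : 1 + ρ ≤ (1 + ρ) ^ 3 := le_self_pow₀ (by linarith) (by norm_num)
  calc (1 + (σ₀ + σ₁) * ρ) * (c + l) * √((2 * h : ℕ) : ℝ)
      ≤ (1 + (σ₀ + σ₁) * ρ) * ((c + 2) * L) * √((2 * h : ℕ) : ℝ) := by gcongr
    _ ≤ ((1 + (σ₀ + σ₁ + σ₂)) * (1 + ρ) ^ 3) * ((c + 2) * L) * (2 * √(h : ℝ)) := by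
        have := e1.trans (mul_le_mul_of_nonneg_left e3
          (by positivity : 0 ≤ 1 + (σ₀ + σ₁ + σ₂)))
        gcongr
    _ ≤ ((1 + (σ₀ + σ₁ + σ₂)) * (1 + ρ) ^ 3) * ((c + 2) * L) * (2 * √(h : ℝ)) * (2 * q) :=
        le_mul_of_one_le_right (by positivity) hq
    _ = _ := by ring

variable {ξ γ T κ b D y z : ℝ}

theorem first_order_error_le (hξ : 0 < ξ) (hT : 1 ≤ T) (hκ : 0 ≤ κ) (hb : 0 ≤ b) (hy : 0 ≤ y)
    (hy1 : y ≤ 1) :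
    2 * b * (κ * T * y) + 3 * (κ * T * y) ^ 2 / (2 * ξ)
      ≤ (2 * κ + 3 * κ ^ 2 / (2 * ξ)) * T ^ 2 * (1 + b) ^ 2 * y := by
  have hT2 : T ≤ T ^ 2 := le_self_pow₀ hT two_ne_zero
  have hb2 : b ≤ (1 + b) ^ 2 := by nlinarith
  have hb1 : 1 ≤ (1 + b) ^ 2 := by nlinarith
  have e1 : 2 * b * (κ * T * y) ≤ 2 * (1 + b) ^ 2 * (κ * T ^ 2 * y) := by gcongr
  have e2 : 3 * (κ * T * y) ^ 2 / (2 * ξ) ≤ 3 * κ ^ 2 / (2 * ξ) * T ^ 2 * (1 + b) ^ 2 * y := by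
    calc 3 * (κ * T * y) ^ 2 / (2 * ξ) = 3 * κ ^ 2 / (2 * ξ) * T ^ 2 * 1 * (y * y) := by ring
      _ ≤ 3 * κ ^ 2 / (2 * ξ) * T ^ 2 * (1 + b) ^ 2 * (1 * y) := by gcongr
      _ = _ := by ring
  linarith

theorem second_order_error_le (hξ : 0 < ξ) (hb : 0 ≤ b) (hD : 0 ≤ D)
    (hyz : y ^ 2 ≤ 2 * z) :
    3 * ξ * D ^ 2 * (κ * T * y) ^ 2 + 3 * (κ * T * y) ^ 2 / ξ
      ≤ (3 * ξ + 3 / ξ) * (2 * κ ^ 2) * T ^ 2 * (1 + b + D) ^ 2 * z := by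
  have hD2 : D ^ 2 ≤ (1 + b + D) ^ 2 := by gcongr; linarith
  have hD1 : 1 ≤ (1 + b + D) ^ 2 := by nlinarith
  have hz : 0 ≤ 2 * z := (sq_nonneg y).trans hyz
  calc 3 * ξ * D ^ 2 * (κ * T * y) ^ 2 + 3 * (κ * T * y) ^ 2 / ξ
      = 3 * ξ * D ^ 2 * (κ ^ 2 * T ^ 2 * y ^ 2) + 3 / ξ * 1 * (κ ^ 2 * T ^ 2 * y ^ 2) := by ring
    _ ≤ 3 * ξ * (1 + b + D) ^ 2 * (κ ^ 2 * T ^ 2 * (2 * z))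
        + 3 / ξ * (1 + b + D) ^ 2 * (κ ^ 2 * T ^ 2 * (2 * z)) := by gcongr
    _ = _ := by ring

/-- For `k ≥ 2` one has `1 ≤ 2 log k`, which absorbs the damping term; the constant `50` is `2 *
5²`. -/
theorem rank_term_le (hξ : 0 < ξ) (hγ : 0 < γ) (hb : 0 ≤ b) (hT : 1 ≤ T) {ℒ s : ℝ} (r : ℕ) {k : ℕ}
    (hk : 2 ≤ k) (hℒ : ℒ ^ 2 * ρ ^ 2 ≤ (5 * s * T) ^ 2) :
    r * (γ * ℒ ^ 2 * ρ ^ 2 + ξ ^ 2 * b ^ 2 * Real.log (1 + k / γ)) / (ξ * k)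
      ≤ (50 * γ * s ^ 2 + ξ ^ 2 * (1 + 2 * Real.log (1 + 1 / γ))) / ξ * T ^ 2 * (1 + b) ^ 2
        * (r * Real.log k / k) := by
  have hk' : (2 : ℝ) ≤ k := by exact_mod_cast hk
  have h1 := half_le_log_of_two_le hk'
  have h2 := log_one_add_div_le hγ hk
  have hlog : 0 ≤ Real.log (1 + 1 / γ) := Real.log_nonneg (by
    have : 0 < 1 / γ := by positivity
    linarith)
  have hb1 : 1 ≤ (1 + b) ^ 2 := by nlinarith
  have hbb : b ^ 2 ≤ (1 + b) ^ 2 := by gcongr; linarith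
  have hT2 : 1 ≤ T ^ 2 := one_le_pow₀ hT
  set G := 1 + 2 * Real.log (1 + 1 / γ) with hG
  have hG0 : 0 ≤ G := by positivity
  have e1 : γ * ℒ ^ 2 * ρ ^ 2 ≤ 50 * γ * s ^ 2 * T ^ 2 * (1 + b) ^ 2 * Real.log k := by
    calc γ * ℒ ^ 2 * ρ ^ 2 = γ * (ℒ ^ 2 * ρ ^ 2) * 1 := by ring
      _ ≤ γ * (5 * s * T) ^ 2 * ((1 + b) ^ 2 * (2 * Real.log k)) := by
          gcongr
          nlinarith
      _ = _ := by ring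
  have e2 : ξ ^ 2 * b ^ 2 * Real.log (1 + k / γ) ≤ ξ ^ 2 * G * T ^ 2 * (1 + b) ^ 2 * Real.log k := by
    calc ξ ^ 2 * b ^ 2 * Real.log (1 + k / γ) ≤ ξ ^ 2 * b ^ 2 * (G * Real.log k) := by gcongr
      _ ≤ ξ ^ 2 * (1 + b) ^ 2 * (G * Real.log k) * T ^ 2 := by
          refine le_trans ?_ (le_mul_of_one_le_right (by positivity) hT2)
          gcongr
      _ = _ := by ring
  calc r * (γ * ℒ ^ 2 * ρ ^ 2 + ξ ^ 2 * b ^ 2 * Real.log (1 + k / γ)) / (ξ * k)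
      ≤ r * (50 * γ * s ^ 2 * T ^ 2 * (1 + b) ^ 2 * Real.log k
        + ξ ^ 2 * G * T ^ 2 * (1 + b) ^ 2 * Real.log k) / (ξ * k) := by gcongr
    _ = _ := by field_simp

theorem le_mul_of_first_order_le (hξ : 0 < ξ) (hγ : 0 < γ) (hT : 1 ≤ T) (hκ : 0 ≤ κ) (hb : 0 ≤ b)
    (hy : 0 ≤ y) (hy1 : y ≤ 1) {ℒ s A Q E : ℝ} (r : ℕ) {k : ℕ} (hk : 2 ≤ k)
    (hℒ : ℒ ^ 2 * ρ ^ 2 ≤ (5 * s * T) ^ 2) (hA₁ : 2 * κ + 3 * κ ^ 2 / (2 * ξ) ≤ A)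
    (hA₂ : (50 * γ * s ^ 2 + ξ ^ 2 * (1 + 2 * Real.log (1 + 1 / γ))) / ξ ≤ A) (hQ : A * T ^ 2 ≤ Q)
    (hE : E ≤ 2 * b * (κ * T * y) + 3 * (κ * T * y) ^ 2 / (2 * ξ)
      + r * (γ * ℒ ^ 2 * ρ ^ 2 + ξ ^ 2 * b ^ 2 * Real.log (1 + k / γ)) / (2 * ξ * k)) :
    E ≤ Q * (1 + b) ^ 2 * (r * Real.log k / k + y) := by
  have hlog := Real.log_natCast_nonneg k
  have hk0 : (0 : ℝ) < k := by exact_mod_cast (by omega : 0 < k)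
  have hz : 0 ≤ (r : ℝ) * Real.log k / k := by positivity
  have hhalf : r * (γ * ℒ ^ 2 * ρ ^ 2 + ξ ^ 2 * b ^ 2 * Real.log (1 + k / γ)) / (2 * ξ * k)
      ≤ r * (γ * ℒ ^ 2 * ρ ^ 2 + ξ ^ 2 * b ^ 2 * Real.log (1 + k / γ)) / (ξ * k) := by
    have : 0 ≤ Real.log (1 + k / γ) := Real.log_nonneg (by
      have : 0 ≤ k / γ := by positivity
      linarith)
    gcongr
    linarith
  calc E ≤ (2 * κ + 3 * κ ^ 2 / (2 * ξ)) * T ^ 2 * (1 + b) ^ 2 * y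
        + (50 * γ * s ^ 2 + ξ ^ 2 * (1 + 2 * Real.log (1 + 1 / γ))) / ξ * T ^ 2 * (1 + b) ^ 2
          * (r * Real.log k / k) :=
        hE.trans (add_le_add (first_order_error_le hξ hT hκ hb hy hy1)
          (hhalf.trans (rank_term_le hξ hγ hb hT r hk hℒ)))
    _ ≤ A * T ^ 2 * (1 + b) ^ 2 * y + A * T ^ 2 * (1 + b) ^ 2 * (r * Real.log k / k) := by gcongr
    _ = A * T ^ 2 * ((1 + b) ^ 2 * (r * Real.log k / k + y)) := by ring
    _ ≤ Q * ((1 + b) ^ 2 * (r * Real.log k / k + y)) :=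
        mul_le_mul_of_nonneg_right hQ (by positivity)
    _ = _ := by ring

theorem le_mul_of_second_order_le (hξ : 0 < ξ) (hγ : 0 < γ) (hT : 1 ≤ T) (hb : 0 ≤ b)
    (hD : 0 ≤ D) (hyz : y ^ 2 ≤ 2 * z) {ℒ s A Q E : ℝ} (hA : 0 ≤ A) (r : ℕ) {k : ℕ} (hk : 2 ≤ k)
    (hℒ : ℒ ^ 2 * ρ ^ 2 ≤ (5 * s * T) ^ 2) (hA₁ : (3 * ξ + 3 / ξ) * (2 * κ ^ 2) ≤ A)
    (hA₂ : (50 * γ * s ^ 2 + ξ ^ 2 * (1 + 2 * Real.log (1 + 1 / γ))) / ξ ≤ A) (hQ : A * T ^ 2 ≤ Q)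
    (hE : E ≤ 3 * ξ * D ^ 2 * (κ * T * y) ^ 2 + 3 * (κ * T * y) ^ 2 / ξ
      + r * (γ * ℒ ^ 2 * ρ ^ 2 + ξ ^ 2 * b ^ 2 * Real.log (1 + k / γ)) / (ξ * k)) :
    E ≤ Q * (1 + b + D) ^ 2 * (r * Real.log k / k + z) := by
  have hlog := Real.log_natCast_nonneg k
  have hr : 0 ≤ (r : ℝ) * Real.log k / k := by positivity
  have hz : 0 ≤ z := by linarith [(sq_nonneg y).trans hyz]
  have hbD : 1 + b ≤ 1 + b + D := by linarith
  calc E ≤ (3 * ξ + 3 / ξ) * (2 * κ ^ 2) * T ^ 2 * (1 + b + D) ^ 2 * z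
        + (50 * γ * s ^ 2 + ξ ^ 2 * (1 + 2 * Real.log (1 + 1 / γ))) / ξ * T ^ 2 * (1 + b) ^ 2
          * (r * Real.log k / k) :=
        hE.trans (add_le_add (second_order_error_le hξ hb hD hyz)
          (rank_term_le hξ hγ hb hT r hk hℒ))
    _ ≤ A * T ^ 2 * (1 + b + D) ^ 2 * z
        + A * T ^ 2 * (1 + b + D) ^ 2 * (r * Real.log k / k) := by gcongr
    _ = A * T ^ 2 * ((1 + b + D) ^ 2 * (r * Real.log k / k + z)) := by ring
    _ ≤ Q * ((1 + b + D) ^ 2 * (r * Real.log k / k + z)) :=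
        mul_le_mul_of_nonneg_right hQ (by positivity)
    _ = _ := by ring

end Numerics

/-! ### The main result -/

section Main

variable {σ : ℝ → ℝ} {σ₀ σ₁ σ₂ : ℝ} {d h : ℕ} {ω : Fin h → EuclideanSpace ℝ (Fin (d + 1))}
  {ρ a : ℝ}

/-- The mean square bound makes the set bounded above, so that `sSup` is a true supremum and not a
default value. -/
theorem norm_gradient_le_lipPred (hσ : IsActivation σ σ₀ σ₁ σ₂) (hh : 0 < h)
    (ha : (1 / (h : ℝ)) * ∑ i, ω i 0 ^ 2 ≤ a) {w : Params (2 * h) d}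
    (hw : w ∈ Metric.closedBall (symInit ω) ρ) {x : EuclideanSpace ℝ (Fin d)} (hx : ‖x‖ ≤ 1) :
    ‖∇ (fun u => network σ (2 * h) d u x) w‖
      ≤ lipPred (network σ (2 * h) d) (Metric.closedBall (symInit ω) ρ) := by
  refine le_csSup ⟨√(σ₀ ^ 2 + σ₁ ^ 2 * (2 * (a + ρ ^ 2))), ?_⟩ ⟨w, hw, x, hx, rfl⟩
  rintro r ⟨w, hw, x, hx, rfl⟩
  exact norm_gradient_network_le_of_mem_closedBall hσ hh ha hw hx

theorem lipPred_nonneg (φ : Params (2 * h) d → EuclideanSpace ℝ (Fin d) → ℝ)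
    (C : Set (Params (2 * h) d)) : 0 ≤ lipPred φ C :=
  Real.sSup_nonneg (by rintro r ⟨w, _, x, _, rfl⟩; exact norm_nonneg _)

theorem lipPred_le (hσ : IsActivation σ σ₀ σ₁ σ₂) (hh : 0 < h)
    (ha : (1 / (h : ℝ)) * ∑ i, ω i 0 ^ 2 ≤ a) :
    lipPred (network σ (2 * h) d) (Metric.closedBall (symInit ω) ρ)
      ≤ √(σ₀ ^ 2 + σ₁ ^ 2 * (2 * (a + ρ ^ 2))) := by
  refine Real.sSup_le ?_ (Real.sqrt_nonneg _)
  rintro r ⟨w, hw, x, hx, rfl⟩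
  exact norm_gradient_network_le_of_mem_closedBall hσ hh ha hw hx

theorem abs_network_le_supPred (hσ : IsActivation σ σ₀ σ₁ σ₂) (hh : 0 < h)
    (ha : (1 / (h : ℝ)) * ∑ i, ω i 0 ^ 2 ≤ a) (hρ : 0 ≤ ρ) {w : Params (2 * h) d}
    (hw : w ∈ Metric.closedBall (symInit ω) ρ) {x : EuclideanSpace ℝ (Fin d)} (hx : ‖x‖ ≤ 1) :
    |network σ (2 * h) d w x|
      ≤ supPred (network σ (2 * h) d) (Metric.closedBall (symInit ω) ρ) := by
  refine le_csSup ⟨√(σ₀ ^ 2 + σ₁ ^ 2 * (2 * (a + ρ ^ 2))) * ρ, ?_⟩ ⟨w, hw, x, hx, rfl⟩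
  rintro r ⟨w, hw, x, hx, rfl⟩
  exact abs_network_le_of_mem_closedBall hσ hh ha hρ hw hx

theorem supPred_le (hσ : IsActivation σ σ₀ σ₁ σ₂) (hh : 0 < h)
    (ha : (1 / (h : ℝ)) * ∑ i, ω i 0 ^ 2 ≤ a) (hρ : 0 ≤ ρ) :
    supPred (network σ (2 * h) d) (Metric.closedBall (symInit ω) ρ)
      ≤ √(σ₀ ^ 2 + σ₁ ^ 2 * (2 * (a + ρ ^ 2))) * ρ := by
  refine Real.sSup_le ?_ (mul_nonneg (Real.sqrt_nonneg _) hρ)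
  rintro r ⟨w, hw, x, hx, rfl⟩
  exact abs_network_le_of_mem_closedBall hσ hh ha hρ hw hx

variable {n B : ℕ} {Z : Set (Sample d)} {ν ξ : ℝ} {β : Set ℝ → ℝ≥0} {ℓ : ℝ → Sample d → ℝ}
  {s : Fin n → Sample d} {Ω : Type*} [MeasurableSpace Ω] {P : Measure Ω} [IsProbabilityMeasure P]
  {I : ℕ → Ω → Finset (Fin n)} {v : Params (2 * h) d} {α γ τ ε : ℝ} {k : ℕ}

theorem network_mem_predRange (hσ : IsActivation σ σ₀ σ₁ σ₂) (hh : 0 < h)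
    (ha : (1 / (h : ℝ)) * ∑ i, ω i 0 ^ 2 ≤ a) (hρ : 0 ≤ ρ) {w : Params (2 * h) d}
    (hw : w ∈ Metric.closedBall (symInit ω) ρ) {x : EuclideanSpace ℝ (Fin d)} (hx : ‖x‖ ≤ 1) :
    network σ (2 * h) d w x
      ∈ predRange (network σ (2 * h) d) (Metric.closedBall (symInit ω) ρ) :=
  abs_le.mp ((abs_network_le_supPred hσ hh ha hρ hw hx).trans (le_max_right _ _))

theorem expRisk_le (hσ : IsActivation σ σ₀ σ₁ σ₂) (hh : 0 < h)
    (ha : (1 / (h : ℝ)) * ∑ i, ω i 0 ^ 2 ≤ a) (hρ : 0 ≤ ρ)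
    (hI : IsBatchSampling P B I) (hB : 1 ≤ B) (hBn : B ≤ n)
    (hℓ : IsLoss Z ν β ℓ) (hξν : 2 / ν ≤ ξ) (hs : ∀ j, s j ∈ Z) (hx : ∀ j, ‖(s j).1‖ ≤ 1)
    (hy : ∀ j, ℓ (s j).2 (s j) = 0) (hα : 0 < α) (hγ : 0 < γ) (hv : ‖v‖ ≤ ρ)
    (hτ : IsNearlyLinearOn (network σ (2 * h) d) s (Metric.closedBall (symInit ω) ρ) τ)
    (hτε : τ ≤ ε) (hε : ∀ w ∈ Metric.closedBall (symInit ω) ρ, ∀ j,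
      |network σ (2 * h) d w (s j).1
        - ⟪∇ (fun u => network σ (2 * h) d u (s j).1) w, w - (symInit ω + v)⟫ - (s j).2| ≤ ε)
    (hk : 0 < k) :
    expRisk P σ ℓ s ρ ξ γ α B I (symInit ω) k
      ≤ 2 * β (predRange (network σ (2 * h) d) (Metric.closedBall (symInit ω) ρ)) * ε
        + 3 * ε ^ 2 / (2 * ξ)
        + runRank P σ ℓ s ρ ξ γ α B I (symInit ω) k
        * (γ * lipPred (network σ (2 * h) d) (Metric.closedBall (symInit ω) ρ) ^ 2 * ρ ^ 2
          + ξ ^ 2 * β (predRange (network σ (2 * h) d) (Metric.closedBall (symInit ω) ρ)) ^ 2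
            * Real.log (1 + k / γ)) / (2 * ξ * k) :=
  integral_empRisk_average_le (v := symInit ω + v) hI hB hBn (isCompact_closedBall _ _)
    (convex_closedBall _ _) (Metric.mem_closedBall_self hρ)
    (by rw [mem_closedBall_iff_norm, add_sub_cancel_left]; exact hv) hℓ hξν hs hy hα hγ
    (lipPred_nonneg _ _) (by rw [sub_add_cancel_left, norm_neg]; exact hv)
    (fun _ hw j => norm_gradient_le_lipPred hσ hh ha hw (hx j))
    (zero_lt_one.trans_le (le_max_left _ _))
    (fun _ hw j => network_mem_predRange hσ hh ha hρ hw (hx j)) hτ hτε hε hk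

theorem expRisk_le_of_abs_deriv_le (hσ : IsActivation σ σ₀ σ₁ σ₂) (hh : 0 < h)
    (ha : (1 / (h : ℝ)) * ∑ i, ω i 0 ^ 2 ≤ a) (hρ : 0 ≤ ρ)
    (hI : IsBatchSampling P B I) (hB : 1 ≤ B) (hBn : B ≤ n)
    (hℓ : IsLoss Z ν β ℓ) (hξν : 2 / ν ≤ ξ) (hs : ∀ j, s j ∈ Z) (hx : ∀ j, ‖(s j).1‖ ≤ 1)
    (hy1 : ∀ j, |(s j).2| ≤ 1)
    (hy : ∀ j, ℓ (s j).2 (s j) = 0) (hα : 0 < α) (hγ : 0 < γ) (hv : ‖v‖ ≤ ρ) {D : ℝ}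
    (hD : ∀ j, ∀ t ∈ predRange (network σ (2 * h) d) (Metric.closedBall (symInit ω) ρ),
      |deriv (fun r => ℓ r (s j)) t| ≤ D * |t - (s j).2|)
    (hτ : IsNearlyLinearOn (network σ (2 * h) d) s (Metric.closedBall (symInit ω) ρ) τ)
    (hτε : τ ≤ ε) (hε : ∀ w ∈ Metric.closedBall (symInit ω) ρ, ∀ j,
      |network σ (2 * h) d w (s j).1
        - ⟪∇ (fun u => network σ (2 * h) d u (s j).1) w, w - (symInit ω + v)⟫ - (s j).2| ≤ ε)
    (hk : 0 < k) :
    expRisk P σ ℓ s ρ ξ γ α B I (symInit ω) k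
      ≤ 3 * ξ * D ^ 2 * ε ^ 2 + 3 * ε ^ 2 / ξ
        + runRank P σ ℓ s ρ ξ γ α B I (symInit ω) k
        * (γ * lipPred (network σ (2 * h) d) (Metric.closedBall (symInit ω) ρ) ^ 2 * ρ ^ 2
          + ξ ^ 2 * β (predRange (network σ (2 * h) d) (Metric.closedBall (symInit ω) ρ)) ^ 2
            * Real.log (1 + k / γ)) / (ξ * k) :=
  integral_empRisk_average_le_of_abs_deriv_le (v := symInit ω + v) hI hB hBn
    (isCompact_closedBall _ _) (convex_closedBall _ _) (Metric.mem_closedBall_self hρ)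
    (by rw [mem_closedBall_iff_norm, add_sub_cancel_left]; exact hv) hℓ hξν hs hy hα hγ
    (lipPred_nonneg _ _) (by rw [sub_add_cancel_left, norm_neg]; exact hv)
    (fun _ hw j => norm_gradient_le_lipPred hσ hh ha hw (hx j))
    (zero_lt_one.trans_le (le_max_left _ _))
    (fun _ hw j => network_mem_predRange hσ hh ha hρ hw (hx j))
    (fun j => abs_le.mp ((hy1 j).trans (le_max_left _ _))) hD hτ hτε hε hk

/-- The constant in front of the deterministic linearization and sampling errors. -/
noncomputable def errConst (S : ℝ) : ℝ := 56 * S + 4 * (1 + S) * (4 * Real.exp 12 + 2)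

theorem errConst_nonneg {S : ℝ} (hS : 0 ≤ S) : 0 ≤ errConst S := by
  unfold errConst
  positivity

variable {g : EuclideanSpace ℝ (Fin (d + 1)) → ℝ}
  {t : EuclideanSpace ℝ (Fin (d + 1)) → EuclideanSpace ℝ (Fin d)} {L q A Q : ℝ}

theorem lipPred_sq_mul_sq_le (hσ : IsActivation σ σ₀ σ₁ σ₂) (hh : 0 < h) (hρ : 0 ≤ ρ) (hL : 1 ≤ L)
    (ha : (1 / (h : ℝ)) * ∑ i, ω i 0 ^ 2 ≤ a) (haL : a ≤ 12 * L) :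
    lipPred (network σ (2 * h) d) (Metric.closedBall (symInit ω) ρ) ^ 2 * ρ ^ 2
      ≤ (5 * (σ₀ + σ₁ + σ₂) * ((1 + ρ) ^ 3 * L)) ^ 2 := by
  have h₀ := hσ.nonneg₀
  have h₁ := hσ.nonneg₁
  have h₂ := hσ.nonneg₂
  have hle := (lipPred_le (ρ := ρ) hσ hh ha).trans (lipschitz_sq_le h₀ h₁ h₂ hρ hL haL)
  have hnn := lipPred_nonneg (network σ (2 * h) d) (Metric.closedBall (symInit ω) ρ)
  rw [← mul_pow]
  refine pow_le_pow_left₀ (mul_nonneg hnn hρ) ?_ 2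
  calc _ ≤ 5 * (σ₀ + σ₁ + σ₂) * ((1 + ρ) * L) * (1 + ρ) :=
        mul_le_mul hle (by linarith) hρ (by positivity)
    _ = 5 * (σ₀ + σ₁ + σ₂) * ((1 + ρ) ^ 2 * L) := by ring
    _ ≤ _ := by
        gcongr
        · linarith
        · norm_num

theorem supPred_le_mul (hσ : IsActivation σ σ₀ σ₁ σ₂) (hh : 0 < h) (hρ : 0 ≤ ρ) (hL : 1 ≤ L)
    (ha : (1 / (h : ℝ)) * ∑ i, ω i 0 ^ 2 ≤ a) (haL : a ≤ 12 * L) :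
    supPred (network σ (2 * h) d) (Metric.closedBall (symInit ω) ρ)
      ≤ 5 * (σ₀ + σ₁ + σ₂) * ((1 + ρ) ^ 3 * L) := by
  have h₀ := hσ.nonneg₀
  have h₁ := hσ.nonneg₁
  have h₂ := hσ.nonneg₂
  calc supPred (network σ (2 * h) d) (Metric.closedBall (symInit ω) ρ)
      ≤ √(σ₀ ^ 2 + σ₁ ^ 2 * (2 * (a + ρ ^ 2))) * ρ := supPred_le hσ hh ha hρ
    _ ≤ 5 * (σ₀ + σ₁ + σ₂) * ((1 + ρ) * L) * (1 + ρ) :=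
        mul_le_mul (lipschitz_sq_le h₀ h₁ h₂ hρ hL haL) (by linarith) hρ (by positivity)
    _ = 5 * (σ₀ + σ₁ + σ₂) * ((1 + ρ) ^ 2 * L) := by ring
    _ ≤ _ := by
        gcongr
        · linarith
        · norm_num

theorem abs_linearization_sub_label_le (hσ : IsActivation σ σ₀ σ₁ σ₂) (hh : 0 < h) (hρ : 0 ≤ ρ)
    (hL : 1 ≤ L) (hq : 1 ≤ 2 * q) (hb : ∀ i, |ω i 0| ≤ 5 * L * q) (hv : ‖transport g t ω‖ ≤ ρ)
    {l : ℝ} (hl : l ≤ 2 * L) {x : EuclideanSpace ℝ (Fin d)} (hx : ‖x‖ ≤ 1) {u : ℝ}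
    (hu : |(1 / (h : ℝ)) * ∑ i, ntkFeature σ g t x (ω i) - u|
      ≤ (1 + (σ₀ + σ₁) * ρ) * (4 * Real.exp 12 + l) / √(h : ℝ))
    {w : Params (2 * h) d} (hw : w ∈ Metric.closedBall (symInit ω) ρ) :
    |network σ (2 * h) d w x
        - ⟪∇ (fun v => network σ (2 * h) d v x) w, w - (symInit ω + transport g t ω)⟫ - u|
      ≤ errConst (σ₀ + σ₁ + σ₂) * ((1 + ρ) ^ 3 * L) * (q / √((2 * h : ℕ) : ℝ)) := by
  have hm : (0 : ℝ) < (2 * h : ℕ) := by exact_mod_cast (by omega)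
  have hτ := linearization_error_le hσ.nonneg₀ hσ.nonneg₁ hσ.nonneg₂ hρ hL hq
    (Real.sqrt_pos.mpr hm)
  have hc := concentration_error_le hσ.nonneg₀ hσ.nonneg₁ hσ.nonneg₂ hρ hL hq hh
    (by positivity : 0 ≤ 4 * Real.exp 12) hl
  have e1 := abs_linearization_sub_mean_le (g := g) (t := t) hσ hh
    (by nlinarith : 0 ≤ 5 * L * q) hb hρ hv hw hx
  have e4 := abs_sub_le (network σ (2 * h) d w x
    - ⟪∇ (fun v => network σ (2 * h) d v x) w, w - (symInit ω + transport g t ω)⟫)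
    ((1 / (h : ℝ)) * ∑ i, ntkFeature σ g t x (ω i)) u
  unfold errConst
  linarith

theorem linearization_error_le_errConst (hσ : IsActivation σ σ₀ σ₁ σ₂) (hh : 0 < h) (hρ : 0 ≤ ρ)
    (hL : 1 ≤ L) (hq : 1 ≤ 2 * q) :
    (σ₁ + (5 * L * q + ρ) * σ₂) * (4 * ρ ^ 2) / √((2 * h : ℕ) : ℝ)
      ≤ errConst (σ₀ + σ₁ + σ₂) * ((1 + ρ) ^ 3 * L) * (q / √((2 * h : ℕ) : ℝ)) := by
  have h₀ := hσ.nonneg₀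
  have h₁ := hσ.nonneg₁
  have h₂ := hσ.nonneg₂
  have hm : (0 : ℝ) < (2 * h : ℕ) := by exact_mod_cast (by omega)
  refine (linearization_error_le h₀ h₁ h₂ hρ hL hq (Real.sqrt_pos.mpr hm)).trans ?_
  have hq0 : 0 ≤ q := by linarith
  have hE : 28 * (σ₀ + σ₁ + σ₂) ≤ errConst (σ₀ + σ₁ + σ₂) := by
    unfold errConst
    have : 0 ≤ 4 * (1 + (σ₀ + σ₁ + σ₂)) * (4 * Real.exp 12 + 2) := by positivity
    linarith
  gcongr

/-- The deterministic half of the result. Both linearization errors are at most `κ T y`, where `κ`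
is `errConst`, `T = (1 + ρ)³ L` and `y = √(log m) / √m`. Part (i) uses `y² ≤ 2 / √m` and part (ii)
uses `y² ≤ y`. -/
theorem expRisk_le_of_concentrated (hσ : IsActivation σ σ₀ σ₁ σ₂) (hh : 0 < h)
    (hI : IsBatchSampling P B I) (hB : 1 ≤ B) (hBn : B ≤ n) (hℓ : IsLoss Z ν β ℓ) (hξν : 2 / ν ≤ ξ)
    (hs : ∀ j, s j ∈ Z) (hx : ∀ j, ‖(s j).1‖ ≤ 1) (hy1 : ∀ j, |(s j).2| ≤ 1)
    (hy : ∀ j, ℓ (s j).2 (s j) = 0) (hγ : 0 < γ) (hρ : 0 ≤ ρ) (hL : 1 ≤ L)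
    (ha : (1 / (h : ℝ)) * ∑ i, ω i 0 ^ 2 ≤ a) (haL : a ≤ 12 * L)
    (hb : ∀ i, |ω i 0| ≤ 5 * L * √(Real.log (2 * h : ℕ))) (hv : ‖transport g t ω‖ ≤ ρ)
    {l : ℝ} (hl : l ≤ 2 * L)
    (hu : ∀ j, |(1 / (h : ℝ)) * ∑ i, ntkFeature σ g t (s j).1 (ω i) - (s j).2|
      ≤ (1 + (σ₀ + σ₁) * ρ) * (4 * Real.exp 12 + l) / √(h : ℝ))
    (hA₁ : 2 * errConst (σ₀ + σ₁ + σ₂) + 3 * errConst (σ₀ + σ₁ + σ₂) ^ 2 / (2 * ξ) ≤ A)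
    (hA₂ : (3 * ξ + 3 / ξ) * (2 * errConst (σ₀ + σ₁ + σ₂) ^ 2) ≤ A)
    (hA₃ : (50 * γ * (σ₀ + σ₁ + σ₂) ^ 2 + ξ ^ 2 * (1 + 2 * Real.log (1 + 1 / γ))) / ξ ≤ A)
    (hQ : A * ((1 + ρ) ^ 3 * L) ^ 2 ≤ Q) (hα : 0 < α) (hk : 2 ≤ k) :
    (∀ D : ℝ, 0 ≤ D →
      (∀ j, ∀ t ∈ predRange (network σ (2 * h) d) (Metric.closedBall (symInit ω) ρ),
        |deriv (fun r => ℓ r (s j)) t| ≤ D * |t - (s j).2|) →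
      expRisk P σ ℓ s ρ ξ γ α B I (symInit ω) k
        ≤ Q * (1 + β (predRange (network σ (2 * h) d) (Metric.closedBall (symInit ω) ρ)) + D) ^ 2
          * (runRank P σ ℓ s ρ ξ γ α B I (symInit ω) k * Real.log k / k
            + 1 / √((2 * h : ℕ) : ℝ))) ∧
    expRisk P σ ℓ s ρ ξ γ α B I (symInit ω) k
      ≤ Q * (1 + β (predRange (network σ (2 * h) d) (Metric.closedBall (symInit ω) ρ))) ^ 2
        * (runRank P σ ℓ s ρ ξ γ α B I (symInit ω) k * Real.log k / k
          + √(Real.log (2 * h : ℕ)) / √((2 * h : ℕ) : ℝ)) := by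
  have hS : 0 ≤ σ₀ + σ₁ + σ₂ := add_nonneg (add_nonneg hσ.nonneg₀ hσ.nonneg₁) hσ.nonneg₂
  have hκ := errConst_nonneg hS
  obtain ⟨hξ, -⟩ := hℓ.strongConvexity_bound hξν
  have hm : (0 : ℝ) < (2 * h : ℕ) := by exact_mod_cast (by omega)
  have hT : 1 ≤ (1 + ρ) ^ 3 * L :=
    one_le_mul_of_one_le_of_one_le (one_le_pow₀ (by linarith)) hL
  have hq := one_le_two_mul_sqrt_log hh
  have hℒ := lipPred_sq_mul_sq_le hσ hh hρ hL ha haL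
  have hy0 : 0 ≤ √(Real.log (2 * h : ℕ)) / √((2 * h : ℕ) : ℝ) := by positivity
  have hy1' : √(Real.log (2 * h : ℕ)) / √((2 * h : ℕ) : ℝ) ≤ 1 := sqrt_log_div_sqrt_le_one hm
  have hyz : (√(Real.log (2 * h : ℕ)) / √((2 * h : ℕ) : ℝ)) ^ 2
      ≤ 2 * (1 / √((2 * h : ℕ) : ℝ)) := by
    rw [div_pow, Real.sq_sqrt (Real.log_natCast_nonneg _), Real.sq_sqrt hm.le]
    exact log_div_le_two_div_sqrt hm
  have hnear : IsNearlyLinearOn (network σ (2 * h) d) s (Metric.closedBall (symInit ω) ρ)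
      ((σ₁ + (5 * L * √(Real.log (2 * h : ℕ)) + ρ) * σ₂) * (4 * ρ ^ 2) / √((2 * h : ℕ) : ℝ)) :=
    fun w hw w' hw' j =>
      abs_network_sub_linearization_le_of_mem_closedBall hσ (by positivity) hb hρ hw hw' (hx j)
  have hτε := linearization_error_le_errConst (h := h) hσ hh hρ hL hq
  have hε : ∀ w ∈ Metric.closedBall (symInit ω) ρ, ∀ j, |network σ (2 * h) d w (s j).1
      - ⟪∇ (fun v => network σ (2 * h) d v (s j).1) w, w - (symInit ω + transport g t ω)⟫
      - (s j).2| ≤ errConst (σ₀ + σ₁ + σ₂) * ((1 + ρ) ^ 3 * L)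
        * (√(Real.log (2 * h : ℕ)) / √((2 * h : ℕ) : ℝ)) := fun w hw j =>
    abs_linearization_sub_label_le hσ hh hρ hL hq hb hv hl (hx j) (hu j) hw
  have hk0 : 0 < k := by omega
  have hA : 0 ≤ A := by
    refine le_trans ?_ hA₁
    positivity
  refine ⟨fun D hD hDer => ?_, ?_⟩
  · exact le_mul_of_second_order_le hξ hγ hT (NNReal.coe_nonneg _) hD hyz hA _ hk hℒ hA₂ hA₃ hQ
      (expRisk_le_of_abs_deriv_le hσ hh ha hρ hI hB hBn hℓ hξν hs hx hy1 hy hα hγ hv hDer hnear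
        hτε hε hk0)
  · exact le_mul_of_first_order_le hξ hγ hT hκ (NNReal.coe_nonneg _) hy0 hy1' _ hk hℒ hA₁ hA₃ hQ
      (expRisk_le hσ hh ha hρ hI hB hBn hℓ hξν hs hx hy hα hγ hv hnear hτε hε hk0)

/-- The constant of the risk bounds. -/
noncomputable def riskConst (S ξ γ : ℝ) : ℝ :=
  5 * S + (2 * errConst S + 3 * errConst S ^ 2 / (2 * ξ)) + (3 * ξ + 3 / ξ) * (2 * errConst S ^ 2)
    + (50 * γ * S ^ 2 + ξ ^ 2 * (1 + 2 * Real.log (1 + 1 / γ))) / ξ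

theorem riskConst_spec {S A : ℝ} (hS : 0 ≤ S) (hξ : 0 < ξ) (hγ : 0 < γ)
    (hA : riskConst S ξ γ ≤ A) :
    5 * S ≤ A ∧ 2 * errConst S + 3 * errConst S ^ 2 / (2 * ξ) ≤ A
      ∧ (3 * ξ + 3 / ξ) * (2 * errConst S ^ 2) ≤ A
      ∧ (50 * γ * S ^ 2 + ξ ^ 2 * (1 + 2 * Real.log (1 + 1 / γ))) / ξ ≤ A := by
  have hκ := errConst_nonneg hS
  have hlog : 0 ≤ Real.log (1 + 1 / γ) := Real.log_nonneg (by
    have : 0 < 1 / γ := by positivity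
    linarith)
  have h1 : 0 ≤ 2 * errConst S + 3 * errConst S ^ 2 / (2 * ξ) := by positivity
  have h2 : 0 ≤ (3 * ξ + 3 / ξ) * (2 * errConst S ^ 2) := by positivity
  have h3 : 0 ≤ (50 * γ * S ^ 2 + ξ ^ 2 * (1 + 2 * Real.log (1 + 1 / γ))) / ξ := by positivity
  unfold riskConst at hA
  refine ⟨?_, ?_, ?_, ?_⟩ <;> linarith

/-- The bounds are quadratic in `T = (1 + ρ)³ L`; this is where the exponent `6` comes from. -/
theorem mul_sq_le_of_eq {c : ℝ} (hc : 0 ≤ c) (hρ : 0 ≤ ρ) (hL : 1 ≤ L)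
    (hQ : Q = c * L ^ 6 * (1 + ρ) ^ 6) : c * ((1 + ρ) ^ 3 * L) ^ 2 ≤ Q := by
  rw [hQ]
  calc c * ((1 + ρ) ^ 3 * L) ^ 2 = c * L ^ 2 * (1 + ρ) ^ 6 := by ring
    _ ≤ c * L ^ 6 * (1 + ρ) ^ 6 := by
        have := pow_le_pow_right₀ hL (show 2 ≤ 6 by norm_num)
        gcongr

theorem abs_coord_le {x δ : ℝ} (hh : 0 < h) (hn : 0 < n) (hδ : 0 < δ) (hδ1 : δ ≤ 1)
    (hx : x ^ 2 ≤ 4 * Real.log (8 * h / δ)) :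
    |x| ≤ 5 * (1 + Real.log (n / δ)) * √(Real.log (2 * h : ℕ)) := by
  have hL := log_div_nonneg_of_one_le hn hδ hδ1
  refine abs_le_of_sq_le_sq (hx.trans ?_) (by positivity)
  have hsq := Real.sq_sqrt (Real.log_natCast_nonneg (2 * h))
  rw [mul_pow, hsq]
  have hlog := Real.log_natCast_nonneg (2 * h)
  have := log_eight_mul_div_le hh hn hδ hδ1
  nlinarith [mul_nonneg hL hlog, mul_nonneg (mul_nonneg hL hL) hlog]

end Main

end SGN

theorem corollary1 :
    ∃ q : ℕ, ∀ σ₀ σ₁ σ₂ ξ γ : ℝ, 0 < γ → ∃ A : ℝ, 0 < A ∧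
      ∀ (d n B h : ℕ), 1 ≤ B → B ≤ n → 1 ≤ h →
      ∀ (σ : ℝ → ℝ), SGN.IsActivation σ σ₀ σ₁ σ₂ →
      ∀ (Z : Set (SGN.Sample d)) (ν : ℝ) (β : Set ℝ → ℝ≥0) (ℓ : ℝ → SGN.Sample d → ℝ),
      SGN.IsLoss Z ν β ℓ → 2 / ν ≤ ξ →
      ∀ (s : Fin n → SGN.Sample d), (∀ j, s j ∈ Z) → (∀ j, ‖(s j).1‖ ≤ 1) → (∀ j, |(s j).2| ≤ 1) →
      (∀ j, ℓ (s j).2 (s j) = 0) →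
      ∀ (vc vW : ℝ) (f : EuclideanSpace ℝ (Fin d) → ℝ), f ∈ SGN.ntkClass σ d vc vW →
      (∀ j, (s j).2 = f (s j).1) →
      ∀ (Ω : Type*) (_ : MeasurableSpace Ω) (P : Measure Ω), IsProbabilityMeasure P →
      ∀ (I : ℕ → Ω → Finset (Fin n)), SGN.IsBatchSampling P B I →
      ∀ δ : ℝ, 0 < δ → δ ≤ 1 →
      ∀ (ρ Q : ℝ), ρ = √(vc ^ 2 + vW ^ 2) →
      Q = A * (1 + Real.log (n / δ)) ^ q * (1 + ρ) ^ q →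
      SGN.initLaw h d {u | ¬
        (SGN.supPred (SGN.network σ (2 * h) d) (Metric.closedBall (SGN.symInit u) ρ) ≤ Q ∧
        ∀ K : Set ℝ,
          K = SGN.predRange (SGN.network σ (2 * h) d) (Metric.closedBall (SGN.symInit u) ρ) →
        ∀ α : ℝ, 0 < α → ∀ k : ℕ, 2 ≤ k →
          (∀ D : ℝ, 0 ≤ D →
            (∀ j, ∀ t ∈ K, |deriv (fun r => ℓ r (s j)) t| ≤ D * |t - (s j).2|) →
            SGN.expRisk P σ ℓ s ρ ξ γ α B I (SGN.symInit u) k ≤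
              Q * (1 + β K + D) ^ 2 *
                (SGN.runRank P σ ℓ s ρ ξ γ α B I (SGN.symInit u) k * Real.log k / k
                  + 1 / √((2 * h : ℕ) : ℝ))) ∧
          SGN.expRisk P σ ℓ s ρ ξ γ α B I (SGN.symInit u) k ≤
            Q * (1 + β K) ^ 2 *
              (SGN.runRank P σ ℓ s ρ ξ γ α B I (SGN.symInit u) k * Real.log k / k
                + √(Real.log (2 * h : ℕ)) / √((2 * h : ℕ) : ℝ)))}
        ≤ ENNReal.ofReal δ := by
  -- The constant is chosen before an activation and a loss fix the signs of the `σ` bounds and of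
  -- `ξ`; the absolute value makes it positive regardless.
  refine ⟨6, fun σ₀ σ₁ σ₂ ξ γ hγ => ⟨1 + |SGN.riskConst (σ₀ + σ₁ + σ₂) ξ γ|, by positivity, ?_⟩⟩
  intro d n B h hB hBn hh σ hσ Z ν β ℓ hℓ hξν s hsZ hx hy hℓ0 vc vW f hf hfy Ω _ P _ I hI δ hδ hδ1
    ρ Q hρdef hQ
  obtain ⟨g, t, hgm, htm, hg, ht, rfl⟩ := hf
  have hn : 0 < n := hB.trans hBn
  have hρ : 0 ≤ ρ := hρdef ▸ Real.sqrt_nonneg _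
  have hL : 1 ≤ 1 + Real.log (n / δ) := by
    linarith [SGN.log_div_nonneg_of_one_le hn hδ hδ1]
  have hS : 0 ≤ σ₀ + σ₁ + σ₂ := add_nonneg (add_nonneg hσ.nonneg₀ hσ.nonneg₁) hσ.nonneg₂
  obtain ⟨hA₀, hA₁, hA₂, hA₃⟩ := SGN.riskConst_spec hS (hℓ.strongConvexity_bound hξν).1 hγ
    (show SGN.riskConst (σ₀ + σ₁ + σ₂) ξ γ ≤ 1 + |SGN.riskConst (σ₀ + σ₁ + σ₂) ξ γ| by
      linarith [le_abs_self (SGN.riskConst (σ₀ + σ₁ + σ₂) ξ γ)])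
  generalize 1 + |SGN.riskConst (σ₀ + σ₁ + σ₂) ξ γ| = A at *
  have hA : 0 ≤ A := le_trans (by positivity) hA₀
  have hQT := SGN.mul_sq_le_of_eq hA hρ hL hQ
  refine le_trans (measure_mono fun u hu => ?_) (SGN.initLaw_not_good_le (g := g) (t := t) hσ hh hn
    hδ hgm htm hg ht (x := fun j => (s j).1) hx)
  simp only [Set.mem_ofPred_eq] at hu ⊢
  refine fun hE => hu ?_
  obtain ⟨hE₁, hE₂, hE₃⟩ := hE
  rw [← hρdef] at hE₃
  have ha : 4 * (1 + Real.log (4 / δ)) ≤ 12 * (1 + Real.log (n / δ)) := by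
    linarith [SGN.log_four_div_le hn hδ hδ1]
  refine ⟨?_, ?_⟩
  · have hT : 1 ≤ (1 + ρ) ^ 3 * (1 + Real.log (n / δ)) :=
      one_le_mul_of_one_le_of_one_le (one_le_pow₀ (by linarith)) hL
    refine (SGN.supPred_le_mul hσ hh hρ hL hE₁ ha).trans (le_trans ?_ hQT)
    exact mul_le_mul hA₀ (le_self_pow₀ hT two_ne_zero) (zero_le_one.trans hT) hA
  · intro K hK α hα k hk
    rw [hK]
    exact SGN.expRisk_le_of_concentrated hσ hh hI hB hBn hℓ hξν hsZ hx hy hℓ0 hγ hρ hL hE₁ ha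
      (fun i => SGN.abs_coord_le hh hn hδ hδ1 (hE₂ i))
      (hρdef ▸ SGN.norm_transport_le hh hg ht u) (SGN.log_four_mul_div_le hn hδ hδ1)
      (fun j => by rw [hfy j]; exact hE₃ j) hA₁ hA₂ hA₃ hQT hα hk
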